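/- Let $n\ge 3$. Let $Q_n=\mathbb{R}^{\binom n2}/\{(a_i+a_j)_{i<j} : a\in\mathbb{R}^n\}$. For $I\subset\{1,\dots,n\}$ with $2\le |I|\le n-2$ let $v_I\in Q_n$ be the class of the vector whose $\{i,j\}$-coordinate is $1$ if exactly one of $i,j$ lies in $I$, and $0$ otherwise (so $v_I=v_{I^c}$), and let $\Lambda_n\subset Q_n$ be the lattice generated by all $v_I$. Call $I$ and $J$ compatible if $I\cap J$, $I\cap J^c$, $I^c\cap J$ or $I^c\cap J^c$ is empty. Let $\mathcal{M}_{0,n}$ be the $(n-3)$-dimensional fan in $Q_n$ whose cones are the cones generated by $\{v_I : I\in\mathcal{F}\}$, for all families $\mathcal{F}$ of pairwise compatible sets (the combinatorial types of rational $n$-marked tropical curves), with all weights equal to $1$. A tropical fan of dimension $k$ in a real vector space with lattice $\Lambda$ is a finite, pure $k$-dimensional fan $X$ of rational polyhedral cones with non-zero rational weights $w(\sigma)$ on its $k$-dimensional cones that satisfies the balancing condition $\sum_{\sigma>\tau}w(\sigma)\,u_{\sigma/\tau}\in V_\tau$ at every $(k-1)$-dimensional cone $\tau$, where $V_\tau$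 is the linear span of $\tau$, the sum runs over the $k$-dimensional cones $\sigma$ of $X$ that have $\tau$ as a face, and $u_{\sigma/\tau}$ is the primitive normal vector of $\sigma$ relative to $\tau$. A non-zero tropical fan $X$ is (globally) irreducible if there is no non-zero tropical fan $Y$ of the same dimension with $|Y|\subsetneq|X|$. It is locally irreducible if at every $(k-1)$-dimensional cone $\tau$ every rational solution $(a_\sigma)_{\sigma>\tau}$ of the balancing condition at $\tau$ is a multiple of $(w(\sigma))_{\sigma>\tau}$. For $n>3$ and $S\subset\{1,\dots,n\}$ with $2\le|S|\le n-2$, let $\varphi^S$ be the function on $\mathcal{M}_{0,n}$ that is linear on every cone and satisfies $\varphi^S(v_S)=1$ and $\varphi^S(v_I)=0$ for $I\ne S,S^c$. The vital divisor $D^S$ is the divisor of $\varphi^S$ on $\mathcal{M}_{0,n}$: it consists of the $(n-4)$-dimensional cones $\tau$ of $\mathcal{M}_{0,n}$ for which $$w(\tau)=\sum_{\sigma>\tau}\varphi^S(u_{\sigma/\tau})-\varphi^S_\tau\Bigl(\sum_{\sigma>\tau}u_{\sigma/\tau}\Bigr)$$ is non-zero (with the representatives $u_{\sigma/\tau}$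 chosen in $\sigma$, and with $\varphi^S_\tau$ the linear extension of $\varphi^S|_\tau$ to $V_\tau$), taken with the weight $w(\tau)$, and of all their faces. Proposition. For every $n>3$ and every $S\subset\{1,\dots,n\}$ with $2\le|S|\le n-2$, the vital divisor $D^S$ in $\mathcal{M}_{0,n}$ is a non-zero tropical fan that is globally irreducible. It need not be locally irreducible: the divisor $D^{\{1,2,3\}}$ in $\mathcal{M}_{0,6}$ is not locally irreducible. -/

import Mathlib

/-! ## Weighted fans, tropical fans, irreducibility

Throughout, `V` is a real vector space and `Λ` an additive subgroup of `V`, the lattice. -/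

namespace TropM

section Fans

variable {V : Type*} [AddCommGroup V] [Module ℝ V]

/-- The linear span `V_σ` of a cone. -/
def linSpan (σ : PointedCone ℝ V) : Submodule ℝ V := Submodule.span ℝ (σ : Set V)

/-- The dimension of a cone. -/
noncomputable def coneDim (σ : PointedCone ℝ V) : ℕ := Module.finrank ℝ (linSpan σ)

/-- Rational polyhedral cones: those generated by finitely many lattice vectors. -/
def IsRationalCone (Λ : AddSubgroup V) (σ : PointedCone ℝ V) : Prop :=
  ∃ s : Finset V, (∀ x ∈ s, x ∈ Λ) ∧ PointedCone.hull ℝ (s : Set V) = σ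

/-- `u` represents the primitive normal vector `u_{σ/τ}` of the cone `σ` relative to its
codimension-1 face `τ`: it is a lattice vector in `σ`, and its class generates the group
`(Λ ∩ V_σ) / (Λ ∩ V_τ)`. -/
def IsPrimitiveNormal (Λ : AddSubgroup V) (τ σ : PointedCone ℝ V) (u : V) : Prop :=
  u ∈ Λ ∧ u ∈ σ ∧ ∀ x ∈ Λ, x ∈ linSpan σ → ∃ m : ℤ, x - m • u ∈ linSpan τ

/-- The data of a weighted fan: a dimension, a finite set of cones, and a weight for the cones of
top dimension (the values of `weight` on other cones play no role). -/
structure WeightedFan (V : Type*) [AddCommGroup V] [Module ℝ V] where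
  dim : ℕ
  cones : Finset (PointedCone ℝ V)
  weight : PointedCone ℝ V → ℝ

namespace WeightedFan

/-- The support `|X|`: the union of all cones. -/
def support (X : WeightedFan V) : Set V := ⋃ σ ∈ X.cones, (σ : Set V)

open Classical in
/-- The cones `σ > τ` of `X` with `dim σ = dim τ + 1`. -/
noncomputable def star (X : WeightedFan V) (τ : PointedCone ℝ V) : Finset (PointedCone ℝ V) :=
  X.cones.filter fun σ => coneDim σ = coneDim τ + 1 ∧ τ.IsFaceOf σ

/-- The balancing condition `∑_{σ > τ} w(σ) u_{σ/τ} = 0 mod V_τ` at `τ`, for weights `w`.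
(It does not depend on the choice of the representatives of the normal vectors.) -/
def BalancedAt (Λ : AddSubgroup V) (X : WeightedFan V) (w : PointedCone ℝ V → ℝ)
    (τ : PointedCone ℝ V) : Prop :=
  ∃ u : PointedCone ℝ V → V, (∀ σ ∈ X.star τ, IsPrimitiveNormal Λ τ σ (u σ)) ∧
    ∑ σ ∈ X.star τ, w σ • u σ ∈ linSpan τ

/-- Tropical fans: pure-dimensional rational polyhedral fans with non-zero rational weights on the
top-dimensional cones, satisfying the balancing condition in codimension 1. -/
structure IsTropicalFan (Λ : AddSubgroup V) (X : WeightedFan V) : Prop where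
  rational : ∀ σ ∈ X.cones, IsRationalCone Λ σ
  face_mem : ∀ σ ∈ X.cones, ∀ τ : PointedCone ℝ V, τ.IsFaceOf σ → τ ∈ X.cones
  inter_face : ∀ σ ∈ X.cones, ∀ σ' ∈ X.cones, (σ ⊓ σ').IsFaceOf σ
  pure : ∀ τ ∈ X.cones, ∃ σ ∈ X.cones, coneDim σ = X.dim ∧ τ.IsFaceOf σ
  weight_ne_zero : ∀ σ ∈ X.cones, coneDim σ = X.dim → X.weight σ ≠ 0
  weight_rat : ∀ σ ∈ X.cones, coneDim σ = X.dim → ∃ q : ℚ, X.weight σ = q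
  balanced : ∀ τ ∈ X.cones, coneDim τ + 1 = X.dim → X.BalancedAt Λ X.weight τ

/-- (Global) irreducibility: `X` is a non-zero tropical fan, and there is no non-zero tropical fan
`Y` of the same dimension with `|Y| ⊊ |X|`. (The zero cycle is the fan without cones.) -/
def IsIrreducible (Λ : AddSubgroup V) (X : WeightedFan V) : Prop :=
  X.IsTropicalFan Λ ∧ X.cones.Nonempty ∧
    ¬ ∃ Y : WeightedFan V, Y.IsTropicalFan Λ ∧ Y.cones.Nonempty ∧ Y.dim = X.dim ∧
      Y.support ⊂ X.support

/-- Local irreducibility of a tropical fan: at each cone `τ` of codimension 1, the weights of the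
adjacent top-dimensional cones are, up to a common multiple, the only rational solution of the
balancing condition at `τ`. -/
def IsLocallyIrreducible (Λ : AddSubgroup V) (X : WeightedFan V) : Prop :=
  ∀ τ ∈ X.cones, coneDim τ + 1 = X.dim →
    ∀ a : PointedCone ℝ V → ℚ, X.BalancedAt Λ (fun σ => (a σ : ℝ)) τ →
      ∃ c : ℚ, ∀ σ ∈ X.star τ, (a σ : ℝ) = c * X.weight σ

end WeightedFan

open Classical in
/-- A chosen representative of the primitive normal vector `u_{σ/τ}` (`0` if there is none). -/
noncomputable def normalVec (Λ : AddSubgroup V) (τ σ : PointedCone ℝ V) : V :=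
  if h : ∃ u, IsPrimitiveNormal Λ τ σ u then h.choose else 0

open Classical in
/-- A linear map agreeing with `φ` on `τ`, hence determined on `V_τ` (`0` if there is none). -/
noncomputable def linExt (φ : V → ℝ) (τ : PointedCone ℝ V) : V →ₗ[ℝ] ℝ :=
  if h : ∃ f : V →ₗ[ℝ] ℝ, ∀ x ∈ τ, f x = φ x then h.choose else 0

namespace WeightedFan

/-- The weight of the codimension-1 cone `τ` in the divisor of `φ` on `X`:
`∑_{σ > τ} φ(w(σ) u_{σ/τ}) - φ_τ(∑_{σ > τ} w(σ) u_{σ/τ})`, where `φ` is linear on each cone and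
`φ_τ` is its linear extension from `τ` to `V_τ`. -/
noncomputable def divisorWeight (Λ : AddSubgroup V) (X : WeightedFan V) (φ : V → ℝ)
    (τ : PointedCone ℝ V) : ℝ :=
  ∑ σ ∈ X.star τ, X.weight σ * φ (normalVec Λ τ σ) -
    linExt φ τ (∑ σ ∈ X.star τ, X.weight σ • normalVec Λ τ σ)

open Classical in
/-- The divisor of the piecewise linear function `φ` on `X`: its cones are the codimension-1 cones
of `X` with non-zero `divisorWeight`, and all their faces. -/
noncomputable def divisor (Λ : AddSubgroup V) (X : WeightedFan V) (φ : V → ℝ) :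
    WeightedFan V where
  dim := X.dim - 1
  cones := X.cones.filter fun τ => ∃ ρ ∈ X.cones,
    coneDim ρ + 1 = X.dim ∧ X.divisorWeight Λ φ ρ ≠ 0 ∧ τ.IsFaceOf ρ
  weight := X.divisorWeight Λ φ

end WeightedFan

end Fans

/-! ## The moduli space of rational `n`-marked tropical curves -/

/-- Two-element subsets of the set of markings, as ordered pairs `i < j`. -/
abbrev Pairs (n : ℕ) : Type := {p : Fin n × Fin n // p.1 < p.2}

/-- The map `ℝⁿ → ℝ^(n choose 2)`, `a ↦ (a_i + a_j)_{i<j}`. -/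
def lineality (n : ℕ) : (Fin n → ℝ) →ₗ[ℝ] (Pairs n → ℝ) where
  toFun a := fun p => a p.1.1 + a p.1.2
  map_add' a b := by
    funext p
    simp only [Pi.add_apply]
    ring
  map_smul' c a := by
    funext p
    simp only [Pi.smul_apply, smul_eq_mul, RingHom.id_apply]
    ring

/-- The ambient space `ℝ^(n choose 2) / im(lineality)` of `M_{0,n}`. -/
abbrev Ambient (n : ℕ) : Type := (Pairs n → ℝ) ⧸ LinearMap.range (lineality n)

/-- The vector `v_I`: the class of the distance vector of the tropical curve with a single bounded
edge, of length 1, that separates the markings in `I` from those not in `I`. -/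
def splitVec {n : ℕ} (I : Finset (Fin n)) : Ambient n :=
  Submodule.Quotient.mk fun p => if (p.1.1 ∈ I ↔ p.1.2 ∈ I) then 0 else 1

/-- `I` and its complement have at least two elements. -/
def IsProper {n : ℕ} (I : Finset (Fin n)) : Prop := 2 ≤ I.card ∧ I.card + 2 ≤ n

/-- The splits `I | Iᶜ` and `J | Jᶜ` are compatible, i.e. they are both induced by edges of a
common tree: one of `I ∩ J`, `I ∩ Jᶜ`, `Iᶜ ∩ J`, `Iᶜ ∩ Jᶜ` is empty. -/
def Compatible {n : ℕ} (I J : Finset (Fin n)) : Prop :=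
  I ∩ J = ∅ ∨ I ⊆ J ∨ J ⊆ I ∨ I ∪ J = Finset.univ

/-- Combinatorial types of rational `n`-marked tropical curves, given by the splits of their bounded
edges: families of pairwise compatible proper splits. -/
def IsCombType {n : ℕ} (F : Finset (Finset (Fin n))) : Prop :=
  (∀ I ∈ F, IsProper I) ∧ ∀ I ∈ F, ∀ J ∈ F, Compatible I J

/-- The cone of all curves of the given combinatorial type and their degenerations. -/
def typeCone {n : ℕ} (F : Finset (Finset (Fin n))) : PointedCone ℝ (Ambient n) :=
  PointedCone.hull ℝ (splitVec '' (F : Set (Finset (Fin n))))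

/-- The lattice generated by the vectors `v_I`. -/
def lattice (n : ℕ) : AddSubgroup (Ambient n) :=
  AddSubgroup.closure {x | ∃ I : Finset (Fin n), IsProper I ∧ splitVec I = x}

open Classical in
/-- The fan `M_{0,n}`, of dimension `n - 3`, with all weights equal to 1. -/
noncomputable def M0 (n : ℕ) : WeightedFan (Ambient n) where
  dim := n - 3
  cones := (Finset.univ.filter fun F : Finset (Finset (Fin n)) => IsCombType F).image typeCone
  weight := fun _ => 1

/-- `x` is the point of `M_{0,n}` of a tropical curve in which, for each `I`, `c I` is the length of
a bounded edge inducing the split `I | Iᶜ` (`c I = 0` if there is no such edge). -/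
def IsCurve {n : ℕ} (x : Ambient n) (c : Finset (Fin n) → ℝ) : Prop :=
  (∃ F, IsCombType F ∧ ∀ I, I ∉ F → c I = 0) ∧ (∀ I, 0 ≤ c I) ∧ x = ∑ I, c I • splitVec I

open Classical in
/-- The function `φ^S` on `M_{0,n}`: the length of the bounded edge inducing the split `S | Sᶜ`.
It is linear on each cone, with value 1 at `v_S = v_{Sᶜ}` and 0 at all other `v_I`.
(It is extended by 0 outside of `M_{0,n}`.) -/
noncomputable def splitLength {n : ℕ} (S : Finset (Fin n)) (x : Ambient n) : ℝ :=
  if h : ∃ c, IsCurve x c then h.choose S + h.choose Sᶜ else 0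

/-- The vital divisor `D^S` in `M_{0,n}`: the divisor of the function `φ^S`. -/
noncomputable def vitalDivisor {n : ℕ} (S : Finset (Fin n)) : WeightedFan (Ambient n) :=
  (M0 n).divisor (lattice n) (splitLength S)

end TropM

/-!
Vital divisors are irreducible because they are connected through walls across which every tropical
subfan has to continue.

Call a wall `τ` of a fan `D` *rigid* if it has at least three adjacent top-dimensional cones and if in
every real solution of the balancing condition at `τ` either all or no coefficients vanish. Let `Y` be
a non-zero tropical fan of the same dimension with `|Y| ⊆ |D|`. If `|Y|` contains one interior point
of a top-dimensional cone of `D`, it contains the whole cone: along a generic segment in the cone, `Y`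
can end only at a wall of `Y`, which the balancing condition excludes
(`WeightedFan.IsTropicalFan.mem_support_of_meets_facet`). If `|Y|` contains one of the cones at a
rigid wall, it contains all of them, since the weights of `Y` around the wall solve the balancing
condition (`WeightedFan.IsTropicalFan.meets_star_of_isRigidWall`). Hence `D` is irreducible as soon as
its top-dimensional cones are connected through rigid walls
(`WeightedFan.IsTropicalFan.isIrreducible`).

Choosing a marking `r ∉ S` as a root turns combinatorial types into laminar families of subsets of
`{r}ᶜ`, read as rooted trees. For markings `i, j, k`, a combination of coordinates of
`ℝ^(n choose 2)` measures the length of the edges separating `i, j` from `k, r` minus that of the edges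
separating `i, k` from `j, r` (`exists_quartet_form`). These forms determine a tree and its edge
lengths, so that the cones of `M_{0,n}` are simplicial, meet in common faces, and have the `v_I` as
primitive normal vectors. The codimension-one cones of `M_{0,n}` belong to the trees with one 4-valent
vertex, which has three resolutions; the sum of their vectors is the sum of the four edges at this
vertex (`splitVec_union_add`), and up to multiples this is the only relation between them modulo the
span of the cone (`IsLaminar.eq_of_sum_resolutions_mem`).

The weight in `D^S` of a tree `F` with one 4-valent vertex is `1` if `S` is one of its resolutions,
and `0` if `S` is neither a resolution nor an edge of `F`. If `S` is an edge of `F`, it is minus the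
coefficient of `v_S` in the sum of the resolutions. The balancing condition for `D^S` follows from the
one for `M_{0,n}` and the symmetry of compatibility (`IsLaminar.sum_vitalWeight_mem`). Contracting the
edge `S` of a tree `H` with one 4-valent vertex gives a rigid wall of `D^S`
(`isRigidWall_vitalDivisor`): its adjacent cones are given by the three resolutions of `H` with `S`
contracted, and possibly by `H` itself. These walls connect the cones of weight `1` in the same way in
which exchanges of single edges connect the trivalent trees containing `S`, which is proved by
uncrossing (`reflTransGen_neighbours`); every cone that contains `v_S` is adjacent to cones of
weight `1` at such a wall.

In `M_{0,6}` with `S = {0, 1, 2}`, the tree with the single edge `S` has two 4-valent vertices. The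
cones of `D^S` around the ray of `v_S` resolve one or the other of them, and the sum of the normal
vectors of the three cones at either vertex is a multiple of `v_S` already. Hence the two groups of
cones can be given independent weights.
-/

/-! ### Geometry of polyhedral cones -/

namespace TropM
section ConeGeometry

open Filter Topology

variable {V : Type*} [AddCommGroup V] [Module ℝ V]

theorem le_linSpan (σ : PointedCone ℝ V) {x : V} (hx : x ∈ σ) : x ∈ linSpan σ :=
  Submodule.subset_span hx

theorem linSpan_mono {σ τ : PointedCone ℝ V} (h : σ ≤ τ) : linSpan σ ≤ linSpan τ :=
  Submodule.span_mono h

theorem mem_linSpan_iff {σ : PointedCone ℝ V} {w : V} :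
    w ∈ linSpan σ ↔ ∃ a ∈ σ, ∃ b ∈ σ, w = a - b := by
  constructor
  · intro hw
    induction hw using Submodule.span_induction with
    | mem x hx => exact ⟨x, hx, 0, σ.zero_mem, by simp⟩
    | zero => exact ⟨0, σ.zero_mem, 0, σ.zero_mem, by simp⟩
    | add x y _ _ hx hy =>
      obtain ⟨a, ha, b, hb, rfl⟩ := hx
      obtain ⟨a', ha', b', hb', rfl⟩ := hy
      exact ⟨a + a', σ.add_mem ha ha', b + b', σ.add_mem hb hb', by abel⟩
    | smul c x _ hx =>
      obtain ⟨a, ha, b, hb, rfl⟩ := hx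
      rcases le_total 0 c with hc | hc
      · exact ⟨c • a, σ.smul_mem hc ha, c • b, σ.smul_mem hc hb, smul_sub _ _ _⟩
      · exact ⟨(-c) • b, σ.smul_mem (by linarith) hb, (-c) • a, σ.smul_mem (by linarith) ha,
          by module⟩
  · rintro ⟨a, ha, b, hb, rfl⟩
    exact (linSpan σ).sub_mem (le_linSpan σ ha) (le_linSpan σ hb)

theorem mem_face_of_mem_linSpan {τ σ : PointedCone ℝ V} (h : τ.IsFaceOf σ) {x : V} (hx : x ∈ σ)
    (hxτ : x ∈ linSpan τ) : x ∈ τ := by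
  obtain ⟨a, ha, b, hb, rfl⟩ := mem_linSpan_iff.1 hxτ
  exact h.mem_of_add_mem_left hx (h.le hb) (by simpa using ha)

theorem face_eq_of_linSpan_le {τ σ : PointedCone ℝ V} (h : τ.IsFaceOf σ)
    (hs : linSpan σ ≤ linSpan τ) : τ = σ :=
  le_antisymm h.le fun _ hx => mem_face_of_mem_linSpan h hx (hs (le_linSpan σ hx))

theorem coneDim_mono [FiniteDimensional ℝ V] {σ τ : PointedCone ℝ V} (h : σ ≤ τ) :
    coneDim σ ≤ coneDim τ :=
  Submodule.finrank_mono (linSpan_mono h)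

theorem linSpan_eq_of_coneDim_le [FiniteDimensional ℝ V] {σ τ : PointedCone ℝ V}
    (h : linSpan σ ≤ linSpan τ) (hd : coneDim τ ≤ coneDim σ) : linSpan σ = linSpan τ :=
  Submodule.eq_of_le_of_finrank_le h hd

theorem face_eq_of_coneDim_le [FiniteDimensional ℝ V] {τ σ : PointedCone ℝ V} (h : τ.IsFaceOf σ)
    (hd : coneDim σ ≤ coneDim τ) : τ = σ :=
  face_eq_of_linSpan_le h (linSpan_eq_of_coneDim_le (linSpan_mono h.le) hd).ge

/-- A cone contains a point of it together with an initial piece of a ray from that point as soon as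
it contains one further point of the ray. -/
theorem eventually_mem_of_mem {σ : PointedCone ℝ V} {x z : V} {δ : ℝ} (hδ : 0 < δ) (hx : x ∈ σ)
    (h : x + δ • z ∈ σ) : ∀ᶠ ε in 𝓝[>] (0 : ℝ), x + ε • z ∈ σ := by
  filter_upwards [Ioc_mem_nhdsGT hδ] with ε hε
  have h1 : x + ε • z = (1 - ε / δ) • x + (ε / δ) • (x + δ • z) := by
    have : ε = (ε / δ) * δ := by field_simp
    rw [smul_add, smul_smul, ← this]; module
  rw [h1]
  have h2 : ε / δ ≤ 1 := (div_le_one hδ).2 hε.2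
  exact σ.add_mem (σ.smul_mem (by linarith) hx) (σ.smul_mem (div_pos hε.1 hδ).le h)

/-- The point `x` lies in the relative interior of the cone `σ`, phrased algebraically: from `x` one
can move a little in the direction opposite to any vector of `σ` without leaving `σ`. -/
def InRelint (σ : PointedCone ℝ V) (x : V) : Prop := x ∈ σ ∧ ∀ y ∈ σ, ∃ ε > (0 : ℝ), x - ε • y ∈ σ

theorem InRelint.eventually {σ : PointedCone ℝ V} {x w : V} (h : InRelint σ x)
    (hw : w ∈ linSpan σ) : ∀ᶠ ε in 𝓝[>] (0 : ℝ), x + ε • w ∈ σ := by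
  obtain ⟨a, ha, b, hb, rfl⟩ := mem_linSpan_iff.1 hw
  obtain ⟨δ, hδ, hm⟩ := h.2 b hb
  refine eventually_mem_of_mem hδ h.1 ?_
  have : x + δ • (a - b) = (x - δ • b) + δ • a := by module
  rw [this]
  exact σ.add_mem hm (σ.smul_mem hδ.le ha)

theorem InRelint.add_mem {σ : PointedCone ℝ V} {x y : V} (h : InRelint σ x) (hy : y ∈ σ) :
    InRelint σ (x + y) := by
  refine ⟨σ.add_mem h.1 hy, fun z hz => ?_⟩
  obtain ⟨ε, hε, hm⟩ := h.2 z hz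
  refine ⟨ε, hε, ?_⟩
  have : x + y - ε • z = (x - ε • z) + y := by abel
  rw [this]
  exact σ.add_mem hm hy

theorem InRelint.smul {σ : PointedCone ℝ V} {x : V} (h : InRelint σ x) {c : ℝ} (hc : 0 < c) :
    InRelint σ (c • x) := by
  refine ⟨σ.smul_mem hc.le h.1, fun z hz => ?_⟩
  obtain ⟨ε, hε, hm⟩ := h.2 z hz
  refine ⟨c * ε, mul_pos hc hε, ?_⟩
  rw [mul_smul, ← smul_sub]
  exact σ.smul_mem hc.le hm

/-- Proper convex combinations of a relative interior point and a point of the cone are relative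
interior points. -/
theorem InRelint.combo {σ : PointedCone ℝ V} {x y : V} (h : InRelint σ x) (hy : y ∈ σ) {t : ℝ}
    (ht0 : 0 ≤ t) (ht1 : t < 1) : InRelint σ (x + t • (y - x)) := by
  have : x + t • (y - x) = (1 - t) • x + t • y := by module
  rw [this]
  exact (h.smul (by linarith)).add_mem (σ.smul_mem ht0 hy)

theorem InRelint.eventually_inRelint {σ : PointedCone ℝ V} {x w : V} (h : InRelint σ x)
    (hw : w ∈ linSpan σ) : ∀ᶠ ε in 𝓝[>] (0 : ℝ), InRelint σ (x + ε • w) := by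
  filter_upwards [h.eventually ((linSpan σ).smul_mem 2 hw)] with ε hε
  convert h.combo hε (t := 1 / 2) (by norm_num) (by norm_num) using 1
  module

/-- Every point of a cone lies in the relative interior of some face of the cone, namely of the
smallest face containing it. -/
theorem exists_face_inRelint (σ : PointedCone ℝ V) {x : V} (hx : x ∈ σ) :
    ∃ τ : PointedCone ℝ V, τ.IsFaceOf σ ∧ InRelint τ x := by
  have hshrink : ∀ y ∈ σ, ∀ δ > (0 : ℝ), x - δ • y ∈ σ → ∀ ε, 0 ≤ ε → ε ≤ δ → x - ε • y ∈ σ := by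
    intro y hy δ hδ h ε h0 h1
    have : x - ε • y = (x - δ • y) + (δ - ε) • y := by module
    rw [this]
    exact σ.add_mem h (σ.smul_mem (by linarith) hy)
  let τ : PointedCone ℝ V :=
    { carrier := {y | y ∈ σ ∧ ∃ ε > (0 : ℝ), x - ε • y ∈ σ}
      add_mem' := by
        rintro a b ⟨ha, ε, hε, h1⟩ ⟨hb, δ, hδ, h2⟩
        refine ⟨σ.add_mem ha hb, min ε δ / 2, by positivity, ?_⟩
        have e1 := hshrink a ha ε hε h1 (min ε δ) (by positivity) (min_le_left _ _)
        have e2 := hshrink b hb δ hδ h2 (min ε δ) (by positivity) (min_le_right _ _)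
        have : x - (min ε δ / 2) • (a + b) =
            (1 / 2 : ℝ) • (x - min ε δ • a) + (1 / 2 : ℝ) • (x - min ε δ • b) := by module
        rw [this]
        exact σ.add_mem (σ.smul_mem (by norm_num) e1) (σ.smul_mem (by norm_num) e2)
      zero_mem' := ⟨σ.zero_mem, 1, one_pos, by simpa using hx⟩
      smul_mem' := by
        rintro ⟨c, hc⟩ a ⟨ha, ε, hε, h1⟩
        refine ⟨σ.smul_mem hc ha, ?_⟩
        change ∃ δ > (0 : ℝ), x - δ • (c • a) ∈ σ
        rcases hc.eq_or_lt with h0 | h0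
        · exact ⟨1, one_pos, by simpa [← h0] using hx⟩
        · refine ⟨ε / c, div_pos hε h0, ?_⟩
          rwa [smul_smul, div_mul_cancel₀ _ h0.ne'] }
  refine ⟨τ, ⟨fun y hy => hy.1, ?_⟩, ⟨hx, 1, one_pos, by simp⟩, ?_⟩
  · rintro y z a hy hz ha ⟨_, ε, hε, h⟩
    refine ⟨hy, ε * a, mul_pos hε ha, ?_⟩
    have : x - (ε * a) • y = (x - ε • (a • y + z)) + ε • z := by module
    rw [this]
    exact σ.add_mem h (σ.smul_mem hε.le hz)
  · rintro y ⟨hy, ε, hε, h⟩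
    refine ⟨min ε 1, by positivity, hshrink y hy ε hε h _ (by positivity) (min_le_left _ _), 1,
      one_pos, ?_⟩
    have : x - (1 : ℝ) • (x - min ε 1 • y) = min ε 1 • y := by module
    rw [this]
    exact σ.smul_mem (by positivity) hy

theorem InRelint.le_of_mem_face {σ σ' τ : PointedCone ℝ V} {x : V} (h : InRelint σ x)
    (hσ : σ ≤ σ') (hτ : τ.IsFaceOf σ') (hx : x ∈ τ) : σ ≤ τ := by
  intro y hy
  obtain ⟨ε, hε, hm⟩ := h.2 y hy
  refine hτ.mem_of_smul_add_mem (hσ hy) (hσ hm) hε ?_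
  simpa using hx

theorem mem_hull_finset_iff {s : Finset V} {x : V} :
    x ∈ PointedCone.hull ℝ (s : Set V) ↔
      ∃ c : V → ℝ, (∀ y ∈ s, 0 ≤ c y) ∧ x = ∑ y ∈ s, c y • y := by
  constructor
  · intro hx
    obtain ⟨c, hcs, hc0, rfl⟩ := PointedCone.mem_hull_set.1 hx
    refine ⟨c, fun y _ => hc0 y, ?_⟩
    rw [Finsupp.sum]
    refine Finset.sum_subset (by exact_mod_cast hcs) fun y _ hy => ?_
    rw [Finsupp.notMem_support_iff.1 hy, zero_smul]
  · rintro ⟨c, hc, rfl⟩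
    exact Submodule.sum_mem _ fun y hy =>
      PointedCone.smul_mem _ (hc y hy) (PointedCone.subset_hull hy)

theorem exists_inRelint_hull (s : Finset V) :
    ∃ x, InRelint (PointedCone.hull ℝ (s : Set V)) x := by
  refine ⟨∑ y ∈ s, y, mem_hull_finset_iff.2 ⟨fun _ => 1, fun _ _ => zero_le_one, by simp⟩, ?_⟩
  intro y hy
  obtain ⟨c, hc, rfl⟩ := mem_hull_finset_iff.1 hy
  have hS : 0 ≤ ∑ z ∈ s, c z := Finset.sum_nonneg hc
  refine ⟨1 / (1 + ∑ z ∈ s, c z), by positivity, mem_hull_finset_iff.2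
    ⟨fun z => 1 - (1 / (1 + ∑ z ∈ s, c z)) * c z, fun z hz => ?_, ?_⟩⟩
  · have := Finset.single_le_sum hc hz
    change 0 ≤ 1 - 1 / (1 + ∑ z ∈ s, c z) * c z
    rw [one_div, inv_mul_eq_div, sub_nonneg, div_le_one (by positivity)]
    linarith
  · simp only [sub_smul, one_smul, Finset.sum_sub_distrib, Finset.smul_sum, mul_smul]

/-- Carathéodory's theorem for cones. -/
theorem exists_linearIndepOn_mem_hull (s : Finset V) {x : V}
    (hx : x ∈ PointedCone.hull ℝ (s : Set V)) :
    ∃ t ⊆ s, LinearIndepOn ℝ id (t : Set V) ∧ x ∈ PointedCone.hull ℝ (t : Set V) := by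
  classical
  induction s using Finset.strongInduction with
  | H s ih =>
    by_cases hli : LinearIndepOn ℝ id (s : Set V)
    · exact ⟨s, subset_rfl, hli, hx⟩
    obtain ⟨c, hc, rfl⟩ := mem_hull_finset_iff.1 hx
    have hdep : ∃ b : V → ℝ, ∑ y ∈ s, b y • y = 0 ∧ ∃ y ∈ s, 0 < b y := by
      rw [linearIndepOn_finset_iff] at hli
      push Not at hli
      obtain ⟨b, hb, y, hy, hne⟩ := hli
      rcases hne.lt_or_gt with h | h
      · exact ⟨-b, by simpa using hb, y, hy, by simpa using h⟩
      · exact ⟨b, by simpa using hb, y, hy, h⟩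
    obtain ⟨b, hb, hpos⟩ := hdep
    obtain ⟨y₀, hy₀, hmin⟩ := (s.filter fun y => 0 < b y).exists_min_image (fun y => c y / b y)
      (by obtain ⟨y, hy, h⟩ := hpos; exact ⟨y, Finset.mem_filter.2 ⟨hy, h⟩⟩)
    rw [Finset.mem_filter] at hy₀
    have hmem : ∑ y ∈ s, c y • y ∈ PointedCone.hull ℝ ((s.erase y₀ : Finset V) : Set V) := by
      refine mem_hull_finset_iff.2 ⟨fun y => c y - (c y₀ / b y₀) * b y, fun y hy => ?_, ?_⟩
      · have hys := Finset.mem_of_mem_erase hy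
        have h0 : 0 ≤ c y₀ / b y₀ := div_nonneg (hc _ hy₀.1) hy₀.2.le
        rcases le_or_gt (b y) 0 with h | h
        · nlinarith [hc y hys]
        · have := hmin y (Finset.mem_filter.2 ⟨hys, h⟩)
          rw [le_div_iff₀ h] at this
          linarith
      · have h1 : ∑ y ∈ s, (c y - (c y₀ / b y₀) * b y) • y = ∑ y ∈ s, c y • y := by
          simp only [sub_smul, Finset.sum_sub_distrib, mul_smul, ← Finset.smul_sum, hb, smul_zero,
            sub_zero]
        rw [← h1, ← Finset.add_sum_erase s _ hy₀.1]
        have : c y₀ - c y₀ / b y₀ * b y₀ = 0 := by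
          rw [div_mul_cancel₀ _ hy₀.2.ne']; ring
        rw [this, zero_smul, zero_add]
    obtain ⟨t, hts, ht⟩ := ih _ (Finset.erase_ssubset hy₀.1) hmem
    exact ⟨t, hts.trans (Finset.erase_subset _ _), ht⟩

/-- Finitely generated cones are closed along lines. -/
theorem mem_hull_of_frequently (s : Finset V) {p d : V}
    (h : ∃ᶠ ε in 𝓝[>] (0 : ℝ), p + ε • d ∈ PointedCone.hull ℝ (s : Set V)) :
    p ∈ PointedCone.hull ℝ (s : Set V) := by
  classical
  -- by pigeonhole, one linearly independent set of generators serves for arbitrarily small `ε`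
  have h1 : ∃ t ∈ s.powerset, ∃ᶠ ε in 𝓝[>] (0 : ℝ), LinearIndepOn ℝ id (t : Set V) ∧
      p + ε • d ∈ PointedCone.hull ℝ (t : Set V) := by
    by_contra hcon
    push Not at hcon
    have := (Filter.eventually_all_finset (l := 𝓝[>] (0 : ℝ)) s.powerset
      (p := fun t ε => ¬ (LinearIndepOn ℝ id (t : Set V) ∧
        p + ε • d ∈ PointedCone.hull ℝ (t : Set V)))).2
      (fun t ht => by simpa using hcon t ht)
    refine h ?_
    filter_upwards [this] with ε hε hmem
    obtain ⟨t, hts, hli, ht⟩ := exists_linearIndepOn_mem_hull s hmem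
    exact hε t (Finset.mem_powerset.2 hts) ⟨hli, ht⟩
  obtain ⟨t, hts, ht⟩ := h1
  have hli : LinearIndepOn ℝ id (t : Set V) := (ht.exists).choose_spec.1
  replace ht := ht.mono fun ε hε => hε.2
  -- two values of `ε` express `p` and `d` in terms of the generators
  obtain ⟨ε₁, hε₁, h₁⟩ := (ht.and_eventually (self_mem_nhdsWithin)).exists.imp
    fun ε h => And.intro h.2 h.1
  obtain ⟨ε₂, hε₂, h₂⟩ := (ht.and_eventually (Ioo_mem_nhdsGT hε₁)).exists.imp
    fun ε h => And.intro h.2 h.1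
  obtain ⟨c₁, -, hc₁⟩ := mem_hull_finset_iff.1 h₁
  obtain ⟨c₂, -, hc₂⟩ := mem_hull_finset_iff.1 h₂
  have hne : ε₁ - ε₂ ≠ 0 := (sub_pos.2 hε₂.2).ne'
  obtain ⟨e, he⟩ : ∃ e : V → ℝ, d = ∑ y ∈ t, e y • y := by
    refine ⟨fun y => (ε₁ - ε₂)⁻¹ * (c₁ y - c₂ y), ?_⟩
    simp only [mul_smul, ← Finset.smul_sum, sub_smul, Finset.sum_sub_distrib, ← hc₁, ← hc₂]
    rw [add_sub_add_left_eq_sub, ← sub_smul, smul_smul, inv_mul_cancel₀ hne, one_smul]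
  obtain ⟨a, ha⟩ : ∃ a : V → ℝ, p = ∑ y ∈ t, a y • y := by
    refine ⟨fun y => c₁ y - ε₁ * e y, ?_⟩
    simp only [sub_smul, Finset.sum_sub_distrib, mul_smul, ← Finset.smul_sum, ← hc₁, ← he]
    abel
  refine Submodule.span_mono (Finset.coe_subset.2 (Finset.mem_powerset.1 hts))
    (mem_hull_finset_iff.2 ⟨a, fun y hy => ?_, ha⟩)
  by_contra hneg
  push Not at hneg
  have hcont : Tendsto (fun ε : ℝ => a y + ε * e y) (𝓝[>] 0) (𝓝 (a y)) := by
    have : Tendsto (fun ε : ℝ => a y + ε * e y) (𝓝 0) (𝓝 (a y + 0 * e y)) :=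
      (continuous_const.add (continuous_id.mul continuous_const)).tendsto 0
    rw [zero_mul, add_zero] at this
    exact this.mono_left nhdsWithin_le_nhds
  obtain ⟨ε, hε, hlt⟩ := (ht.and_eventually (hcont.eventually_lt_const hneg)).exists
  obtain ⟨c, hc, hceq⟩ := mem_hull_finset_iff.1 hε
  have hz : ∑ z ∈ t, (a z + ε * e z - c z) • id z = 0 := by
    simp only [id, sub_smul, add_smul, Finset.sum_sub_distrib, Finset.sum_add_distrib, mul_smul,
      ← Finset.smul_sum, ← ha, ← he, ← hceq, sub_self]
  have := linearIndepOn_finset_iff.1 hli _ hz y hy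
  linarith [hc y hy]

theorem tendsto_sub_nhdsGT (t : ℝ) : Tendsto (fun s => s - t) (𝓝[>] t) (𝓝[>] 0) := by
  refine tendsto_nhdsWithin_iff.2 ⟨?_, ?_⟩
  · have : Tendsto (fun s : ℝ => s - t) (𝓝 t) (𝓝 (t - t)) := (continuous_sub_right t).tendsto t
    rw [sub_self] at this
    exact this.mono_left nhdsWithin_le_nhds
  · filter_upwards [self_mem_nhdsWithin] with s hs
    exact sub_pos.2 (by simpa using hs)

theorem tendsto_sub_nhdsLT (t : ℝ) : Tendsto (fun s => t - s) (𝓝[<] t) (𝓝[>] 0) := by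
  refine tendsto_nhdsWithin_iff.2 ⟨?_, ?_⟩
  · have : Tendsto (fun s : ℝ => t - s) (𝓝 t) (𝓝 (t - t)) := (continuous_sub_left t).tendsto t
    rw [sub_self] at this
    exact this.mono_left nhdsWithin_le_nhds
  · filter_upwards [self_mem_nhdsWithin] with s hs
    exact sub_pos.2 (by simpa using hs)

theorem isClosed_setOf_add_smul_mem_hull (s : Finset V) (p d : V) :
    IsClosed {t : ℝ | p + t • d ∈ PointedCone.hull ℝ (s : Set V)} := by
  refine isClosed_of_closure_subset fun t ht => ?_
  rw [mem_closure_iff_frequently, ← nhdsNE_sup_pure, Filter.frequently_sup, ← nhdsLT_sup_nhdsGT,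
    Filter.frequently_sup] at ht
  rcases ht with (ht | ht) | ht
  · refine mem_hull_of_frequently s (d := -d) ((tendsto_sub_nhdsLT t).frequently (ht.mono ?_))
    intro r hr
    have : p + t • d + (t - r) • -d = p + r • d := by module
    rwa [this]
  · refine mem_hull_of_frequently s (d := d) ((tendsto_sub_nhdsGT t).frequently (ht.mono ?_))
    intro r hr
    have : p + t • d + (r - t) • d = p + r • d := by module
    rwa [this]
  · simpa using ht

/-- A real vector space `W` that lies in none of finitely many subspaces contains a direction in
which every point immediately leaves all of them. -/
theorem exists_direction_avoiding {ι : Type*} [Finite ι] (W : Submodule ℝ V)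
    (P : ι → Submodule ℝ V) (h : ∀ i, ¬ W ≤ P i) :
    ∃ w ∈ W, ∀ x : V, ∀ᶠ ε in 𝓝[>] (0 : ℝ), ∀ i, x + ε • w ∉ P i := by
  obtain ⟨w, hw⟩ := Submodule.exists_forall_notMem_of_forall_ne_top
    (fun i => (P i).comap W.subtype) fun i hi => h i fun x hx => by
      have : (⟨x, hx⟩ : W) ∈ (P i).comap W.subtype := by rw [hi]; trivial
      simpa using this
  refine ⟨w, w.2, fun x => Filter.eventually_all.2 fun i => ?_⟩
  have hwi : (w : V) ∉ P i := by simpa using hw i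
  by_cases hex : ∃ δ > (0 : ℝ), x + δ • (w : V) ∈ P i
  · obtain ⟨δ, hδ, hm⟩ := hex
    filter_upwards [Ioo_mem_nhdsGT hδ] with ε hε hm'
    have := (P i).sub_mem hm hm'
    rw [add_sub_add_left_eq_sub, ← sub_smul] at this
    exact hwi (((P i).smul_mem_iff (sub_pos.2 hε.2).ne').1 this)
  · filter_upwards [self_mem_nhdsWithin] with ε hε hm
    exact hex ⟨ε, hε, hm⟩

end ConeGeometry
end TropM

/-! ### Geometry of tropical fans -/

namespace TropM
section FanGeometry

open Filter Topology

variable {V : Type*} [AddCommGroup V] [Module ℝ V] {Λ : AddSubgroup V}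

theorem exists_smul_sub_mem_of_finrank_eq [FiniteDimensional ℝ V] {W U : Submodule ℝ V}
    (hWU : W ≤ U) (hfr : Module.finrank ℝ U = Module.finrank ℝ W + 1) {d z : V} (hd : d ∈ U)
    (hdW : d ∉ W) (hz : z ∈ U) : ∃ c : ℝ, z - c • d ∈ W := by
  have hle : W ⊔ Submodule.span ℝ {d} ≤ U :=
    sup_le hWU ((Submodule.span_singleton_le_iff_mem _ _).2 hd)
  have hlt : W < W ⊔ Submodule.span ℝ {d} :=
    lt_of_le_of_ne le_sup_left fun h => hdW (h ▸ Submodule.mem_sup_right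
      (Submodule.mem_span_singleton_self d))
  have h1 := Submodule.finrank_lt_finrank_of_lt hlt
  have heq := Submodule.eq_of_le_of_finrank_le hle (by omega)
  rw [← heq] at hz
  obtain ⟨w, hw, y, hy, rfl⟩ := Submodule.mem_sup.1 hz
  obtain ⟨c, rfl⟩ := Submodule.mem_span_singleton.1 hy
  exact ⟨c, by simpa using hw⟩

theorem IsRationalCone.exists_inRelint {σ : PointedCone ℝ V} (h : IsRationalCone Λ σ) :
    ∃ x, InRelint σ x := by
  obtain ⟨s, -, rfl⟩ := h
  exact exists_inRelint_hull s

theorem IsPrimitiveNormal.exists_smul_sub_mem {τ σ : PointedCone ℝ V} {u : V}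
    (h : IsPrimitiveNormal Λ τ σ u) (hσ : IsRationalCone Λ σ) {z : V} (hz : z ∈ linSpan σ) :
    ∃ c : ℝ, z - c • u ∈ linSpan τ := by
  obtain ⟨s, hs, hσs⟩ := hσ
  have hle : linSpan σ ≤ linSpan τ ⊔ Submodule.span ℝ {u} := by
    refine Submodule.span_le.2 fun x hx => ?_
    have hgen : ∀ y ∈ s, y ∈ linSpan τ ⊔ Submodule.span ℝ {u} := by
      intro y hy
      have hyσ : y ∈ σ := hσs ▸ PointedCone.subset_hull hy
      obtain ⟨m, hm⟩ := h.2.2 y (hs y hy) (le_linSpan σ hyσ)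
      have : y = (y - m • u) + (m : ℝ) • u := by rw [Int.cast_smul_eq_zsmul]; abel
      rw [this]
      exact Submodule.add_mem _ (Submodule.mem_sup_left hm) (Submodule.mem_sup_right
        (Submodule.smul_mem _ _ (Submodule.mem_span_singleton_self u)))
    rw [← hσs] at hx
    obtain ⟨c, -, rfl⟩ := mem_hull_finset_iff.1 hx
    exact Submodule.sum_mem _ fun y hy => Submodule.smul_mem _ _ (hgen y hy)
  obtain ⟨w, hw, y, hy, rfl⟩ := Submodule.mem_sup.1 (hle hz)
  obtain ⟨c, rfl⟩ := Submodule.mem_span_singleton.1 hy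
  exact ⟨c, by simpa using hw⟩

theorem IsPrimitiveNormal.notMem_linSpan [FiniteDimensional ℝ V] {τ σ : PointedCone ℝ V} {u : V}
    (h : IsPrimitiveNormal Λ τ σ u) (hσ : IsRationalCone Λ σ) (hd : coneDim σ = coneDim τ + 1) :
    u ∉ linSpan τ := by
  intro hu
  have : linSpan σ ≤ linSpan τ := fun z hz => by
    obtain ⟨c, hc⟩ := h.exists_smul_sub_mem hσ hz
    simpa using (linSpan τ).add_mem hc ((linSpan τ).smul_mem c hu)
  have := Submodule.finrank_mono this
  simp only [coneDim] at hd
  omega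

/-- A cone lies on one side of a face of codimension one. -/
theorem exists_nonneg_smul_sub_mem [FiniteDimensional ℝ V] {τ σ : PointedCone ℝ V}
    (hτ : τ.IsFaceOf σ) (hd : coneDim σ = coneDim τ + 1) {u z : V} (hu : u ∈ σ)
    (huτ : u ∉ linSpan τ) (hz : z ∈ σ) : ∃ c : ℝ, 0 ≤ c ∧ z - c • u ∈ linSpan τ := by
  obtain ⟨c, hc⟩ := exists_smul_sub_mem_of_finrank_eq (linSpan_mono hτ.le) hd (le_linSpan σ hu) huτ
    (le_linSpan σ hz)
  refine ⟨c, ?_, hc⟩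
  by_contra hneg
  push Not at hneg
  have hmem : z - c • u ∈ σ := by
    rw [sub_eq_add_neg, ← neg_smul]
    exact σ.add_mem hz (σ.smul_mem (by linarith) hu)
  have h1 := mem_face_of_mem_linSpan hτ hmem hc
  rw [sub_eq_add_neg, ← neg_smul, add_comm] at h1
  exact huτ (le_linSpan τ (hτ.mem_of_smul_add_mem hu hz (by linarith) h1))

namespace WeightedFan

variable {X Y D : WeightedFan V}

theorem mem_support {x : V} : x ∈ X.support ↔ ∃ σ ∈ X.cones, x ∈ σ := by
  simp [support]

theorem mem_star {τ σ : PointedCone ℝ V} :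
    σ ∈ X.star τ ↔ σ ∈ X.cones ∧ coneDim σ = coneDim τ + 1 ∧ τ.IsFaceOf σ := by
  simp [star]

theorem IsTropicalFan.exists_inRelint (hX : X.IsTropicalFan Λ) {x : V} (hx : x ∈ X.support) :
    ∃ ρ ∈ X.cones, InRelint ρ x := by
  obtain ⟨σ, hσ, hxσ⟩ := mem_support.1 hx
  obtain ⟨ρ, hρ, hxρ⟩ := exists_face_inRelint σ hxσ
  exact ⟨ρ, hX.face_mem σ hσ ρ hρ, hxρ⟩

theorem IsTropicalFan.isClosed_line (hX : X.IsTropicalFan Λ) (p d : V) :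
    IsClosed {t : ℝ | p + t • d ∈ X.support} := by
  have : {t : ℝ | p + t • d ∈ X.support} = ⋃ σ ∈ X.cones, {t : ℝ | p + t • d ∈ σ} := by
    ext t
    simp [mem_support]
  rw [this]
  refine X.cones.finite_toSet.isClosed_biUnion fun σ hσ => ?_
  obtain ⟨s, -, rfl⟩ := hX.rational σ hσ
  exact isClosed_setOf_add_smul_mem_hull s p d

theorem IsTropicalFan.exists_cone_of_frequently (hX : X.IsTropicalFan Λ) {p d : V}
    (h : ∃ᶠ ε in 𝓝[>] (0 : ℝ), p + ε • d ∈ X.support) :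
    ∃ σ ∈ X.cones, p ∈ σ ∧ ∃ ε > (0 : ℝ), p + ε • d ∈ σ := by
  have h1 : ∃ σ ∈ X.cones, ∃ᶠ ε in 𝓝[>] (0 : ℝ), p + ε • d ∈ σ := by
    by_contra hcon
    push Not at hcon
    refine h ?_
    filter_upwards [(Filter.eventually_all_finset (l := 𝓝[>] (0 : ℝ)) X.cones
      (p := fun σ ε => p + ε • d ∉ σ)).2 fun σ hσ => by simpa using hcon σ hσ] with ε hε hmem
    obtain ⟨σ, hσ, hm⟩ := mem_support.1 hmem
    exact hε σ hσ hm
  obtain ⟨σ, hσ, hf⟩ := h1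
  obtain ⟨ε, hε, hpos⟩ := (hf.and_eventually self_mem_nhdsWithin).exists
  refine ⟨σ, hσ, ?_, ε, hpos, hε⟩
  obtain ⟨s, -, rfl⟩ := hX.rational σ hσ
  exact mem_hull_of_frequently s hf

theorem IsTropicalFan.isFaceOf_of_inRelint (hX : X.IsTropicalFan Λ) {τ σ : PointedCone ℝ V}
    (hτ : τ ∈ X.cones) (hσ : σ ∈ X.cones) {x : V} (hx : InRelint τ x) (hxσ : x ∈ σ) :
    τ.IsFaceOf σ := by
  have h1 := hx.le_of_mem_face le_rfl (hX.inter_face τ hτ σ hσ) ⟨hx.1, hxσ⟩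
  have h2 : σ ⊓ τ = τ := by
    rw [inf_comm]
    exact le_antisymm inf_le_left h1
  have := hX.inter_face σ hσ τ hτ
  rwa [h2] at this

/-- The local structure of a fan: the directions in which one stays in the support when leaving a
point in the relative interior of `τ` are those of the top-dimensional cones that contain `τ`. -/
theorem IsTropicalFan.exists_facet_of_direction (hX : X.IsTropicalFan Λ) {τ : PointedCone ℝ V}
    (hτ : τ ∈ X.cones) {x z : V} (hx : InRelint τ x)
    (hz : ∃ᶠ ε in 𝓝[>] (0 : ℝ), x + ε • z ∈ X.support) :
    ∃ σ ∈ X.cones, coneDim σ = X.dim ∧ τ.IsFaceOf σ ∧ ∃ y ∈ σ, z - y ∈ linSpan τ := by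
  obtain ⟨σ', hσ', hxσ', ε, hε, hmem⟩ := hX.exists_cone_of_frequently hz
  obtain ⟨σ, hσ, hd, hface⟩ := hX.pure σ' hσ'
  refine ⟨σ, hσ, hd, hX.isFaceOf_of_inRelint hτ hσ hx (hface.le hxσ'), ε⁻¹ • (x + ε • z),
    σ.smul_mem (inv_pos.2 hε).le (hface.le hmem), ?_⟩
  rw [smul_add, smul_smul, inv_mul_cancel₀ hε.ne', one_smul, sub_add_cancel_right]
  exact (linSpan τ).neg_mem ((linSpan τ).smul_mem _ (le_linSpan τ hx.1))

theorem IsTropicalFan.coneDim_le [FiniteDimensional ℝ V] (hX : X.IsTropicalFan Λ)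
    {τ : PointedCone ℝ V} (hτ : τ ∈ X.cones) : coneDim τ ≤ X.dim := by
  obtain ⟨σ, -, hd, hface⟩ := hX.pure τ hτ
  exact hd ▸ coneDim_mono hface.le

/-- Let `ρ` be a cone of codimension one of a tropical fan, such that all cones around `ρ` point, in
the quotient by the span of `ρ`, in one of the directions `v i`. If in every linear relation between
the `v i` either all coefficients or no coefficients vanish, then each of the directions `v i`
occurs: the balancing condition at `ρ` is one such relation. -/
theorem IsTropicalFan.exists_star_direction [FiniteDimensional ℝ V] (hX : X.IsTropicalFan Λ)
    {ρ : PointedCone ℝ V} (hρ : ρ ∈ X.cones) (hd : coneDim ρ + 1 = X.dim) {ι : Type*} [Fintype ι]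
    (v : ι → V)
    (hdir : ∀ η ∈ X.star ρ, ∀ z ∈ η, z ∉ linSpan ρ →
      ∃ i, ∃ c : ℝ, 0 < c ∧ z - c • v i ∈ linSpan ρ)
    (hrel : ∀ a : ι → ℝ, ∑ i, a i • v i ∈ linSpan ρ → (∀ i, a i = 0) ∨ ∀ i, a i ≠ 0) (i : ι) :
    ∃ η ∈ X.star ρ, ∃ z ∈ η, v i - z ∈ linSpan ρ := by
  classical
  obtain ⟨u, hu, hbal⟩ := hX.balanced ρ hρ hd
  have hun : ∀ η ∈ X.star ρ, u η ∉ linSpan ρ := fun η hη =>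
    (hu η hη).notMem_linSpan (hX.rational η (mem_star.1 hη).1) (mem_star.1 hη).2.1
  have hex : ∀ η ∈ X.star ρ, ∃ i, ∃ c : ℝ, 0 < c ∧ u η - c • v i ∈ linSpan ρ := fun η hη =>
    hdir η hη (u η) (hu η hη).2.1 (hun η hη)
  have : Nonempty ι := ⟨i⟩
  choose! j c hc hjc using hex
  -- two different cones around `ρ` cannot point in the same direction
  have hinj : ∀ η ∈ X.star ρ, ∀ η' ∈ X.star ρ, j η = j η' → η ≤ η' := by
    intro η hη η' hη' hj
    obtain ⟨x, hx⟩ := (hX.rational ρ hρ).exists_inRelint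
    have hw : c η' • u η - c η • u η' ∈ linSpan ρ := by
      have h1 := (linSpan ρ).smul_mem (c η') (hjc η hη)
      have h2 := (linSpan ρ).smul_mem (c η) (hjc η' hη')
      have := (linSpan ρ).sub_mem h1 h2
      rw [← hj] at this
      convert this using 1
      module
    obtain ⟨ε, hε, hpos⟩ := ((hx.eventually hw).and self_mem_nhdsWithin).exists
    obtain ⟨hη1, hη2, hη3⟩ := mem_star.1 hη
    obtain ⟨hη1', hη2', hη3'⟩ := mem_star.1 hη'
    have hq : x + ε • c η' • u η ∈ η ⊓ η' := by
      refine ⟨η.add_mem (hη3.le hx.1) (η.smul_mem hpos.le (η.smul_mem (hc η' hη').le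
        (hu η hη).2.1)), ?_⟩
      have : x + ε • c η' • u η = (x + ε • (c η' • u η - c η • u η')) + ε • c η • u η' := by
        module
      rw [this]
      exact η'.add_mem (hη3'.le hε) (η'.smul_mem hpos.le (η'.smul_mem (hc η hη).le
        (hu η' hη').2.1))
    have hface := hX.inter_face η hη1 η' hη1'
    have hρle : linSpan ρ ≤ linSpan (η ⊓ η') := linSpan_mono (le_inf hη3.le hη3'.le)
    have huq : u η ∈ linSpan (η ⊓ η') := by
      have h1 := (linSpan (η ⊓ η')).sub_mem (le_linSpan _ hq) (hρle (le_linSpan _ hx.1))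
      rw [add_sub_cancel_left, smul_smul] at h1
      exact ((linSpan (η ⊓ η')).smul_mem_iff (mul_pos hpos (hc η' hη')).ne').1 h1
    have heq : η ⊓ η' = η := by
      refine face_eq_of_linSpan_le hface fun z hz => ?_
      obtain ⟨e, he⟩ := (hu η hη).exists_smul_sub_mem (hX.rational η hη1) hz
      have := (linSpan (η ⊓ η')).add_mem (hρle he) ((linSpan (η ⊓ η')).smul_mem e huq)
      simpa using this
    exact inf_eq_left.1 heq
  let a : ι → ℝ := fun i => ∑ η ∈ (X.star ρ).filter fun η => j η = i, X.weight η * c η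
  have ha : ∑ i, a i • v i ∈ linSpan ρ := by
    have h1 : ∑ i, a i • v i = ∑ η ∈ X.star ρ, (X.weight η * c η) • v (j η) := by
      simp only [a, Finset.sum_smul]
      rw [← Finset.sum_fiberwise (X.star ρ) j]
      refine Finset.sum_congr rfl fun i _ => Finset.sum_congr rfl fun η hη => ?_
      rw [(Finset.mem_filter.1 hη).2]
    have h2 : ∑ η ∈ X.star ρ, X.weight η • (u η - c η • v (j η)) ∈ linSpan ρ :=
      Submodule.sum_mem _ fun η hη => Submodule.smul_mem _ _ (hjc η hη)
    have h3 := (linSpan ρ).sub_mem hbal h2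
    rw [h1]
    convert h3 using 1
    rw [← Finset.sum_sub_distrib]
    refine Finset.sum_congr rfl fun η _ => ?_
    module
  have haj : ∀ η ∈ X.star ρ, a (j η) = X.weight η * c η := by
    intro η hη
    have : ((X.star ρ).filter fun η' => j η' = j η) = {η} := by
      ext η'
      simp only [Finset.mem_filter, Finset.mem_singleton]
      constructor
      · rintro ⟨h1, h2⟩
        exact le_antisymm (hinj η' h1 η hη h2) (hinj η hη η' h1 h2.symm)
      · rintro rfl
        exact ⟨hη, rfl⟩
    simp only [a, this, Finset.sum_singleton]
  obtain ⟨η₀, hη₀, hd₀, hface₀⟩ := hX.pure ρ hρ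
  have hs₀ : η₀ ∈ X.star ρ := mem_star.2 ⟨hη₀, by omega, hface₀⟩
  have hne : ∀ i, a i ≠ 0 := by
    refine (hrel a ha).resolve_left fun h => ?_
    have := haj η₀ hs₀
    rw [h] at this
    exact mul_ne_zero (hX.weight_ne_zero η₀ hη₀ hd₀) (hc η₀ hs₀).ne' this.symm
  obtain ⟨η, hη, hηi⟩ : ∃ η ∈ X.star ρ, j η = i := by
    by_contra hcon
    push Not at hcon
    refine hne i ?_
    simp only [a]
    rw [Finset.filter_eq_empty_iff.2 fun η hη => hcon η hη, Finset.sum_empty]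
  refine ⟨η, hη, (c η)⁻¹ • u η, η.smul_mem (inv_pos.2 (hc η hη)).le (hu η hη).2.1, ?_⟩
  have := (linSpan ρ).smul_mem (-(c η)⁻¹) (hjc η hη)
  rw [hηi, smul_sub, smul_smul, neg_mul, inv_mul_cancel₀ (hc η hη).ne'] at this
  convert this using 1
  module

end WeightedFan

end FanGeometry
end TropM

/-! ### A criterion for irreducibility -/

namespace TropM
section AbstractIrreducibility

open Filter Topology

variable {V : Type*} [AddCommGroup V] [Module ℝ V] {Λ : AddSubgroup V}

namespace WeightedFan

variable {X Y D : WeightedFan V} [FiniteDimensional ℝ V]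

theorem IsTropicalFan.linSpan_le_of_inRelint_facet (hD : D.IsTropicalFan Λ)
    (hsub : Y.support ⊆ D.support) {σ : PointedCone ℝ V} (hσ : σ ∈ D.cones)
    (hd : coneDim σ = D.dim) {x : V} (hx : InRelint σ x) {η : PointedCone ℝ V} (hη : η ∈ Y.cones)
    (hxη : x ∈ η) : linSpan η ≤ linSpan σ := by
  refine Submodule.span_le.2 fun z hz => ?_
  have hmem : ∀ᶠ ε in 𝓝[>] (0 : ℝ), x + ε • z ∈ D.support := by
    filter_upwards [self_mem_nhdsWithin] with ε hε
    exact hsub (mem_support.2 ⟨η, hη, η.add_mem hxη (η.smul_mem (le_of_lt (by simpa using hε)) hz)⟩)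
  obtain ⟨σ', hσ', hd', hface, y, hy, hzy⟩ := hD.exists_facet_of_direction hσ hx hmem.frequently
  have : σ = σ' := face_eq_of_coneDim_le hface (by omega)
  subst this
  simpa using (linSpan σ).add_mem hzy (le_linSpan σ hy)

/-- If a tropical fan `Y` is contained in a fan `D` of the same dimension and meets the relative
interior of a top-dimensional cone `σ` of `D`, then it contains the relative interior of `σ`.

Otherwise one could travel on a segment inside `σ` from a point of `Y` to a point outside of `Y`.
The segment can be chosen generically, so that it avoids the cones of `Y` of codimension at least
2. By balancing it can then never leave `Y`. -/
theorem IsTropicalFan.mem_support_of_meets_facet (hD : D.IsTropicalFan Λ) (hY : Y.IsTropicalFan Λ)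
    (hdim : Y.dim = D.dim) (hsub : Y.support ⊆ D.support) {σ : PointedCone ℝ V} (hσ : σ ∈ D.cones)
    (hd : coneDim σ = D.dim) {x₀ : V} (hx₀ : InRelint σ x₀) (hx₀Y : x₀ ∈ Y.support) {q : V}
    (hq : InRelint σ q) : q ∈ Y.support := by
  have hloc : ∀ x, InRelint σ x → ∀ η ∈ Y.cones, x ∈ η → linSpan η ≤ linSpan σ :=
    fun x hx η hη hxη => hD.linSpan_le_of_inRelint_facet hsub hσ hd hx hη hxη
  -- a starting point in the relative interiors of `σ` and of a top-dimensional cone of `Y`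
  obtain ⟨η', hη', hxη'⟩ := mem_support.1 hx₀Y
  obtain ⟨η, hη, hηd, hface⟩ := hY.pure η' hη'
  have hxη := hface.le hxη'
  obtain ⟨y₀, hy₀⟩ := (hY.rational η hη).exists_inRelint
  have hspan : linSpan η = linSpan σ :=
    linSpan_eq_of_coneDim_le (hloc x₀ hx₀ η hη hxη) (by omega)
  obtain ⟨ε₀, hp₀, hε₀⟩ := ((hx₀.eventually_inRelint (hspan ▸ le_linSpan η hy₀.1)).and
    self_mem_nhdsWithin).exists
  have hp₀η : InRelint η (x₀ + ε₀ • y₀) := by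
    rw [add_comm]
    exact (hy₀.smul (by simpa using hε₀)).add_mem hxη
  -- move it to a position that is generic with respect to `q`
  let ι := {ρ // ρ ∈ Y.cones ∧ coneDim ρ + 2 ≤ Y.dim}
  have : Finite ι := Set.Finite.subset Y.cones.finite_toSet (fun ρ h => h.1)
  obtain ⟨w, hw, havoid⟩ := exists_direction_avoiding (linSpan σ)
    (fun ρ : ι => linSpan ρ.1 ⊔ Submodule.span ℝ {q}) fun ρ hle => by
      have h1 := Submodule.finrank_mono hle
      have h2 := Submodule.finrank_add_le_finrank_add_finrank (linSpan ρ.1) (Submodule.span ℝ {q})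
      have h3 := finrank_span_le_card (R := ℝ) ({q} : Set V)
      have h4 := ρ.2.2
      simp only [Set.toFinset_singleton, Finset.card_singleton] at h3
      simp only [coneDim] at hd h4
      omega
  obtain ⟨ε₁, ⟨hpσ, hpη⟩, hpa⟩ := (((hp₀.eventually_inRelint hw).and
    (hp₀η.eventually_inRelint (hspan.symm ▸ hw))).and (havoid (x₀ + ε₀ • y₀))).exists
  set p := x₀ + ε₀ • y₀ + ε₁ • w
  set d := q - p
  have hdσ : d ∈ linSpan σ := (linSpan σ).sub_mem (le_linSpan σ hq.1) (le_linSpan σ hpσ.1)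
  have key : Set.Icc (0 : ℝ) 1 ⊆ {t | p + t • d ∈ Y.support} := by
    refine IsClosed.Icc_subset_of_forall_mem_nhdsWithin
      ((hY.isClosed_line p d).inter isClosed_Icc) ?_ ?_
    · simpa using mem_support.2 ⟨η, hη, hpη.1⟩
    rintro t ⟨htY, ht0, ht1⟩
    change p + t • d ∈ Y.support at htY
    suffices h : ∀ᶠ ε in 𝓝[>] (0 : ℝ), (p + t • d) + ε • d ∈ Y.support by
      filter_upwards [(tendsto_sub_nhdsGT t).eventually h] with r hr
      have : p + t • d + (r - t) • d = p + r • d := by module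
      rwa [this] at hr
    have hxσ : InRelint σ (p + t • d) := hpσ.combo hq.1 ht0 ht1
    obtain ⟨ρ, hρ, hxρ⟩ := hY.exists_inRelint htY
    set x := p + t • d
    have hρσ := hloc x hxσ ρ hρ hxρ.1
    have hρY : ∀ z ∈ linSpan ρ, ∀ᶠ ε in 𝓝[>] (0 : ℝ), x + ε • z ∈ Y.support := fun z hz =>
      (hxρ.eventually hz).mono fun ε hε => mem_support.2 ⟨ρ, hρ, hε⟩
    have hdim1 : Y.dim ≤ coneDim ρ + 1 := by
      by_contra hlt
      refine hpa ⟨ρ, hρ, by omega⟩ ?_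
      have h1 : p = (1 - t)⁻¹ • x + (-(1 - t)⁻¹ * t) • q := by
        have : x = (1 - t) • p + t • q := by simp only [x, d]; module
        rw [this, smul_add, smul_smul, smul_smul, inv_mul_cancel₀ (sub_pos.2 ht1).ne']
        module
      rw [h1]
      exact Submodule.add_mem _ (Submodule.mem_sup_left (Submodule.smul_mem _ _
        (le_linSpan ρ hxρ.1))) (Submodule.mem_sup_right (Submodule.smul_mem _ _
        (Submodule.mem_span_singleton_self q)))
    by_cases hdρ : d ∈ linSpan ρ
    · exact hρY d hdρ
    have hdim2 : coneDim ρ + 1 = Y.dim := by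
      have := hY.coneDim_le hρ
      by_contra hne
      exact hdρ ((linSpan_eq_of_coneDim_le hρσ (by omega)).symm ▸ hdσ)
    -- the fan `Y` continues on both sides of the wall `ρ`
    obtain ⟨θ, hθ, z, hz, hdz⟩ := hY.exists_star_direction hρ hdim2
      (fun b : Bool => if b then d else -d)
      (by
        intro θ hθ z hz hzρ
        obtain ⟨hθ1, -, hθ3⟩ := mem_star.1 hθ
        have hzσ := hloc x hxσ θ hθ1 (hθ3.le hxρ.1) (le_linSpan θ hz)
        obtain ⟨c, hc⟩ := exists_smul_sub_mem_of_finrank_eq hρσ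
          (by simp only [coneDim] at hd hdim2; omega) hdσ hdρ hzσ
        rcases lt_trichotomy c 0 with h | h | h
        · exact ⟨false, -c, by linarith, by simpa using hc⟩
        · exact absurd (by simpa [h] using hc) hzρ
        · exact ⟨true, c, h, by simpa using hc⟩)
      (by
        intro a ha
        have h1 : (a true - a false) • d ∈ linSpan ρ := by
          convert ha using 1
          simp [add_smul, sub_eq_add_neg]
        have h2 : a true = a false := by
          by_contra hne
          exact hdρ (((linSpan ρ).smul_mem_iff (sub_ne_zero.2 hne)).1 h1)
        by_cases h : a false = 0
        · left; intro b; cases b <;> simp [h, h2]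
        · right; intro b; cases b <;> simp [h, h2])
      true
    simp only [if_true] at hdz
    filter_upwards [hxρ.eventually hdz, self_mem_nhdsWithin] with ε hε hpos
    obtain ⟨hθ1, -, hθ3⟩ := mem_star.1 hθ
    refine mem_support.2 ⟨θ, hθ1, ?_⟩
    have : x + ε • d = (x + ε • (d - z)) + ε • z := by module
    rw [this]
    exact θ.add_mem (hθ3.le hε) (θ.smul_mem (le_of_lt (by simpa using hpos)) hz)
  have h1 : p + (1 : ℝ) • d ∈ Y.support := key ⟨zero_le_one, le_rfl⟩
  simpa [d] using h1

/-- A rigid wall: a cone `τ` of codimension 1 with at least three adjacent top-dimensional cones,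
such that in every real linear relation, modulo the span of `τ`, between suitable vectors `v σ` in
the adjacent cones `σ > τ`, either all coefficients or no coefficients vanish. -/
def IsRigidWall (D : WeightedFan V) (τ : PointedCone ℝ V) : Prop :=
  τ ∈ D.cones ∧ coneDim τ + 1 = D.dim ∧ 2 < (D.star τ).card ∧
    ∃ v : PointedCone ℝ V → V, (∀ σ ∈ D.star τ, v σ ∈ σ) ∧
      ∀ a : PointedCone ℝ V → ℝ, ∑ σ ∈ D.star τ, a σ • v σ ∈ linSpan τ →
        (∀ σ ∈ D.star τ, a σ = 0) ∨ ∀ σ ∈ D.star τ, a σ ≠ 0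

/-- Let `Y` be a tropical fan contained in a fan `D` of the same dimension. If `Y` contains one of
the top-dimensional cones of `D` adjacent to a rigid wall, then `Y` meets the relative interior of
all of them. -/
theorem IsTropicalFan.meets_star_of_isRigidWall (hD : D.IsTropicalFan Λ) (hY : Y.IsTropicalFan Λ)
    (hdim : Y.dim = D.dim) (hsub : Y.support ⊆ D.support) {τ : PointedCone ℝ V}
    (hτ : D.IsRigidWall τ) {σ₁ : PointedCone ℝ V} (hσ₁ : σ₁ ∈ D.star τ)
    (hσ₁Y : ∀ x, InRelint σ₁ x → x ∈ Y.support) {σ : PointedCone ℝ V} (hσ : σ ∈ D.star τ) :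
    ∃ x, InRelint σ x ∧ x ∈ Y.support := by
  classical
  obtain ⟨hτD, hτd, hcard, v, hv, hrel⟩ := hτ
  have hvn : ∀ σ ∈ D.star τ, v σ ∉ linSpan τ := by
    intro σ hσ hmem
    have := hrel (fun σ' => if σ' = σ then 1 else 0) (by simpa [hσ] using hmem)
    rcases this with h | h
    · simpa using h σ hσ
    · obtain ⟨σ', hσ', hne⟩ := Finset.exists_mem_ne (show 1 < (D.star τ).card by omega) σ
      exact h σ' hσ' (if_neg hne)
  -- a generic point `x` in the relative interior of the wall
  obtain ⟨x₀, hx₀⟩ := (hD.rational τ hτD).exists_inRelint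
  let ι := {ρ // ρ ∈ Y.cones ∧ ¬ linSpan τ ≤ linSpan ρ}
  have : Finite ι := Set.Finite.subset Y.cones.finite_toSet (fun ρ h => h.1)
  obtain ⟨w, hw, havoid⟩ := exists_direction_avoiding (linSpan τ)
    (fun ρ : ι => linSpan ρ.1) fun ρ => ρ.2.2
  obtain ⟨ε₁, hxτ, hxa⟩ := ((hx₀.eventually_inRelint hw).and (havoid x₀)).exists
  set x := x₀ + ε₁ • w
  have hxY : x ∈ Y.support := by
    obtain ⟨h1, -, h3⟩ := mem_star.1 hσ₁
    obtain ⟨y, hy⟩ := (hD.rational σ₁ h1).exists_inRelint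
    have : ∀ᶠ ε in 𝓝[>] (0 : ℝ), x + ε • y ∈ Y.support := by
      filter_upwards [self_mem_nhdsWithin] with ε hε
      rw [add_comm]
      exact hσ₁Y _ ((hy.smul (by simpa using hε)).add_mem (h3.le hxτ.1))
    obtain ⟨ρ, hρ, hxρ, -⟩ := hY.exists_cone_of_frequently this.frequently
    exact mem_support.2 ⟨ρ, hρ, hxρ⟩
  obtain ⟨ρ, hρ, hxρ⟩ := hY.exists_inRelint hxY
  have hτρ : linSpan τ ≤ linSpan ρ := by
    by_contra hcon
    exact hxa ⟨ρ, hρ, hcon⟩ (le_linSpan ρ hxρ.1)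
  -- directions in which one can stay in `Y` belong to one of the cones around the wall
  have hloc : ∀ z, (∀ᶠ ε in 𝓝[>] (0 : ℝ), x + ε • z ∈ Y.support) → z ∉ linSpan τ →
      ∃ σ ∈ D.star τ, ∃ c : ℝ, 0 < c ∧ z - c • v σ ∈ linSpan τ := by
    intro z hz hzτ
    obtain ⟨σ', hσ', hd', hface, y, hy, hzy⟩ := hD.exists_facet_of_direction hτD hxτ
      (hz.mono fun ε hε => hsub hε).frequently
    have hst : σ' ∈ D.star τ := mem_star.2 ⟨hσ', by omega, hface⟩
    obtain ⟨c, hc, hyc⟩ := exists_nonneg_smul_sub_mem hface (by omega) (hv σ' hst) (hvn σ' hst) hy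
    have hzc : z - c • v σ' ∈ linSpan τ := by
      have := (linSpan τ).add_mem hzy hyc
      simpa using this
    refine ⟨σ', hst, c, lt_of_le_of_ne hc ?_, hzc⟩
    rintro rfl
    exact hzτ (by simpa using hzc)
  have hle := hY.coneDim_le hρ
  have hge : coneDim τ ≤ coneDim ρ := Submodule.finrank_mono hτρ
  rcases (show coneDim ρ = Y.dim ∨ coneDim ρ + 1 = Y.dim by omega) with hρd | hρd
  · -- a top-dimensional cone of `Y` cannot cross the wall
    exfalso
    obtain ⟨z, hz, hzτ⟩ : ∃ z ∈ linSpan ρ, z ∉ linSpan τ := by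
      by_contra hcon
      push Not at hcon
      have : coneDim ρ ≤ coneDim τ := Submodule.finrank_mono hcon
      omega
    have hρY : ∀ z ∈ linSpan ρ, ∀ᶠ ε in 𝓝[>] (0 : ℝ), x + ε • z ∈ Y.support := fun z hz =>
      (hxρ.eventually hz).mono fun ε hε => mem_support.2 ⟨ρ, hρ, hε⟩
    obtain ⟨σ, hσ, c, hc, h1⟩ := hloc z (hρY z hz) hzτ
    obtain ⟨σ', hσ', c', hc', h2⟩ := hloc (-z) (hρY _ ((linSpan ρ).neg_mem hz))
      (by simpa using hzτ)
    have h3 : c • v σ + c' • v σ' ∈ linSpan τ := by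
      have := (linSpan τ).neg_mem ((linSpan τ).add_mem h1 h2)
      convert this using 1
      abel
    let a : PointedCone ℝ V → ℝ := fun θ => (if θ = σ then c else 0) + (if θ = σ' then c' else 0)
    have ha := hrel a (by
      simpa [a, add_smul, Finset.sum_add_distrib, hσ, hσ', ite_smul] using h3)
    have hpos : 0 < a σ := by
      have : (0 : ℝ) ≤ if σ = σ' then c' else 0 := by split_ifs <;> linarith
      simp only [a, if_true]
      linarith
    obtain ⟨θ, hθ, hne⟩ : ∃ θ ∈ D.star τ, θ ∉ ({σ, σ'} : Finset (PointedCone ℝ V)) := by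
      by_contra hcon
      push Not at hcon
      have h4 := Finset.card_le_card (show D.star τ ⊆ {σ, σ'} from hcon)
      have h5 := Finset.card_le_two (a := σ) (b := σ')
      omega
    simp only [Finset.mem_insert, Finset.mem_singleton, not_or] at hne
    rcases ha with h | h
    · exact hpos.ne' (h σ hσ)
    · exact h θ hθ (by simp [a, hne.1, hne.2])
  · have hspan : linSpan τ = linSpan ρ := linSpan_eq_of_coneDim_le hτρ (by omega)
    obtain ⟨θ, hθ, z, hz, hvz⟩ := hY.exists_star_direction hρ hρd
      (fun σ : {σ // σ ∈ D.star τ} => v σ.1)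
      (by
        intro θ hθ z hz hzρ
        obtain ⟨hθ1, -, hθ3⟩ := mem_star.1 hθ
        have hmem : ∀ᶠ ε in 𝓝[>] (0 : ℝ), x + ε • z ∈ Y.support := by
          filter_upwards [self_mem_nhdsWithin] with ε hε
          exact mem_support.2 ⟨θ, hθ1, θ.add_mem (hθ3.le hxρ.1)
            (θ.smul_mem (le_of_lt (by simpa using hε)) hz)⟩
        obtain ⟨σ', hσ', c, hc, h⟩ := hloc z hmem (hspan ▸ hzρ)
        exact ⟨⟨σ', hσ'⟩, c, hc, hspan ▸ h⟩)
      (by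
        intro a ha
        let b : PointedCone ℝ V → ℝ := fun σ => if h : σ ∈ D.star τ then a ⟨σ, h⟩ else 0
        have hb : ∀ s : {σ // σ ∈ D.star τ}, b s.1 = a s := fun s => dif_pos s.2
        have h1 : ∑ σ ∈ D.star τ, b σ • v σ ∈ linSpan τ := by
          rw [← Finset.sum_coe_sort, hspan]
          simpa only [hb] using ha
        rcases hrel b h1 with h | h
        · exact Or.inl fun s => by rw [← hb]; exact h s.1 s.2
        · exact Or.inr fun s => by rw [← hb]; exact h s.1 s.2)
      ⟨σ, hσ⟩
    obtain ⟨hθ1, -, hθ3⟩ := mem_star.1 hθ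
    obtain ⟨hσ1, hσ2, hσ3⟩ := mem_star.1 hσ
    obtain ⟨y, hy⟩ := (hD.rational σ hσ1).exists_inRelint
    obtain ⟨c, hc, hyc⟩ := exists_nonneg_smul_sub_mem hσ3 hσ2 (hv σ hσ) (hvn σ hσ) hy.1
    have hw : (y - c • v σ) + c • (v σ - z) ∈ linSpan ρ :=
      (linSpan ρ).add_mem (hspan ▸ hyc) ((linSpan ρ).smul_mem _ hvz)
    obtain ⟨ε, hε, hpos⟩ := ((hxρ.eventually hw).and self_mem_nhdsWithin).exists
    replace hpos : 0 < ε := by simpa using hpos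
    refine ⟨ε • y + x, (hy.smul hpos).add_mem (hσ3.le hxτ.1), mem_support.2 ⟨θ, hθ1, ?_⟩⟩
    have : ε • y + x = (x + ε • ((y - c • v σ) + c • (v σ - z))) + (ε * c) • z := by module
    rw [this]
    exact θ.add_mem (hθ3.le hε) (θ.smul_mem (mul_nonneg hpos.le hc) hz)

/-- Two top-dimensional cones of a fan are adjacent at a rigid wall. -/
def RigidlyAdjacent (D : WeightedFan V) (σ σ' : PointedCone ℝ V) : Prop :=
  ∃ τ, D.IsRigidWall τ ∧ σ ∈ D.star τ ∧ σ' ∈ D.star τ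

omit [FiniteDimensional ℝ V] in
theorem RigidlyAdjacent.symm {σ σ' : PointedCone ℝ V} (h : D.RigidlyAdjacent σ σ') :
    D.RigidlyAdjacent σ' σ := by
  obtain ⟨τ, h1, h2, h3⟩ := h
  exact ⟨τ, h1, h3, h2⟩

/-- A tropical fan all of whose top-dimensional cones can be reached from each other by crossing
rigid walls is irreducible. -/
theorem IsTropicalFan.isIrreducible (hD : D.IsTropicalFan Λ) (hne : D.cones.Nonempty)
    (hconn : ∀ σ ∈ D.cones, coneDim σ = D.dim → ∀ σ' ∈ D.cones, coneDim σ' = D.dim →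
      Relation.ReflTransGen D.RigidlyAdjacent σ σ') :
    D.IsIrreducible Λ := by
  refine ⟨hD, hne, ?_⟩
  rintro ⟨Y, hY, ⟨η', hη'⟩, hdim, hsub⟩
  -- `Y` meets the relative interior of some top-dimensional cone of `D`
  obtain ⟨η, hη, hηd, -⟩ := hY.pure η' hη'
  obtain ⟨x₀, hx₀⟩ := (hY.rational η hη).exists_inRelint
  let ι := {ρ // ρ ∈ D.cones ∧ coneDim ρ < D.dim}
  have : Finite ι := Set.Finite.subset D.cones.finite_toSet (fun ρ h => h.1)
  obtain ⟨w, hw, havoid⟩ := exists_direction_avoiding (linSpan η)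
    (fun ρ : ι => linSpan ρ.1) fun ρ hle => by
      have h1 := Submodule.finrank_mono hle
      have h2 := ρ.2.2
      simp only [coneDim] at h2 hηd
      omega
  obtain ⟨ε, hx, hxa⟩ := ((hx₀.eventually_inRelint hw).and (havoid x₀)).exists
  have hxY : x₀ + ε • w ∈ Y.support := mem_support.2 ⟨η, hη, hx.1⟩
  obtain ⟨σ₀, hσ₀, hxσ₀⟩ := hD.exists_inRelint (hsub.1 hxY)
  have hd₀ : coneDim σ₀ = D.dim := by
    by_contra hcon
    exact hxa ⟨σ₀, hσ₀, lt_of_le_of_ne (hD.coneDim_le hσ₀) hcon⟩ (le_linSpan σ₀ hxσ₀.1)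
  have hall : ∀ σ ∈ D.cones, coneDim σ = D.dim → ∀ x, InRelint σ x → x ∈ Y.support := by
    intro σ hσ hd
    have := hconn σ₀ hσ₀ hd₀ σ hσ hd
    clear hd hσ
    induction this with
    | refl => exact fun q hq => hD.mem_support_of_meets_facet hY hdim hsub.1 hσ₀ hd₀ hxσ₀ hxY hq
    | tail _ h ih =>
      obtain ⟨τ, hτ, h1, h2⟩ := h
      obtain ⟨x, hx, hxY⟩ := hD.meets_star_of_isRigidWall hY hdim hsub.1 hτ h1 ih h2
      obtain ⟨h3, h4, -⟩ := mem_star.1 h2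
      exact fun q hq => hD.mem_support_of_meets_facet hY hdim hsub.1 h3
        (by rw [h4]; exact hτ.2.1) hx hxY hq
  refine hsub.2 fun x hx => ?_
  obtain ⟨σ', hσ', hxσ'⟩ := mem_support.1 hx
  obtain ⟨σ, hσ, hd, hface⟩ := hD.pure σ' hσ'
  obtain ⟨y, hy⟩ := (hD.rational σ hσ).exists_inRelint
  have : ∀ᶠ ε in 𝓝[>] (0 : ℝ), x + ε • y ∈ Y.support := by
    filter_upwards [self_mem_nhdsWithin] with ε hε
    rw [add_comm]
    exact hall σ hσ hd _ ((hy.smul (by simpa using hε)).add_mem (hface.le hxσ'))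
  obtain ⟨ρ, hρ, hxρ, -⟩ := hY.exists_cone_of_frequently this.frequently
  exact mem_support.2 ⟨ρ, hρ, hxρ⟩

end WeightedFan

end AbstractIrreducibility
end TropM

/-! ### Vectors of splits and the lengths of edges -/

namespace TropM
section Splits

variable {n : ℕ}

/-- Two sets of markings are nested if they are disjoint or one contains the other. -/
def Nested (I J : Finset (Fin n)) : Prop := Disjoint I J ∨ I ⊆ J ∨ J ⊆ I

/-- A rooted description of combinatorial types: after choosing a marking `r` as a root, each split
is represented by its side that does not contain `r`. Compatibility then means that the sides form
a laminar family, i.e. that they are pairwise nested. -/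
structure IsLaminar (r : Fin n) (F : Finset (Finset (Fin n))) : Prop where
  root : ∀ I ∈ F, r ∉ I
  proper : ∀ I ∈ F, IsProper I
  nested : ∀ I ∈ F, ∀ J ∈ F, Nested I J

theorem Nested.symm {I J : Finset (Fin n)} (h : Nested I J) : Nested J I := by
  rcases h with h | h | h
  · exact Or.inl h.symm
  · exact Or.inr (Or.inr h)
  · exact Or.inr (Or.inl h)

theorem Nested.subset_or_subset {I J : Finset (Fin n)} (h : Nested I J) {i : Fin n} (hI : i ∈ I)
    (hJ : i ∈ J) : I ⊆ J ∨ J ⊆ I :=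
  h.resolve_left fun hd => Finset.disjoint_left.1 hd hI hJ

theorem IsLaminar.subset {r : Fin n} {F G : Finset (Finset (Fin n))} (h : IsLaminar r G)
    (hFG : F ⊆ G) : IsLaminar r F :=
  ⟨fun I hI => h.root I (hFG hI), fun I hI => h.proper I (hFG hI),
    fun I hI J hJ => h.nested I (hFG hI) J (hFG hJ)⟩

theorem IsProper.nonempty {I : Finset (Fin n)} (h : IsProper I) : I.Nonempty :=
  Finset.card_pos.1 (by have := h.1; omega)

theorem splitVec_compl (I : Finset (Fin n)) : splitVec Iᶜ = splitVec I := by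
  simp only [splitVec, Finset.mem_compl, not_iff_not]

theorem splitVec_singleton (i : Fin n) : splitVec {i} = 0 := by
  rw [splitVec, Submodule.Quotient.mk_eq_zero]
  refine ⟨Pi.single i 1, ?_⟩
  funext p
  have := p.2.ne
  simp only [lineality, LinearMap.coe_mk, AddHom.coe_mk, Finset.mem_singleton, Pi.single_apply]
  by_cases h1 : p.1.1 = i <;> by_cases h2 : p.1.2 = i <;> simp_all

theorem splitVec_compl_singleton (i : Fin n) : splitVec ({i}ᶜ : Finset (Fin n)) = 0 := by
  rw [splitVec_compl, splitVec_singleton]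

/-- For a 4-valent vertex with branches `A`, `B`, `C` and the complement of `A ∪ B ∪ C`, the sum of
its three resolutions is the sum of its four edges. -/
theorem splitVec_union_add {A B C : Finset (Fin n)} (hAB : Disjoint A B) (hAC : Disjoint A C)
    (hBC : Disjoint B C) :
    splitVec (A ∪ B) + splitVec (A ∪ C) + splitVec (B ∪ C) =
      splitVec A + splitVec B + splitVec C + splitVec (A ∪ B ∪ C) := by
  simp only [splitVec, ← Submodule.Quotient.mk_add]
  congr 1
  funext p
  simp only [Pi.add_apply, Finset.mem_union]
  have h : ∀ i, ¬ (i ∈ A ∧ i ∈ B) ∧ ¬ (i ∈ A ∧ i ∈ C) ∧ ¬ (i ∈ B ∧ i ∈ C) := fun i =>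
    ⟨fun h => Finset.disjoint_left.1 hAB h.1 h.2, fun h => Finset.disjoint_left.1 hAC h.1 h.2,
      fun h => Finset.disjoint_left.1 hBC h.1 h.2⟩
  have h1 := h p.1.1
  have h2 := h p.1.2
  revert h1 h2
  by_cases a1 : p.1.1 ∈ A <;> by_cases b1 : p.1.1 ∈ B <;> by_cases c1 : p.1.1 ∈ C <;>
    by_cases a2 : p.1.2 ∈ A <;> by_cases b2 : p.1.2 ∈ B <;> by_cases c2 : p.1.2 ∈ C <;>
    norm_num [a1, b1, c1, a2, b2, c2]

/-- The coordinate of a vector of `ℝ^(n choose 2)` at the pair `{i, j}`, and `0` if `i = j`. -/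
def pairCoord (i j : Fin n) : (Pairs n → ℝ) →ₗ[ℝ] ℝ :=
  if h : i < j then LinearMap.proj ⟨(i, j), h⟩ else
    if h : j < i then LinearMap.proj ⟨(j, i), h⟩ else 0

theorem pairCoord_lineality {i j : Fin n} (hij : i ≠ j) (a : Fin n → ℝ) :
    pairCoord i j (lineality n a) = a i + a j := by
  rcases lt_or_gt_of_ne hij with h | h
  · simp [pairCoord, h, lineality]
  · simp [pairCoord, h, h.not_gt, lineality, add_comm]

theorem pairCoord_split {i j : Fin n} (hij : i ≠ j) (I : Finset (Fin n)) :
    pairCoord i j (fun p => if (p.1.1 ∈ I ↔ p.1.2 ∈ I) then 0 else 1) =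
      if (i ∈ I ↔ j ∈ I) then 0 else 1 := by
  rcases lt_or_gt_of_ne hij with h | h
  · simp [pairCoord, h]
  · simp only [pairCoord, h, h.not_gt, dif_pos, dif_neg, not_false_eq_true, LinearMap.proj_apply]
    simp only [iff_comm]

/-- The difference of the total length of the edges separating `i, j` from `k, r` and the total
length of those separating `i, k` from `j, r`, as a linear form on the ambient space of `M_{0,n}`.
-/
theorem exists_quartet_form {r i j k : Fin n} (hij : i ≠ j) (hik : i ≠ k) (hjr : j ≠ r)
    (hkr : k ≠ r) :
    ∃ f : Ambient n →ₗ[ℝ] ℝ, ∀ J : Finset (Fin n), r ∉ J → f (splitVec J) =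
      (if i ∈ J ∧ j ∈ J ∧ k ∉ J then 1 else 0) - (if i ∈ J ∧ k ∈ J ∧ j ∉ J then 1 else 0) := by
  refine ⟨Submodule.liftQ _
    ((1 / 2 : ℝ) • (pairCoord i k + pairCoord j r - pairCoord i j - pairCoord k r)) ?_, ?_⟩
  · rintro _ ⟨a, rfl⟩
    rw [LinearMap.mem_ker]
    simp only [LinearMap.smul_apply, LinearMap.sub_apply, LinearMap.add_apply,
      pairCoord_lineality hij, pairCoord_lineality hik, pairCoord_lineality hjr,
      pairCoord_lineality hkr]
    ring_nf
  · intro J hJ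
    rw [splitVec, Submodule.liftQ_apply]
    simp only [LinearMap.smul_apply, LinearMap.sub_apply, LinearMap.add_apply,
      pairCoord_split hij, pairCoord_split hik, pairCoord_split hjr,
      pairCoord_split hkr]
    by_cases hi : i ∈ J <;> by_cases hj : j ∈ J <;> by_cases hk : k ∈ J <;>
      simp [hi, hj, hk, hJ] <;> norm_num

/-- In a tree, the branches at the two ends of the edge `S` contain markings `i, j` and `k, r` that
are separated by no other edge. -/
theorem IsLaminar.exists_separated {r : Fin n} {F : Finset (Finset (Fin n))} (hF : IsLaminar r F)
    {S : Finset (Fin n)} (hS : IsProper S) (hSF : ∀ J ∈ F, Nested S J) :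
    ∃ i ∈ S, ∃ j ∈ S, ∃ k ∉ S, i ≠ j ∧ k ≠ r ∧ ∀ J ∈ F, i ∈ J → j ∈ J → k ∉ J → J = S := by
  classical
  have hin : ∃ i ∈ S, ∃ j ∈ S, i ≠ j ∧ ∀ J ∈ F, J ⊂ S → i ∈ J → j ∉ J := by
    by_cases h : ∃ J ∈ F, J ⊂ S
    · obtain ⟨J₀, hJ₀, hmax⟩ := (F.filter (· ⊂ S)).exists_max_image Finset.card
        (by obtain ⟨J, hJ, hJS⟩ := h; exact ⟨J, Finset.mem_filter.2 ⟨hJ, hJS⟩⟩)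
      rw [Finset.mem_filter] at hJ₀
      obtain ⟨i, hi⟩ := (hF.proper J₀ hJ₀.1).nonempty
      obtain ⟨j, hjS, hj⟩ := Finset.exists_of_ssubset hJ₀.2
      refine ⟨i, hJ₀.2.1 hi, j, hjS, fun h => hj (h ▸ hi), fun J hJ hJS hiJ hjJ => ?_⟩
      rcases (hF.nested J hJ J₀ hJ₀.1).subset_or_subset hiJ hi with h1 | h1
      · exact hj (h1 hjJ)
      · have := Finset.card_lt_card (Finset.ssubset_iff_subset_ne.2 ⟨h1, fun h => hj (h ▸ hjJ)⟩)
        have := hmax J (Finset.mem_filter.2 ⟨hJ, hJS⟩)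
        omega
    · obtain ⟨i, hi, j, hj, hij⟩ := Finset.one_lt_card.1 (show 1 < S.card from hS.1)
      exact ⟨i, hi, j, hj, hij, fun J hJ hJS => absurd ⟨J, hJ, hJS⟩ h⟩
  have hout : ∃ k ∉ S, k ≠ r ∧ ∀ J ∈ F, S ⊂ J → k ∈ J := by
    by_cases h : ∃ J ∈ F, S ⊂ J
    · obtain ⟨J₁, hJ₁, hmin⟩ := (F.filter (S ⊂ ·)).exists_min_image Finset.card
        (by obtain ⟨J, hJ, hJS⟩ := h; exact ⟨J, Finset.mem_filter.2 ⟨hJ, hJS⟩⟩)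
      rw [Finset.mem_filter] at hJ₁
      obtain ⟨k, hkJ, hkS⟩ := Finset.exists_of_ssubset hJ₁.2
      obtain ⟨i, hi⟩ := hS.nonempty
      refine ⟨k, hkS, fun h => hF.root J₁ hJ₁.1 (h ▸ hkJ), fun J hJ hSJ => ?_⟩
      rcases (hF.nested J hJ J₁ hJ₁.1).subset_or_subset (hSJ.1 hi) (hJ₁.2.1 hi) with h1 | h1
      · have := hmin J (Finset.mem_filter.2 ⟨hJ, hSJ⟩)
        rwa [Finset.eq_of_subset_of_card_le h1 this]
      · exact h1 hkJ
    · obtain ⟨k, hk⟩ : ∃ k, k ∉ insert r S := by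
        by_contra hcon
        push Not at hcon
        have h1 : (insert r S).card = n := by
          rw [Finset.eq_univ_iff_forall.2 hcon, Finset.card_fin]
        have h2 := Finset.card_insert_le r S
        have h3 := hS.2
        omega
      rw [Finset.mem_insert, not_or] at hk
      exact ⟨k, hk.2, hk.1, fun J hJ hJS => absurd ⟨J, hJ, hJS⟩ h⟩
  obtain ⟨i, hi, j, hj, hij, h1⟩ := hin
  obtain ⟨k, hk, hkr, h2⟩ := hout
  refine ⟨i, hi, j, hj, k, hk, hij, hkr, fun J hJ hiJ hjJ hkJ => ?_⟩
  by_contra hne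
  rcases (hSF J hJ).subset_or_subset hi hiJ with h | h
  · exact hkJ (h2 J hJ (Finset.ssubset_iff_subset_ne.2 ⟨h, Ne.symm hne⟩))
  · exact h1 J hJ (Finset.ssubset_iff_subset_ne.2 ⟨h, hne⟩) hiJ hjJ

/-- Dual bases for laminar families, with integer values on the lattice. -/
theorem IsLaminar.exists_dual {r : Fin n} {F : Finset (Finset (Fin n))} (hF : IsLaminar r F)
    {S : Finset (Fin n)} (hS : S ∈ F) :
    ∃ f : Ambient n →ₗ[ℝ] ℝ, f (splitVec S) = 1 ∧ (∀ J ∈ F, J ≠ S → f (splitVec J) = 0) ∧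
      ∀ x ∈ lattice n, ∃ m : ℤ, f x = m := by
  obtain ⟨i, hi, j, hj, k, hk, hij, hkr, h⟩ := hF.exists_separated (hF.proper S hS)
    fun J hJ => hF.nested S hS J hJ
  have hr := hF.root S hS
  obtain ⟨f, hf⟩ := exists_quartet_form (r := r) hij (k := k) (fun h => hk (h ▸ hi))
    (fun h => hr (h ▸ hj)) hkr
  refine ⟨f, ?_, ?_, ?_⟩
  · rw [hf S hr]
    simp [hi, hj, hk]
  · intro J hJ hne
    rw [hf J (hF.root J hJ), if_neg fun h' => hne (h J hJ h'.1 h'.2.1 h'.2.2), if_neg, sub_zero]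
    rintro ⟨h1, h2, h3⟩
    rcases (hF.nested S hS J hJ).subset_or_subset hi h1 with h' | h'
    · exact h3 (h' hj)
    · exact hk (h' h2)
  · intro x hx
    induction hx using AddSubgroup.closure_induction with
    | mem x hx =>
      have key : ∀ J : Finset (Fin n), r ∉ J → ∃ m : ℤ, f (splitVec J) = m := by
        intro J hJ
        rw [hf J hJ]
        exact ⟨(if i ∈ J ∧ j ∈ J ∧ k ∉ J then 1 else 0) - (if i ∈ J ∧ k ∈ J ∧ j ∉ J then 1 else 0),
          by push_cast; rfl⟩
      obtain ⟨I, -, rfl⟩ := hx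
      by_cases hI : r ∈ I
      · rw [← splitVec_compl]
        exact key _ (by simpa using hI)
      · exact key I hI
    | zero => exact ⟨0, by simp⟩
    | add x y _ _ hx hy =>
      obtain ⟨a, ha⟩ := hx
      obtain ⟨b, hb⟩ := hy
      exact ⟨a + b, by rw [map_add, ha, hb]; push_cast; rfl⟩
    | neg x _ hx =>
      obtain ⟨a, ha⟩ := hx
      exact ⟨-a, by rw [map_neg, ha]; push_cast; rfl⟩

/-- The point `x` is `∑ c I • v_I`, where `c` is non-negative and its support is a laminar family.
-/
structure IsRootedCurve (r : Fin n) (x : Ambient n) (c : Finset (Fin n) → ℝ) : Prop where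
  nonneg : ∀ I, 0 ≤ c I
  exists_laminar : ∃ F, IsLaminar r F ∧ ∀ I, I ∉ F → c I = 0
  eq_sum : x = ∑ I, c I • splitVec I

theorem IsRootedCurve.root {r : Fin n} {x : Ambient n} {c : Finset (Fin n) → ℝ}
    (h : IsRootedCurve r x c) {I : Finset (Fin n)} (hI : c I ≠ 0) : r ∉ I := by
  obtain ⟨F, hF, hc⟩ := h.exists_laminar
  exact hF.root I (by by_contra hIF; exact hI (hc I hIF))

theorem IsRootedCurve.nested {r : Fin n} {x : Ambient n} {c : Finset (Fin n) → ℝ}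
    (h : IsRootedCurve r x c) {I J : Finset (Fin n)} (hI : c I ≠ 0) (hJ : c J ≠ 0) :
    Nested I J := by
  obtain ⟨F, hF, hc⟩ := h.exists_laminar
  exact hF.nested I (by by_contra hIF; exact hI (hc I hIF)) J
    (by by_contra hIF; exact hJ (hc J hIF))

/-- The total length of the edges that separate `i, j` from `k` and the root. -/
def sepLength (c : Finset (Fin n) → ℝ) (i j k : Fin n) : ℝ :=
  ∑ J, c J * if i ∈ J ∧ j ∈ J ∧ k ∉ J then 1 else 0

theorem le_sepLength {c : Finset (Fin n) → ℝ} (hc : ∀ I, 0 ≤ c I) {i j k : Fin n}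
    {S : Finset (Fin n)} (hi : i ∈ S) (hj : j ∈ S) (hk : k ∉ S) : c S ≤ sepLength c i j k := by
  have := Finset.single_le_sum (f := fun J => c J * if i ∈ J ∧ j ∈ J ∧ k ∉ J then (1 : ℝ) else 0)
    (fun J _ => mul_nonneg (hc J) (by split_ifs <;> norm_num)) (Finset.mem_univ S)
  simpa [hi, hj, hk, sepLength] using this

theorem sepLength_nonneg {c : Finset (Fin n) → ℝ} (hc : ∀ I, 0 ≤ c I) (i j k : Fin n) :
    0 ≤ sepLength c i j k :=
  Finset.sum_nonneg fun J _ => mul_nonneg (hc J) (by split_ifs <;> norm_num)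

/-- In a tree, edges separating `i, j` from `k, r` exclude edges separating `i, k` from `j, r`. -/
theorem IsRootedCurve.sepLength_eq_zero {r : Fin n} {x : Ambient n} {c : Finset (Fin n) → ℝ}
    (h : IsRootedCurve r x c) {i j k : Fin n} (hpos : 0 < sepLength c i j k) :
    sepLength c i k j = 0 := by
  obtain ⟨J, -, hJ⟩ := Finset.exists_ne_zero_of_sum_ne_zero hpos.ne'
  have hcJ := left_ne_zero_of_mul hJ
  have hmem : i ∈ J ∧ j ∈ J ∧ k ∉ J := by
    by_contra hcon
    exact hJ (by rw [if_neg hcon, mul_zero])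
  refine Finset.sum_eq_zero fun J' _ => ?_
  by_cases hcJ' : c J' = 0
  · rw [hcJ', zero_mul]
  rw [if_neg, mul_zero]
  rintro ⟨h1, h2, h3⟩
  rcases (h.nested hcJ hcJ').subset_or_subset hmem.1 h1 with h' | h'
  · exact h3 (h' hmem.2.1)
  · exact hmem.2.2 (h' h2)

theorem IsRootedCurve.sepLength_le {r : Fin n} {x : Ambient n} {c c' : Finset (Fin n) → ℝ}
    (h : IsRootedCurve r x c) (h' : IsRootedCurve r x c') {i j k : Fin n} (hij : i ≠ j)
    (hik : i ≠ k) (hjr : j ≠ r) (hkr : k ≠ r) :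
    sepLength c i j k ≤ sepLength c' i j k := by
  obtain ⟨f, hf⟩ := exists_quartet_form hij hik hjr hkr
  have key : ∀ c, IsRootedCurve r x c → f x = sepLength c i j k - sepLength c i k j := by
    intro c h
    rw [h.eq_sum, map_sum, sepLength, sepLength, ← Finset.sum_sub_distrib]
    refine Finset.sum_congr rfl fun J _ => ?_
    rw [map_smul, smul_eq_mul, ← mul_sub]
    by_cases hJ : c J = 0
    · rw [hJ, zero_mul, zero_mul]
    · rw [hf J (h.root hJ)]
  rcases (sepLength_nonneg h.nonneg i j k).eq_or_lt with h0 | h0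
  · rw [← h0]
    exact sepLength_nonneg h'.nonneg i j k
  · have h1 := key c h
    have h2 := key c' h'
    rw [h.sepLength_eq_zero h0] at h1
    have := sepLength_nonneg h'.nonneg i k j
    linarith

/-- The tree and the edge lengths of a tropical curve are determined by its point in `M_{0,n}`: the
length of an edge `S` is the minimum of the total lengths of the edges separating `i, j` from `k,
r`, for `i, j` on one side of `S` and `k` on the other. -/
theorem IsRootedCurve.unique {r : Fin n} {x : Ambient n} {c c' : Finset (Fin n) → ℝ}
    (h : IsRootedCurve r x c) (h' : IsRootedCurve r x c') : c = c' := by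
  suffices key : ∀ c c', IsRootedCurve r x c → IsRootedCurve r x c' → ∀ S, c S ≤ c' S from
    funext fun S => le_antisymm (key c c' h h' S) (key c' c h' h S)
  clear h h' c c'
  intro c c' h h' S
  by_contra hlt
  push Not at hlt
  have hpos : 0 < c S := lt_of_le_of_lt (h'.nonneg S) hlt
  have hr := h.root hpos.ne'
  obtain ⟨F', hF', hc'⟩ := h'.exists_laminar
  obtain ⟨F, hF, hc⟩ := h.exists_laminar
  have hSF : S ∈ F := by by_contra hcon; exact hpos.ne' (hc S hcon)
  by_cases hnest : ∀ J ∈ F'.filter (c' · ≠ 0), Nested S J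
  · obtain ⟨i, hi, j, hj, k, hk, hij, hkr, hsep⟩ :=
      (hF'.subset (Finset.filter_subset (c' · ≠ 0) F')).exists_separated (hF.proper S hSF) hnest
    have h1 := le_sepLength h.nonneg hi hj hk
    have h2 := h.sepLength_le h' hij (ne_of_mem_of_not_mem hi hk) (ne_of_mem_of_not_mem hj hr) hkr
    have h3 : sepLength c' i j k = c' S := by
      rw [sepLength, Finset.sum_eq_single S]
      · simp [hi, hj, hk]
      · intro J _ hne
        by_cases hJ : c' J = 0
        · rw [hJ, zero_mul]
        rw [if_neg, mul_zero]
        rintro ⟨g1, g2, g3⟩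
        refine hne (hsep J (Finset.mem_filter.2 ⟨?_, hJ⟩) g1 g2 g3)
        by_contra hcon
        exact hJ (hc' J hcon)
      · simp
    linarith
  · push Not at hnest
    obtain ⟨J, hJ, hnest⟩ := hnest
    obtain ⟨hJF, hJ0⟩ := Finset.mem_filter.1 hJ
    simp only [Nested, not_or, Finset.not_disjoint_iff, Finset.not_subset] at hnest
    obtain ⟨⟨i, hiS, hiJ⟩, ⟨j, hjS, hjJ⟩, ⟨k, hkJ, hkS⟩⟩ := hnest
    have hrJ := hF'.root J hJF
    have hij : i ≠ j := fun h => hjJ (h ▸ hiJ)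
    have hik : i ≠ k := fun h => hkS (h ▸ hiS)
    have hjr : j ≠ r := fun h => hr (h ▸ hjS)
    have hkr : k ≠ r := fun h => hrJ (h ▸ hkJ)
    have h1 := le_sepLength h.nonneg hiS hjS hkS
    have h2 := h.sepLength_le h' hij hik hjr hkr
    have h3 := le_sepLength h'.nonneg hiJ hkJ hjJ
    have h4 := h'.sepLength_eq_zero (i := i) (j := j) (k := k) (by linarith)
    have h5 := lt_of_le_of_ne (h'.nonneg J) (Ne.symm hJ0)
    linarith

end Splits
end TropM

/-! ### Trees as laminar families -/

namespace TropM
section Laminar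

variable {n : ℕ} {r : Fin n} {F : Finset (Finset (Fin n))}

theorem IsLaminar.insert_of_nested {I : Finset (Fin n)} (hF : IsLaminar r F) (hr : r ∉ I)
    (hI : IsProper I) (h : ∀ J ∈ F, Nested I J) : IsLaminar r (insert I F) := by
  refine ⟨fun J hJ => ?_, fun J hJ => ?_, fun J hJ K hK => ?_⟩
  · rcases Finset.mem_insert.1 hJ with rfl | hJ
    exacts [hr, hF.root J hJ]
  · rcases Finset.mem_insert.1 hJ with rfl | hJ
    exacts [hI, hF.proper J hJ]
  · rw [Finset.mem_insert] at hJ hK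
    rcases hJ with rfl | hJ <;> rcases hK with rfl | hK
    · exact Or.inr (Or.inl subset_rfl)
    · exact h K hK
    · exact (h _ hJ).symm
    · exact hF.nested J hJ K hK

theorem nested_singleton (i : Fin n) (I : Finset (Fin n)) : Nested {i} I := by
  by_cases h : i ∈ I
  · exact Or.inr (Or.inl (by simpa using h))
  · exact Or.inl (by simpa using h)

theorem subset_compl_singleton_of_notMem {I : Finset (Fin n)} (h : r ∉ I) :
    I ⊆ {r}ᶜ := fun i hi => by
  simpa using ne_of_mem_of_not_mem hi h

theorem card_compl_singleton (r : Fin n) : ({r}ᶜ : Finset (Fin n)).card = n - 1 := by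
  rw [Finset.card_compl, Finset.card_singleton, Fintype.card_fin]

/-- The edges of the tree given by a laminar family, except for the edge at the root: the bounded
edges and the edges leading to the markings other than `r`. -/
def edges (r : Fin n) (F : Finset (Finset (Fin n))) : Finset (Finset (Fin n)) :=
  F ∪ ({r}ᶜ : Finset (Fin n)).image fun i => {i}

/-- The inner vertices of the tree given by a laminar family. Each vertex is represented by the set
of markings that it separates from the root; the largest such set belongs to the vertex at the
root. -/
def vertices (r : Fin n) (F : Finset (Finset (Fin n))) : Finset (Finset (Fin n)) :=
  insert {r}ᶜ F

theorem mem_edges {A : Finset (Fin n)} : A ∈ edges r F ↔ A ∈ F ∨ ∃ i, i ≠ r ∧ A = {i} := by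
  simp [edges, eq_comm]

theorem mem_vertices {P : Finset (Fin n)} : P ∈ vertices r F ↔ P = {r}ᶜ ∨ P ∈ F := by
  simp [vertices]

/-- The edges leaving the vertex `P` in the direction away from the root. -/
def children (r : Fin n) (F : Finset (Finset (Fin n))) (P : Finset (Fin n)) :
    Finset (Finset (Fin n)) :=
  (edges r F).filter fun A => A ⊂ P ∧ ∀ Q ∈ vertices r F, A ⊂ Q → P ⊆ Q

theorem mem_children {A P : Finset (Fin n)} :
    A ∈ children r F P ↔ A ∈ edges r F ∧ A ⊂ P ∧ ∀ Q ∈ vertices r F, A ⊂ Q → P ⊆ Q := by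
  simp [children]

namespace IsLaminar

theorem notMem_vertex (hF : IsLaminar r F) {P : Finset (Fin n)} (hP : P ∈ vertices r F) :
    r ∉ P := by
  rcases mem_vertices.1 hP with rfl | h
  · simp
  · exact hF.root P h

theorem two_le_card_vertex (hF : IsLaminar r F) (hn : 3 ≤ n) {P : Finset (Fin n)}
    (hP : P ∈ vertices r F) : 2 ≤ P.card := by
  rcases mem_vertices.1 hP with rfl | h
  · rw [card_compl_singleton]; omega
  · exact (hF.proper P h).1

theorem nonempty_edge (hF : IsLaminar r F) {A : Finset (Fin n)} (hA : A ∈ edges r F) :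
    A.Nonempty := by
  rcases mem_edges.1 hA with h | ⟨i, -, rfl⟩
  · exact (hF.proper A h).nonempty
  · simp

theorem notMem_edge (hF : IsLaminar r F) {A : Finset (Fin n)} (hA : A ∈ edges r F) : r ∉ A := by
  rcases mem_edges.1 hA with h | ⟨i, hi, rfl⟩
  · exact hF.root A h
  · simpa using hi.symm

theorem nested_vertices (hF : IsLaminar r F) {P Q : Finset (Fin n)} (hP : P ∈ vertices r F)
    (hQ : Q ∈ vertices r F) : Nested P Q := by
  have hP' := subset_compl_singleton_of_notMem (hF.notMem_vertex hP)
  have hQ' := subset_compl_singleton_of_notMem (hF.notMem_vertex hQ)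
  rcases mem_vertices.1 hP with rfl | h
  · exact Or.inr (Or.inr hQ')
  rcases mem_vertices.1 hQ with rfl | h'
  · exact Or.inr (Or.inl hP')
  exact hF.nested P h Q h'

theorem nested_edges (hF : IsLaminar r F) {A B : Finset (Fin n)} (hA : A ∈ edges r F)
    (hB : B ∈ edges r F) : Nested A B := by
  rcases mem_edges.1 hA with h | ⟨i, hi, rfl⟩
  · rcases mem_edges.1 hB with h' | ⟨i, hi, rfl⟩
    · exact hF.nested A h B h'
    · exact (nested_singleton i A).symm
  · exact nested_singleton i B

theorem mem_of_ssubset_edge {A B : Finset (Fin n)} (hA : A.Nonempty)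
    (hB : B ∈ edges r F) (hAB : A ⊂ B) : B ∈ F := by
  rcases mem_edges.1 hB with h | ⟨i, hi, rfl⟩
  · exact h
  · have := Finset.card_lt_card hAB
    have := hA.card_pos
    rw [Finset.card_singleton] at *
    omega

/-- Among the vertices that strictly contain a given nonempty set of markings there is a smallest
one, as they form a chain. -/
theorem exists_smallest_vertex (hF : IsLaminar r F) {A : Finset (Fin n)} (hA : A.Nonempty)
    (hAt : A ⊂ {r}ᶜ) : ∃ P ∈ vertices r F, A ⊂ P ∧ ∀ Q ∈ vertices r F, A ⊂ Q → P ⊆ Q := by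
  obtain ⟨P, hP, hmin⟩ := ((vertices r F).filter (A ⊂ ·)).exists_min_image Finset.card
    ⟨{r}ᶜ, Finset.mem_filter.2 ⟨mem_vertices.2 (Or.inl rfl), hAt⟩⟩
  rw [Finset.mem_filter] at hP
  refine ⟨P, hP.1, hP.2, fun Q hQ hAQ => ?_⟩
  obtain ⟨i, hi⟩ := hA
  rcases (hF.nested_vertices hP.1 hQ).subset_or_subset (hP.2.1 hi) (hAQ.1 hi) with h | h
  · exact h
  · rw [Finset.eq_of_subset_of_card_le h (hmin Q (Finset.mem_filter.2 ⟨hQ, hAQ⟩))]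

theorem edge_ssubset (hF : IsLaminar r F) (hn : 3 ≤ n) {A : Finset (Fin n)} (hA : A ∈ edges r F) :
    A ⊂ {r}ᶜ := by
  refine Finset.ssubset_iff_subset_ne.2
    ⟨subset_compl_singleton_of_notMem (hF.notMem_edge hA), fun h => ?_⟩
  have hc := card_compl_singleton r
  rw [← h] at hc
  rcases mem_edges.1 hA with h | ⟨i, hi, rfl⟩
  · have := (hF.proper A h).2
    omega
  · rw [Finset.card_singleton] at hc
    omega

theorem children_disjoint (hF : IsLaminar r F) {P A B : Finset (Fin n)} (hA : A ∈ children r F P)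
    (hB : B ∈ children r F P) (hne : A ≠ B) : Disjoint A B := by
  have key : ∀ A B, A ∈ children r F P → B ∈ children r F P → A ≠ B → ¬ A ⊆ B := by
    intro A B hA hB hne hAB
    obtain ⟨hA1, hA2, hA3⟩ := mem_children.1 hA
    obtain ⟨hB1, hB2, hB3⟩ := mem_children.1 hB
    have hss := Finset.ssubset_iff_subset_ne.2 ⟨hAB, hne⟩
    have hBF := mem_of_ssubset_edge (hF.nonempty_edge hA1) hB1 hss
    exact hB2.2 (hA3 B (mem_vertices.2 (Or.inr hBF)) hss)
  rcases hF.nested_edges (mem_children.1 hA).1 (mem_children.1 hB).1 with h | h | h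
  · exact h
  · exact absurd h (key A B hA hB hne)
  · exact absurd h (key B A hB hA hne.symm)

theorem exists_child (hF : IsLaminar r F) (hn : 3 ≤ n) {P : Finset (Fin n)}
    (hP : P ∈ vertices r F) {i : Fin n} (hi : i ∈ P) : ∃ A ∈ children r F P, i ∈ A := by
  have hr := hF.notMem_vertex hP
  have h2 := hF.two_le_card_vertex hn hP
  obtain ⟨A, hA, hmax⟩ := ((edges r F).filter fun A => i ∈ A ∧ A ⊂ P).exists_max_image Finset.card
    ⟨{i}, by
      refine Finset.mem_filter.2 ⟨mem_edges.2 (Or.inr ⟨i, ne_of_mem_of_not_mem hi hr, rfl⟩),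
        Finset.mem_singleton_self i, Finset.ssubset_iff_subset_ne.2
        ⟨Finset.singleton_subset_iff.2 hi, ?_⟩⟩
      rintro rfl
      simp at h2⟩
  obtain ⟨hA1, hA2, hA3⟩ := Finset.mem_filter.1 hA
  refine ⟨A, mem_children.2 ⟨hA1, hA3, fun Q hQ hAQ => ?_⟩, hA2⟩
  rcases (hF.nested_vertices hP hQ).subset_or_subset hi (hAQ.1 hA2) with h | h
  · exact h
  by_contra hcon
  rcases mem_vertices.1 hQ with rfl | hQF
  · exact hcon (subset_compl_singleton_of_notMem hr)
  · have := hmax Q (Finset.mem_filter.2 ⟨mem_edges.2 (Or.inl hQF), hAQ.1 hA2, h, hcon⟩)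
    have := Finset.card_lt_card hAQ
    omega

theorem two_le_card_children (hF : IsLaminar r F) (hn : 3 ≤ n) {P : Finset (Fin n)}
    (hP : P ∈ vertices r F) : 2 ≤ (children r F P).card := by
  obtain ⟨i, hi⟩ : P.Nonempty := Finset.card_pos.1 (by have := hF.two_le_card_vertex hn hP; omega)
  obtain ⟨A, hA, -⟩ := hF.exists_child hn hP hi
  obtain ⟨j, hjP, hjA⟩ := Finset.exists_of_ssubset (mem_children.1 hA).2.1
  obtain ⟨B, hB, hjB⟩ := hF.exists_child hn hP hjP
  exact Finset.one_lt_card.2 ⟨A, hA, B, hB, fun h => hjA (h ▸ hjB)⟩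

theorem card_edges (hF : IsLaminar r F) : (edges r F).card = F.card + (n - 1) := by
  rw [edges, Finset.card_union_of_disjoint, Finset.card_image_of_injective _
    Finset.singleton_injective, card_compl_singleton]
  refine Finset.disjoint_left.2 fun A hA hA' => ?_
  obtain ⟨i, -, rfl⟩ := Finset.mem_image.1 hA'
  have := (hF.proper _ hA).1
  simp at this

theorem card_vertices (hF : IsLaminar r F) : (vertices r F).card = F.card + 1 := by
  refine Finset.card_insert_of_notMem fun h => ?_
  have h1 := (hF.proper _ h).2
  have h2 := (hF.proper _ h).1
  rw [card_compl_singleton] at h1 h2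
  omega

/-- Every edge except for the one at the root leaves exactly one vertex. -/
theorem sum_card_children (hF : IsLaminar r F) (hn : 3 ≤ n) :
    ∑ P ∈ vertices r F, (children r F P).card = F.card + (n - 1) := by
  rw [← hF.card_edges, ← Finset.card_biUnion]
  · congr 1
    ext A
    simp only [Finset.mem_biUnion]
    constructor
    · rintro ⟨P, -, hA⟩
      exact (mem_children.1 hA).1
    · intro hA
      obtain ⟨P, hP, h⟩ := hF.exists_smallest_vertex (hF.nonempty_edge hA) (hF.edge_ssubset hn hA)
      exact ⟨P, hP, mem_children.2 ⟨hA, h⟩⟩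
  · intro P hP Q hQ hne
    refine Finset.disjoint_left.2 fun A hA hA' => hne ?_
    obtain ⟨-, h1, h2⟩ := mem_children.1 hA
    obtain ⟨-, h3, h4⟩ := mem_children.1 hA'
    exact subset_antisymm (h2 Q hQ h3) (h4 P hP h1)

theorem card_le (hF : IsLaminar r F) (hn : 3 ≤ n) : F.card + 3 ≤ n := by
  have h1 := hF.sum_card_children hn
  have h2 := Finset.card_nsmul_le_sum (vertices r F) (fun P => (children r F P).card) 2
    fun P hP => hF.two_le_card_children hn hP
  rw [hF.card_vertices, smul_eq_mul] at h2
  omega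

/-- Splitting a vertex with at least four edges. -/
theorem insert_union_children (hF : IsLaminar r F) {P A B C : Finset (Fin n)}
    (hP : P ∈ vertices r F) (hA : A ∈ children r F P) (hB : B ∈ children r F P)
    (hC : C ∈ children r F P) (hAB : A ≠ B) (hAC : A ≠ C) (hBC : B ≠ C) :
    A ∪ B ∉ F ∧ IsLaminar r (insert (A ∪ B) F) := by
  obtain ⟨hA1, hA2, hA3⟩ := mem_children.1 hA
  obtain ⟨hB1, hB2, hB3⟩ := mem_children.1 hB
  obtain ⟨hC1, hC2, hC3⟩ := mem_children.1 hC
  have dAB := hF.children_disjoint hA hB hAB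
  have dAC := hF.children_disjoint hA hC hAC
  have dBC := hF.children_disjoint hB hC hBC
  have nA := hF.nonempty_edge hA1
  have nB := hF.nonempty_edge hB1
  have nC := hF.nonempty_edge hC1
  have hsub : A ∪ B ⊆ P := Finset.union_subset hA2.1 hB2.1
  have hss : A ⊂ A ∪ B := Finset.ssubset_iff_subset_ne.2 ⟨Finset.subset_union_left, fun h => by
    obtain ⟨i, hi⟩ := nB
    exact Finset.disjoint_left.1 dAB (h ▸ Finset.mem_union_right A hi) hi⟩
  have hdC : Disjoint (A ∪ B) C := Finset.disjoint_union_left.2 ⟨dAC, dBC⟩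
  have hr : r ∉ A ∪ B := fun h => hF.notMem_vertex hP (hsub h)
  refine ⟨fun h => ?_, hF.insert_of_nested hr ⟨?_, ?_⟩ fun J hJ => ?_⟩
  · obtain ⟨i, hi⟩ := nC
    have := hA3 (A ∪ B) (mem_vertices.2 (Or.inr h)) hss (hC2.1 hi)
    exact Finset.disjoint_left.1 hdC this hi
  · rw [Finset.card_union_of_disjoint dAB]
    have := nA.card_pos
    have := nB.card_pos
    omega
  · have h1 : (A ∪ B ∪ C).card ≤ n - 1 := by
      rw [← card_compl_singleton r]
      exact Finset.card_le_card (subset_compl_singleton_of_notMem fun h =>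
        hF.notMem_vertex hP (Finset.union_subset hsub hC2.1 h))
    rw [Finset.card_union_of_disjoint hdC] at h1
    have := nC.card_pos
    have := r.pos
    omega
  · have key : ∀ A ∈ children r F P, P ⊆ J ∨ J ⊆ A ∨ Disjoint A J := by
      intro A hA
      obtain ⟨hA1, -, hA3⟩ := mem_children.1 hA
      rcases hF.nested_edges hA1 (mem_edges.2 (Or.inl hJ)) with h | h | h
      · exact Or.inr (Or.inr h)
      · by_cases heq : A = J
        · exact Or.inr (Or.inl heq.ge)
        · exact Or.inl (hA3 J (mem_vertices.2 (Or.inr hJ))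
            (Finset.ssubset_iff_subset_ne.2 ⟨h, heq⟩))
      · exact Or.inr (Or.inl h)
    rcases key A hA with h1 | h1 | h1
    · exact Or.inr (Or.inl (hsub.trans h1))
    · exact Or.inr (Or.inr (h1.trans Finset.subset_union_left))
    rcases key B hB with h2 | h2 | h2
    · exact Or.inr (Or.inl (hsub.trans h2))
    · exact Or.inr (Or.inr (h2.trans Finset.subset_union_right))
    · exact Or.inl (Finset.disjoint_union_left.2 ⟨h1, h2⟩)

theorem exists_insert (hF : IsLaminar r F) (hn : 3 ≤ n) (hc : F.card + 3 < n) :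
    ∃ I, I ∉ F ∧ IsLaminar r (insert I F) := by
  obtain ⟨P, hP, h3⟩ : ∃ P ∈ vertices r F, 2 < (children r F P).card := by
    by_contra hcon
    push Not at hcon
    have h1 := hF.sum_card_children hn
    have h2 := Finset.sum_le_card_nsmul (vertices r F) (fun P => (children r F P).card) 2 hcon
    rw [hF.card_vertices, smul_eq_mul] at h2
    omega
  obtain ⟨A, B, C, hA, hB, hC, hAB, hAC, hBC⟩ := Finset.two_lt_card_iff.1 h3
  exact ⟨A ∪ B, hF.insert_union_children hP hA hB hC hAB hAC hBC⟩

/-- Every tree can be resolved to a trivalent tree. -/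
theorem exists_trivalent (hF : IsLaminar r F) (hn : 3 ≤ n) :
    ∃ M, F ⊆ M ∧ IsLaminar r M ∧ M.card + 3 = n := by
  have key : ∀ d, ∀ F, IsLaminar r F → F.card + 3 + d = n →
      ∃ M, F ⊆ M ∧ IsLaminar r M ∧ M.card + 3 = n := by
    intro d
    induction d with
    | zero => exact fun F hF h => ⟨F, subset_rfl, hF, h⟩
    | succ d ih =>
      intro F hF h
      obtain ⟨I, hI, hIF⟩ := hF.exists_insert hn (by omega)
      obtain ⟨M, h1, h2⟩ := ih _ hIF (by rw [Finset.card_insert_of_notMem hI]; omega)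
      exact ⟨M, (Finset.subset_insert I F).trans h1, h2⟩
  have := hF.card_le hn
  exact key (n - (F.card + 3)) F hF (by omega)

/-- Every additional bounded edge `I` resolves one of the vertices `P`: it collects at least two but
not all of the children of `P`. -/
theorem exists_vertex_of_insert (hF : IsLaminar r F) (hn : 3 ≤ n) {I : Finset (Fin n)} (hI : I ∉ F)
    (hIF : IsLaminar r (insert I F)) :
    ∃ P ∈ vertices r F, I ⊂ P ∧ (∀ A ∈ children r F P, A ⊆ I ∨ Disjoint A I) ∧
      ∃ A ∈ children r F P, ∃ B ∈ children r F P, ∃ C ∈ children r F P,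
        A ≠ B ∧ A ⊆ I ∧ B ⊆ I ∧ Disjoint C I := by
  have hIm := Finset.mem_insert_self I F
  have hIp := hIF.proper I hIm
  obtain ⟨P, hP, hIP, hmin⟩ := hF.exists_smallest_vertex hIp.nonempty
    (hIF.edge_ssubset hn (mem_edges.2 (Or.inl hIm)))
  have hne : ∀ A ∈ edges r F, I ≠ A := by
    rintro A hA rfl
    rcases mem_edges.1 hA with h | ⟨i, -, rfl⟩
    · exact hI h
    · simpa using hIp.1
  have hch : ∀ A ∈ children r F P, A ⊆ I ∨ Disjoint A I := by
    intro A hA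
    obtain ⟨hA1, hA2, hA3⟩ := mem_children.1 hA
    have hnest : Nested A I := by
      rcases mem_edges.1 hA1 with h | ⟨i, -, rfl⟩
      · exact hIF.nested A (Finset.mem_insert_of_mem h) I hIm
      · exact nested_singleton i I
    rcases hnest with h | h | h
    · exact Or.inr h
    · exact Or.inl h
    · exfalso
      have hss := Finset.ssubset_iff_subset_ne.2 ⟨h, hne A hA1⟩
      have hAF := mem_of_ssubset_edge hIp.nonempty hA1 hss
      exact hA2.2 (hmin A (mem_vertices.2 (Or.inr hAF)) hss)
  have hin : ∀ i ∈ I, ∃ A ∈ children r F P, i ∈ A ∧ A ⊆ I := by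
    intro i hi
    obtain ⟨A, hA, hiA⟩ := hF.exists_child hn hP (hIP.1 hi)
    exact ⟨A, hA, hiA, (hch A hA).resolve_right fun h => Finset.disjoint_left.1 h hiA hi⟩
  refine ⟨P, hP, hIP, hch, ?_⟩
  obtain ⟨i, hi⟩ := hIp.nonempty
  obtain ⟨A, hA, -, hAI⟩ := hin i hi
  obtain ⟨j, hj, hjA⟩ := Finset.exists_of_ssubset
    (Finset.ssubset_iff_subset_ne.2 ⟨hAI, (hne A (mem_children.1 hA).1).symm⟩)
  obtain ⟨B, hB, hjB, hBI⟩ := hin j hj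
  obtain ⟨k, hkP, hkI⟩ := Finset.exists_of_ssubset hIP
  obtain ⟨C, hC, hkC⟩ := hF.exists_child hn hP hkP
  exact ⟨A, hA, B, hB, C, hC, fun h => hjA (h ▸ hjB), hAI, hBI,
    (hch C hC).resolve_left fun h => hkI (h hkC)⟩

end IsLaminar

open Classical in
/-- The bounded edges that can be added to a tree. -/
noncomputable def resolutions (r : Fin n) (F : Finset (Finset (Fin n))) : Finset (Finset (Fin n)) :=
  Finset.univ.filter fun I => I ∉ F ∧ IsLaminar r (insert I F)

theorem mem_resolutions {I : Finset (Fin n)} :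
    I ∈ resolutions r F ↔ I ∉ F ∧ IsLaminar r (insert I F) := by
  simp [resolutions]

/-- A tree with one bounded edge less than a trivalent tree has exactly one 4-valent vertex, and
this vertex has exactly three resolutions. -/
theorem IsLaminar.exists_resolutions_eq (hF : IsLaminar r F) (hc : F.card + 4 = n) :
    ∃ A ∈ edges r F, ∃ B ∈ edges r F, ∃ C ∈ edges r F, A ∪ B ∪ C ∈ vertices r F ∧
      Disjoint A B ∧ Disjoint A C ∧ Disjoint B C ∧
      resolutions r F = {A ∪ B, A ∪ C, B ∪ C} := by
  have hn : 3 ≤ n := by omega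
  have hsum : ∑ P ∈ vertices r F, ((children r F P).card - 2) = 1 := by
    have h1 := hF.sum_card_children hn
    have h2 : ∑ P ∈ vertices r F, (((children r F P).card - 2) + 2) = F.card + (n - 1) := by
      rw [← h1]
      refine Finset.sum_congr rfl fun P hP => ?_
      have := hF.two_le_card_children hn hP
      omega
    rw [Finset.sum_add_distrib, Finset.sum_const, hF.card_vertices, smul_eq_mul] at h2
    omega
  obtain ⟨P, hP, h0⟩ := Finset.exists_ne_zero_of_sum_ne_zero (hsum.trans_ne one_ne_zero)
  have h1 := Finset.single_le_sum (f := fun P => (children r F P).card - 2)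
    (fun _ _ => Nat.zero_le _) hP
  have hcard : (children r F P).card = 3 := by omega
  have huniq : ∀ Q ∈ vertices r F, 2 < (children r F Q).card → Q = P := by
    intro Q hQ h2
    by_contra hne
    have h3 := Finset.sum_le_sum_of_subset (f := fun P => (children r F P).card - 2)
      (show {Q, P} ⊆ vertices r F by
        intro R hR
        rcases Finset.mem_insert.1 hR with rfl | hR
        · exact hQ
        · rwa [Finset.mem_singleton.1 hR])
    rw [Finset.sum_pair hne] at h3
    omega
  obtain ⟨A, B, C, hAB, hAC, hBC, hch⟩ := Finset.card_eq_three.1 hcard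
  have hA : A ∈ children r F P := by simp [hch]
  have hB : B ∈ children r F P := by simp [hch]
  have hC : C ∈ children r F P := by simp [hch]
  have dAB := hF.children_disjoint hA hB hAB
  have dAC := hF.children_disjoint hA hC hAC
  have dBC := hF.children_disjoint hB hC hBC
  have hPeq : A ∪ B ∪ C = P := by
    refine subset_antisymm (Finset.union_subset (Finset.union_subset (mem_children.1 hA).2.1.1
      (mem_children.1 hB).2.1.1) (mem_children.1 hC).2.1.1) fun i hi => ?_
    obtain ⟨D, hD, hiD⟩ := hF.exists_child hn hP hi
    rw [hch] at hD
    simp only [Finset.mem_insert, Finset.mem_singleton] at hD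
    rcases hD with rfl | rfl | rfl <;> simp [hiD]
  refine ⟨A, (mem_children.1 hA).1, B, (mem_children.1 hB).1, C, (mem_children.1 hC).1,
    hPeq ▸ hP, dAB, dAC, dBC, ?_⟩
  ext I
  rw [mem_resolutions]
  simp only [Finset.mem_insert, Finset.mem_singleton]
  constructor
  · rintro ⟨hI, hIF⟩
    obtain ⟨Q, hQ, hIQ, hch', A', hA', B', hB', C', hC', hne, hAI, hBI, hCI⟩ :=
      hF.exists_vertex_of_insert hn hI hIF
    have nonempty : ∀ {D}, D ∈ children r F Q → D.Nonempty := fun hD =>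
      hF.nonempty_edge (mem_children.1 hD).1
    have hdis : ∀ {D}, D ∈ children r F Q → D ⊆ I → ¬ Disjoint D I := fun hD h h' => by
      obtain ⟨i, hi⟩ := nonempty hD
      exact Finset.disjoint_left.1 h' hi (h hi)
    obtain rfl : Q = P := huniq Q hQ (Finset.two_lt_card_iff.2 ⟨A', B', C', hA', hB', hC', hne,
      fun h => hdis hA' hAI (h ▸ hCI), fun h => hdis hB' hBI (h ▸ hCI)⟩)
    -- `I` is the union of the children that it contains
    have hI' : ∀ i, i ∈ I → i ∈ A ∨ i ∈ B ∨ i ∈ C := by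
      intro i hi
      have := hIQ.1 hi
      rw [← hPeq] at this
      simpa [or_assoc] using this
    have hsubs : ¬ (A ⊆ I ∧ B ⊆ I ∧ C ⊆ I) := fun h =>
      hIQ.2 (hPeq ▸ Finset.union_subset (Finset.union_subset h.1 h.2.1) h.2.2)
    have hone : ∀ D, (∀ E, E = A ∨ E = B ∨ E = C → E ≠ D → ¬ E ⊆ I) → False := by
      intro D h
      rw [hch] at hA' hB'
      simp only [Finset.mem_insert, Finset.mem_singleton] at hA' hB'
      by_cases hD : A' = D
      · exact h B' hB' (fun h' => hne (hD.trans h'.symm)) hBI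
      · exact h A' hA' hD hAI
    have e : ∀ {D E G}, D ⊆ I → E ⊆ I → Disjoint G I → (∀ i, i ∈ I → i ∈ D ∨ i ∈ E ∨ i ∈ G) →
        I = D ∪ E := by
      intro D E G h1 h2 h3 h4
      refine subset_antisymm (fun i hi => ?_) (Finset.union_subset h1 h2)
      rcases h4 i hi with h | h | h
      · exact Finset.mem_union_left _ h
      · exact Finset.mem_union_right _ h
      · exact absurd hi (Finset.disjoint_left.1 h3 h)
    have cA := hch' A hA
    have cB := hch' B hB
    have cC := hch' C hC
    by_cases a : A ⊆ I <;> by_cases b : B ⊆ I <;> by_cases c : C ⊆ I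
    · exact absurd ⟨a, b, c⟩ hsubs
    · exact Or.inl (e a b (cC.resolve_left c) hI')
    · exact Or.inr (Or.inl (e a c (cB.resolve_left b) fun i hi => (hI' i hi).imp_right Or.symm))
    · exact (hone A (by rintro E (rfl | rfl | rfl) h <;> trivial)).elim
    · exact Or.inr (Or.inr (e b c (cA.resolve_left a) fun i hi => by
        rcases hI' i hi with h | h | h <;> simp only [h, true_or, or_true]))
    · exact (hone B (by rintro E (rfl | rfl | rfl) h <;> trivial)).elim
    · exact (hone C (by rintro E (rfl | rfl | rfl) h <;> trivial)).elim
    · exact (hone C (by rintro E (rfl | rfl | rfl) h <;> trivial)).elim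
  · rintro (rfl | rfl | rfl)
    · exact hF.insert_union_children hP hA hB hC hAB hAC hBC
    · exact hF.insert_union_children hP hA hC hB hAC hAB hBC.symm
    · exact hF.insert_union_children hP hB hC hA hBC hAB.symm hAC.symm

end Laminar
end TropM

/-! ### Connectivity of the set of trivalent trees -/

namespace TropM
section Connectivity

variable {n : ℕ} {r : Fin n} {F : Finset (Finset (Fin n))}

/-- The two trivalent trees `M` and `M'` differ by at most one bounded edge, different from `S`. -/
def Neighbours (r : Fin n) (S : Finset (Fin n)) (M M' : Finset (Finset (Fin n))) : Prop :=
  IsLaminar r M ∧ IsLaminar r M' ∧ M.card + 3 = n ∧ M'.card + 3 = n ∧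
    ∃ H, S ∈ H ∧ H.card + 4 = n ∧ H ⊆ M ∧ H ⊆ M'

/-- If `I` and `I'` cross each other, then each set nested with both of them is nested with any set
`Q` obtained as one of the four corners. -/
theorem Nested.corner {I I' J Q : Finset (Fin n)} (hJI : Nested J I) (hJI' : Nested J I')
    (h : ¬ Nested I I') (hQ : Q = I ∩ I' ∨ Q = I \ I' ∨ Q = I' \ I ∨ Q = I ∪ I') :
    Nested Q J := by
  simp only [Nested, not_or, Finset.not_disjoint_iff, Finset.not_subset] at h
  obtain ⟨⟨a, ha, ha'⟩, ⟨b, hb, hb'⟩, ⟨c, hc, hc'⟩⟩ := h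
  simp only [Nested, Finset.disjoint_left, Finset.subset_iff] at *
  rcases hQ with rfl | rfl | rfl | rfl <;>
    simp only [Finset.mem_inter, Finset.mem_sdiff, Finset.mem_union] <;>
    rcases hJI with h1 | h1 | h1 <;> rcases hJI' with h2 | h2 | h2 <;> grind

/-- If `J` is nested with all four corners of the crossing sets `I` and `I'`, and nested with `I`
but different from it, then `J` is nested with `I'`. -/
theorem Nested.of_corners {I I' J : Finset (Fin n)} (h0 : Nested J (I ∩ I'))
    (h1 : Nested J (I \ I')) (h2 : Nested J (I' \ I)) (h3 : Nested J (I ∪ I')) (hJI : Nested J I)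
    (hne : J ≠ I) (h : ¬ Nested I I') : Nested J I' := by
  simp only [Nested, not_or, Finset.not_disjoint_iff, Finset.not_subset] at h
  obtain ⟨⟨a, ha, ha'⟩, ⟨b, hb, hb'⟩, ⟨c, hc, hc'⟩⟩ := h
  rw [Ne, Finset.ext_iff] at hne
  simp only [Nested, Finset.disjoint_left, Finset.subset_iff, Finset.mem_inter, Finset.mem_sdiff,
    Finset.mem_union] at *
  by_cases hJa : a ∈ J <;> by_cases hJb : b ∈ J <;> by_cases hJc : c ∈ J <;> grind

/-- Trivalent trees containing the bounded edge `S` are connected by exchanges of single bounded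
edges different from `S`.

By induction it suffices to connect two bounded edges `I`, `I'` that can be added to a common tree
`K` by a chain of such edges, each compatible with the next. If `I` and `I'` are not compatible,
then one of the corners `I ∩ I'`, `I \ I'`, `I' \ I`, `I ∪ I'` is a new edge compatible with both,
or `I` and `I'` resolve the same 4-valent vertex of `K`, and any edge at another vertex will do. -/
theorem reflTransGen_neighbours (hn : 3 ≤ n) {S : Finset (Fin n)} {K M M' : Finset (Finset (Fin n))}
    (hS : S ∈ K) (hK : IsLaminar r K) (hM : IsLaminar r M) (hM' : IsLaminar r M')
    (hMc : M.card + 3 = n) (hMc' : M'.card + 3 = n) (hKM : K ⊆ M) (hKM' : K ⊆ M') :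
    Relation.ReflTransGen (Neighbours r S) M M' := by
  suffices key : ∀ d, ∀ K, S ∈ K → IsLaminar r K → K.card + 3 + d = n → ∀ M M', IsLaminar r M →
      IsLaminar r M' → M.card + 3 = n → M'.card + 3 = n → K ⊆ M → K ⊆ M' →
      Relation.ReflTransGen (Neighbours r S) M M' from by
    have := hK.card_le hn
    exact key (n - (K.card + 3)) K hS hK (by omega) M M' hM hM' hMc hMc' hKM hKM'
  clear hS hK hM hM' hMc hMc' hKM hKM' K M M'
  intro d
  induction d with
  | zero =>
    intro K _ _ hc M M' _ _ hMc hMc' hKM hKM'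
    rw [← Finset.eq_of_subset_of_card_le hKM (by omega),
      ← Finset.eq_of_subset_of_card_le hKM' (by omega)]
  | succ d ih =>
    intro K hS hK hc M M' hM hM' hMc hMc' hKM hKM'
    rcases Nat.eq_zero_or_pos d with rfl | hd
    · exact Relation.ReflTransGen.single ⟨hM, hM', hMc, hMc', K, hS, by omega, hKM, hKM'⟩
    -- `conn I I'`: all trivalent trees containing `I` are connected to all those containing `I'`
    let conn : Finset (Fin n) → Finset (Fin n) → Prop := fun I I' => ∀ M M', IsLaminar r M →
      IsLaminar r M' → M.card + 3 = n → M'.card + 3 = n → insert I K ⊆ M → insert I' K ⊆ M' →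
      Relation.ReflTransGen (Neighbours r S) M M'
    have hstep : ∀ I ∈ resolutions r K, ∀ M M', IsLaminar r M → IsLaminar r M' → M.card + 3 = n →
        M'.card + 3 = n → insert I K ⊆ M → insert I K ⊆ M' →
        Relation.ReflTransGen (Neighbours r S) M M' := by
      intro I hI
      obtain ⟨hIK, hIl⟩ := mem_resolutions.1 hI
      exact ih (insert I K) (Finset.mem_insert_of_mem hS) hIl
        (by rw [Finset.card_insert_of_notMem hIK]; omega)
    have htrans : ∀ I J I', J ∈ resolutions r K → conn I J → conn J I' → conn I I' := by
      intro I J I' hJ h1 h2 M M' hM hM' hMc hMc' hKM hKM'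
      obtain ⟨N, hN1, hN2, hN3⟩ := (mem_resolutions.1 hJ).2.exists_trivalent hn
      exact (h1 M N hM hN2 hMc hN3 hKM hN1).trans (h2 N M' hN2 hM' hN3 hMc' hN1 hKM')
    have hnest : ∀ I ∈ resolutions r K, ∀ I' ∈ resolutions r K, Nested I I' → conn I I' := by
      intro I hI I' hI' hII' M M' hM hM' hMc hMc' hKM hKM'
      obtain ⟨hIK, hIl⟩ := mem_resolutions.1 hI
      obtain ⟨hIK', hIl'⟩ := mem_resolutions.1 hI'
      have hl : IsLaminar r (insert I (insert I' K)) := by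
        refine hIl'.insert_of_nested (hIl.root I (Finset.mem_insert_self I K))
          (hIl.proper I (Finset.mem_insert_self I K)) fun J hJ => ?_
        rcases Finset.mem_insert.1 hJ with rfl | hJ
        · exact hII'
        · exact hIl.nested I (Finset.mem_insert_self I K) J (Finset.mem_insert_of_mem hJ)
      obtain ⟨N, hN1, hN2, hN3⟩ := hl.exists_trivalent hn
      exact (hstep I hI M N hM hN2 hMc hN3 hKM
        ((Finset.insert_subset_insert I (Finset.subset_insert I' K)).trans hN1)).trans
        (hstep I' hI' N M' hN2 hM' hN3 hMc' ((Finset.subset_insert _ _).trans hN1) hKM')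
    have hall : ∀ I ∈ resolutions r K, ∀ I' ∈ resolutions r K, conn I I' := by
      intro I hI I' hI'
      by_cases hII' : Nested I I'
      · exact hnest I hI I' hI' hII'
      obtain ⟨hIK, hIl⟩ := mem_resolutions.1 hI
      obtain ⟨hIK', hIl'⟩ := mem_resolutions.1 hI'
      have hIm := Finset.mem_insert_self I K
      have hIm' := Finset.mem_insert_self I' K
      have hcr := hII'
      simp only [Nested, not_or, Finset.not_disjoint_iff, Finset.not_subset] at hcr
      obtain ⟨⟨a, ha, ha'⟩, ⟨b, hb, hb'⟩, ⟨c, hc1, hc2⟩⟩ := hcr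
      by_cases hQ : ∃ Q, (Q = I ∩ I' ∨ Q = I \ I' ∨ Q = I' \ I ∨ Q = I ∪ I') ∧ Q ∉ K ∧ IsProper Q
      · obtain ⟨Q, hQ, hQK, hQp⟩ := hQ
        have hroot : r ∉ Q := by
          have h1 := hIl.root I hIm
          have h2 := hIl'.root I' hIm'
          rcases hQ with rfl | rfl | rfl | rfl <;> simp [h1, h2]
        have hQres : Q ∈ resolutions r K := mem_resolutions.2 ⟨hQK,
          hK.insert_of_nested hroot hQp fun J hJ => Nested.corner
            (hIl.nested J (Finset.mem_insert_of_mem hJ) I hIm)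
            (hIl'.nested J (Finset.mem_insert_of_mem hJ) I' hIm') hII' hQ⟩
        have h1 : Nested I Q := by
          rcases hQ with rfl | rfl | rfl | rfl
          · exact Or.inr (Or.inr Finset.inter_subset_left)
          · exact Or.inr (Or.inr Finset.sdiff_subset)
          · exact Or.inl Finset.disjoint_sdiff
          · exact Or.inr (Or.inl Finset.subset_union_left)
        have h2 : Nested Q I' := by
          rcases hQ with rfl | rfl | rfl | rfl
          · exact Or.inr (Or.inl Finset.inter_subset_right)
          · exact Or.inl Finset.sdiff_disjoint
          · exact Or.inr (Or.inl Finset.sdiff_subset)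
          · exact Or.inr (Or.inr Finset.subset_union_right)
        exact htrans I Q I' hQres (hnest I hI Q hQres h1) (hnest Q hQres I' hI' h2)
      · push Not at hQ
        obtain ⟨N, hN1, hN2, hN3⟩ := hIl.exists_trivalent hn
        obtain ⟨J, hJN, hJ⟩ : ∃ J ∈ N, J ∉ insert I K := by
          refine Finset.exists_mem_notMem_of_card_lt_card ?_
          rw [Finset.card_insert_of_notMem hIK]
          omega
        rw [Finset.mem_insert, not_or] at hJ
        have hrJ := hN2.root J hJN
        have hJres : J ∈ resolutions r K := mem_resolutions.2 ⟨hJ.2, hK.insert_of_nested hrJ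
          (hN2.proper J hJN) fun L hL => hN2.nested J hJN L (hN1 (Finset.mem_insert_of_mem hL))⟩
        have hJI : Nested J I := hN2.nested J hJN I (hN1 hIm)
        have hcorner : ∀ Q, (Q = I ∩ I' ∨ Q = I \ I' ∨ Q = I' \ I ∨ Q = I ∪ I') → Q.Nonempty →
            Nested J Q := by
          intro Q hQ' hne
          by_cases hQK : Q ∈ K
          · exact hN2.nested J hJN Q (hN1 (Finset.mem_insert_of_mem hQK))
          have hnp := hQ Q hQ' hQK
          rw [IsProper, not_and_or] at hnp
          have hroot : r ∉ Q := by
            have h1 := hIl.root I hIm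
            have h2 := hIl'.root I' hIm'
            rcases hQ' with rfl | rfl | rfl | rfl <;> simp [h1, h2]
          rcases hnp with h | h
          · obtain ⟨i, rfl⟩ := Finset.card_eq_one.1
              (show Q.card = 1 by have := hne.card_pos; omega)
            exact (nested_singleton i J).symm
          · have : Q = {r}ᶜ := Finset.eq_of_subset_of_card_le
              (subset_compl_singleton_of_notMem hroot) (by rw [card_compl_singleton]; omega)
            rw [this]
            exact Or.inr (Or.inl (subset_compl_singleton_of_notMem hrJ))
        have hJI' : Nested J I' := Nested.of_corners
          (hcorner _ (Or.inl rfl) ⟨a, Finset.mem_inter.2 ⟨ha, ha'⟩⟩)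
          (hcorner _ (Or.inr (Or.inl rfl)) ⟨b, Finset.mem_sdiff.2 ⟨hb, hb'⟩⟩)
          (hcorner _ (Or.inr (Or.inr (Or.inl rfl))) ⟨c, Finset.mem_sdiff.2 ⟨hc1, hc2⟩⟩)
          (hcorner _ (Or.inr (Or.inr (Or.inr rfl))) ⟨a, Finset.mem_union_left _ ha⟩)
          hJI hJ.1 hII'
        exact htrans I J I' hJres (hnest I hI J hJres hJI.symm) (hnest J hJres I' hI' hJI')
    have hex : ∀ M, IsLaminar r M → M.card + 3 = n → K ⊆ M →
        ∃ I ∈ resolutions r K, insert I K ⊆ M := by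
      intro M hM hMc hKM
      obtain ⟨I, hIM, hIK⟩ := Finset.exists_mem_notMem_of_card_lt_card
        (show K.card < M.card by omega)
      have := Finset.insert_subset hIM hKM
      exact ⟨I, mem_resolutions.2 ⟨hIK, hM.subset this⟩, this⟩
    obtain ⟨I, hI, hIM⟩ := hex M hM hMc hKM
    obtain ⟨I', hI', hIM'⟩ := hex M' hM' hMc' hKM'
    exact hall I hI I' hI' M M' hM hM' hMc hMc' hIM hIM'

end Connectivity
end TropM

/-! ### The cones of `M_{0,n}` -/

namespace TropM
section TypeCones

variable {n : ℕ} {r : Fin n} {F G : Finset (Finset (Fin n))}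

theorem mem_typeCone_iff {x : Ambient n} : x ∈ typeCone F ↔
    ∃ c : Finset (Fin n) → ℝ, (∀ I ∈ F, 0 ≤ c I) ∧ x = ∑ I ∈ F, c I • splitVec I := by
  constructor
  · intro hx
    obtain ⟨c, hc⟩ := (Submodule.mem_span_image_finset_iff_exists_fun' _).1 hx
    exact ⟨fun I => c I, fun I _ => (c I).2, hc.symm⟩
  · rintro ⟨c, hc, rfl⟩
    exact Submodule.sum_mem _ fun I hI => PointedCone.smul_mem _ (hc I hI)
      (PointedCone.subset_hull ⟨I, hI, rfl⟩)

theorem splitVec_mem_typeCone {I : Finset (Fin n)} (hI : I ∈ F) : splitVec I ∈ typeCone F :=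
  PointedCone.subset_hull ⟨I, hI, rfl⟩

theorem typeCone_mono (h : F ⊆ G) : typeCone F ≤ typeCone G :=
  Submodule.span_mono (Set.image_mono (by exact_mod_cast h))

theorem linSpan_typeCone (F : Finset (Finset (Fin n))) :
    linSpan (typeCone F) = Submodule.span ℝ (splitVec '' (F : Set (Finset (Fin n)))) := by
  refine le_antisymm (Submodule.span_le.2 fun x hx => ?_) (Submodule.span_mono
    PointedCone.subset_hull)
  exact PointedCone.hull_le_span ℝ _ hx

theorem mem_linSpan_typeCone_iff {x : Ambient n} : x ∈ linSpan (typeCone F) ↔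
    ∃ c : Finset (Fin n) → ℝ, x = ∑ I ∈ F, c I • splitVec I := by
  rw [linSpan_typeCone, Submodule.mem_span_image_finset_iff_exists_fun']
  simp only [eq_comm]

theorem splitVec_mem_linSpan {I : Finset (Fin n)} (hI : I ∈ F) :
    splitVec I ∈ linSpan (typeCone F) :=
  le_linSpan _ (splitVec_mem_typeCone hI)

namespace IsLaminar

theorem coeff_eq_zero (hF : IsLaminar r F) {c : Finset (Fin n) → ℝ}
    (h : ∑ I ∈ F, c I • splitVec I = 0) : ∀ I ∈ F, c I = 0 := by
  intro I hI
  obtain ⟨f, h1, h2, -⟩ := hF.exists_dual hI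
  have := congrArg f h
  rw [map_sum, map_zero, Finset.sum_eq_single_of_mem I hI] at this
  · simpa [h1] using this
  · intro J hJ hne
    rw [map_smul, h2 J hJ hne, smul_zero]

theorem coeff_unique (hF : IsLaminar r F) {c c' : Finset (Fin n) → ℝ}
    (h : ∑ I ∈ F, c I • splitVec I = ∑ I ∈ F, c' I • splitVec I) : ∀ I ∈ F, c I = c' I := by
  intro I hI
  refine sub_eq_zero.1 (hF.coeff_eq_zero (c := fun I => c I - c' I) ?_ I hI)
  simp only [sub_smul, Finset.sum_sub_distrib, h, sub_self]

theorem coneDim_typeCone (hF : IsLaminar r F) : coneDim (typeCone F) = F.card := by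
  have hli : LinearIndependent ℝ (fun I : F => splitVec I.1) := by
    rw [Fintype.linearIndependent_iff]
    intro g hg I
    have := hF.coeff_eq_zero (c := fun I => if h : I ∈ F then g ⟨I, h⟩ else 0) (by
      rw [← Finset.sum_coe_sort, ← hg]
      exact Finset.sum_congr rfl fun J _ => by simp) I.1 I.2
    simpa using this
  have h1 := finrank_span_eq_card hli
  have h2 : splitVec '' (F : Set (Finset (Fin n))) = Set.range fun I : F => splitVec I.1 := by
    ext x
    simp
  rw [coneDim, linSpan_typeCone, ← Fintype.card_coe, ← h1, h2]

theorem isRootedCurve (hF : IsLaminar r F) {c : Finset (Fin n) → ℝ} (hc : ∀ I ∈ F, 0 ≤ c I) :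
    IsRootedCurve r (∑ I ∈ F, c I • splitVec I) (fun I => if I ∈ F then c I else 0) := by
  refine ⟨fun I => ?_, ⟨F, hF, fun I hI => if_neg hI⟩, ?_⟩
  · split_ifs with h
    exacts [hc I h, le_rfl]
  · simp

/-- Cones of `M_{0,n}` intersect in the cone of their common degenerations. -/
theorem typeCone_inf (hF : IsLaminar r F) (hG : IsLaminar r G) :
    typeCone F ⊓ typeCone G = typeCone (F ∩ G) := by
  refine le_antisymm ?_ (le_inf (typeCone_mono Finset.inter_subset_left)
    (typeCone_mono Finset.inter_subset_right))
  rintro x ⟨hxF, hxG⟩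
  obtain ⟨c, hc, rfl⟩ := mem_typeCone_iff.1 hxF
  obtain ⟨d, hd, hcd⟩ := mem_typeCone_iff.1 hxG
  have h1 := hF.isRootedCurve hc
  have h2 := hG.isRootedCurve hd
  rw [← hcd] at h2
  have h3 := h1.unique h2
  refine mem_typeCone_iff.2 ⟨c, fun I hI => hc I (Finset.mem_inter.1 hI).1, ?_⟩
  refine (Finset.sum_subset Finset.inter_subset_left fun I hI hIG => ?_).symm
  have := congrFun h3 I
  have hIG' : I ∉ G := fun h => hIG (Finset.mem_inter.2 ⟨hI, h⟩)
  simp only [hI, hIG', if_true, if_false] at this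
  rw [this, zero_smul]

theorem subset_of_typeCone_le (hF : IsLaminar r F) (hG : IsLaminar r G)
    (h : typeCone F ≤ typeCone G) : F ⊆ G := by
  have h1 := hF.typeCone_inf hG
  rw [inf_eq_left.2 h] at h1
  have h2 := hF.coneDim_typeCone
  rw [h1, (hF.subset Finset.inter_subset_left).coneDim_typeCone] at h2
  exact Finset.inter_eq_left.1 (Finset.eq_of_subset_of_card_le Finset.inter_subset_left h2.ge)

theorem typeCone_injective (hF : IsLaminar r F) (hG : IsLaminar r G)
    (h : typeCone F = typeCone G) : F = G :=
  subset_antisymm (hF.subset_of_typeCone_le hG h.le) (hG.subset_of_typeCone_le hF h.ge)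

theorem isFaceOf_typeCone (hF : IsLaminar r F) (hGF : G ⊆ F) :
    (typeCone G).IsFaceOf (typeCone F) := by
  refine ⟨typeCone_mono hGF, fun {x y a} hx hy ha h => ?_⟩
  obtain ⟨c, hc, rfl⟩ := mem_typeCone_iff.1 hx
  obtain ⟨d, hd, rfl⟩ := mem_typeCone_iff.1 hy
  obtain ⟨e, he, heq⟩ := mem_typeCone_iff.1 h
  have h1 : ∑ I ∈ F, (a * c I + d I) • splitVec I =
      ∑ I ∈ F, (if I ∈ G then e I else 0) • splitVec I := by
    simp only [add_smul, mul_smul, Finset.sum_add_distrib, ← Finset.smul_sum, heq, ite_smul,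
      zero_smul]
    rw [← Finset.sum_filter, Finset.filter_mem_eq_inter, Finset.inter_eq_right.2 hGF]
  refine mem_typeCone_iff.2 ⟨c, fun I hI => hc I (hGF hI), ?_⟩
  refine (Finset.sum_subset hGF fun I hI hIG => ?_).symm
  have := hF.coeff_unique h1 I hI
  simp only [hIG, if_false] at this
  have h2 := hd I hI
  have h3 := hc I hI
  have : c I = 0 := by nlinarith
  rw [this, zero_smul]

end IsLaminar

theorem exists_eq_typeCone_of_isFaceOf {τ : PointedCone ℝ (Ambient n)}
    (h : τ.IsFaceOf (typeCone F)) : ∃ G ⊆ F, τ = typeCone G := by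
  classical
  refine ⟨F.filter fun I => splitVec I ∈ τ, Finset.filter_subset _ _, le_antisymm ?_ ?_⟩
  · intro x hx
    obtain ⟨c, hc, hcx⟩ := mem_typeCone_iff.1 (h.le hx)
    refine mem_typeCone_iff.2 ⟨c, fun I hI => hc I (Finset.mem_filter.1 hI).1, ?_⟩
    rw [hcx]
    refine (Finset.sum_subset (Finset.filter_subset _ _) fun I hI hIτ => ?_).symm
    rcases (hc I hI).eq_or_lt with h0 | h0
    · rw [← h0, zero_smul]
    refine absurd (Finset.mem_filter.2 ⟨hI, ?_⟩) hIτ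
    refine h.mem_of_smul_add_mem (splitVec_mem_typeCone hI)
      (y := ∑ J ∈ F.erase I, c J • splitVec J) (Submodule.sum_mem _ fun J hJ => ?_) h0 ?_
    · exact PointedCone.smul_mem _ (hc J (Finset.mem_of_mem_erase hJ))
        (splitVec_mem_typeCone (Finset.mem_of_mem_erase hJ))
    · rw [Finset.add_sum_erase F (fun J => c J • splitVec J) hI, ← hcx]
      exact hx
  · refine Submodule.span_le.2 ?_
    rintro _ ⟨I, hI, rfl⟩
    exact (Finset.mem_filter.1 hI).2

theorem IsProper.compl {I : Finset (Fin n)} (h : IsProper I) : IsProper Iᶜ := by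
  have := h.1
  have := h.2
  have := Finset.card_le_univ I
  rw [Fintype.card_fin] at this
  constructor <;> rw [Finset.card_compl, Fintype.card_fin] <;> omega

theorem Compatible.symm {I J : Finset (Fin n)} (h : Compatible I J) : Compatible J I := by
  rcases h with h | h | h | h
  · exact Or.inl (by rwa [Finset.inter_comm])
  · exact Or.inr (Or.inr (Or.inl h))
  · exact Or.inr (Or.inl h)
  · exact Or.inr (Or.inr (Or.inr (by rwa [Finset.union_comm])))

theorem Compatible.compl_left {I J : Finset (Fin n)} (h : Compatible I J) : Compatible Iᶜ J := by
  simp only [Compatible, Finset.ext_iff, Finset.subset_iff, Finset.mem_inter, Finset.mem_union,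
    Finset.mem_compl, Finset.notMem_empty, Finset.mem_univ, iff_false, iff_true] at *
  rcases h with h | h | h | h
  · exact Or.inr (Or.inr (Or.inl fun i hi hi' => h i ⟨hi', hi⟩))
  · exact Or.inr (Or.inr (Or.inr fun i => or_iff_not_imp_left.2 fun hi => h (not_not.1 hi)))
  · exact Or.inl fun i hi => hi.1 (h hi.2)
  · exact Or.inr (Or.inl fun i hi => (h i).resolve_left hi)

theorem Compatible.nested {I J : Finset (Fin n)} (h : Compatible I J) (hI : r ∉ I) (hJ : r ∉ J) :
    Nested I J := by
  rcases h with h | h | h | h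
  · exact Or.inl (Finset.disjoint_iff_inter_eq_empty.2 h)
  · exact Or.inr (Or.inl h)
  · exact Or.inr (Or.inr h)
  · have := Finset.mem_univ r
    rw [← h, Finset.mem_union] at this
    tauto

/-- The side of the split `I | Iᶜ` that does not contain `r`. -/
def farSide (r : Fin n) (I : Finset (Fin n)) : Finset (Fin n) := if r ∈ I then Iᶜ else I

theorem splitVec_farSide (I : Finset (Fin n)) : splitVec (farSide r I) = splitVec I := by
  rw [farSide]
  split_ifs
  exacts [splitVec_compl I, rfl]

theorem notMem_farSide (I : Finset (Fin n)) : r ∉ farSide r I := by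
  rw [farSide]
  split_ifs with h
  · simpa using h
  · exact h

theorem IsCombType.isLaminar (hF : IsCombType F) : IsLaminar r (F.image (farSide r)) := by
  refine ⟨?_, ?_, ?_⟩
  · intro I hI
    obtain ⟨J, -, rfl⟩ := Finset.mem_image.1 hI
    exact notMem_farSide J
  · intro I hI
    obtain ⟨J, hJ, rfl⟩ := Finset.mem_image.1 hI
    rw [farSide]
    split_ifs
    exacts [(hF.1 J hJ).compl, hF.1 J hJ]
  · intro I hI J hJ
    obtain ⟨I, hI', rfl⟩ := Finset.mem_image.1 hI
    obtain ⟨J, hJ', rfl⟩ := Finset.mem_image.1 hJ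
    refine Compatible.nested ?_ (notMem_farSide (r := r) I) (notMem_farSide J)
    have h := hF.2 I hI' J hJ'
    simp only [farSide]
    split_ifs
    exacts [h.compl_left.symm.compl_left.symm, h.compl_left, h.symm.compl_left.symm, h]

theorem IsLaminar.isCombType (hF : IsLaminar r F) : IsCombType F := by
  refine ⟨hF.proper, fun I hI J hJ => ?_⟩
  rcases hF.nested I hI J hJ with h | h | h
  · exact Or.inl (Finset.disjoint_iff_inter_eq_empty.1 h)
  · exact Or.inr (Or.inl h)
  · exact Or.inr (Or.inr (Or.inl h))

theorem typeCone_image_farSide : typeCone (F.image (farSide r)) = typeCone F := by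
  rw [typeCone, typeCone, Finset.coe_image, Set.image_image]
  simp only [splitVec_farSide]

theorem mem_M0_cones (r : Fin n) {σ : PointedCone ℝ (Ambient n)} :
    σ ∈ (M0 n).cones ↔ ∃ F, IsLaminar r F ∧ typeCone F = σ := by
  simp only [M0, Finset.mem_image, Finset.mem_filter, Finset.mem_univ, true_and]
  constructor
  · rintro ⟨F, hF, rfl⟩
    exact ⟨F.image (farSide r), hF.isLaminar, typeCone_image_farSide⟩
  · rintro ⟨F, hF, rfl⟩
    exact ⟨F, hF.isCombType, rfl⟩

theorem IsLaminar.mem_M0_cones (hF : IsLaminar r F) : typeCone F ∈ (M0 n).cones :=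
  (TropM.mem_M0_cones r).2 ⟨F, hF, rfl⟩

theorem IsCurve.isRootedCurve {x : Ambient n} {c : Finset (Fin n) → ℝ} (h : IsCurve x c) :
    IsRootedCurve r x (fun I => if r ∈ I then 0 else c I + c Iᶜ) := by
  obtain ⟨⟨F, hF, hc⟩, h0, rfl⟩ := h
  refine ⟨fun I => ?_, ⟨F.image (farSide r), hF.isLaminar, fun I hI => ?_⟩, ?_⟩
  · split_ifs
    exacts [le_rfl, add_nonneg (h0 _) (h0 _)]
  · split_ifs with hr
    · rfl
    rw [hc I, hc Iᶜ, add_zero]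
    · refine fun h => hI (Finset.mem_image.2 ⟨_, h, ?_⟩)
      rw [farSide, if_pos (by simpa using hr), compl_compl]
    · refine fun h => hI (Finset.mem_image.2 ⟨_, h, ?_⟩)
      rw [farSide, if_neg hr]
  · have h1 : ∑ I : Finset (Fin n), (if r ∈ I then 0 else c Iᶜ) • splitVec I =
        ∑ I : Finset (Fin n), (if r ∈ I then c I else 0) • splitVec I := by
      rw [← Equiv.sum_comp (Function.Involutive.toPerm _ compl_involutive)]
      refine Finset.sum_congr rfl fun I _ => ?_
      by_cases hr : r ∈ I <;> simp [hr, splitVec_compl]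
    have h2 : ∑ I : Finset (Fin n), (if r ∈ I then 0 else c I + c Iᶜ) • splitVec I =
        ∑ I : Finset (Fin n), (if r ∈ I then 0 else c I) • splitVec I +
          ∑ I : Finset (Fin n), (if r ∈ I then 0 else c Iᶜ) • splitVec I := by
      rw [← Finset.sum_add_distrib]
      refine Finset.sum_congr rfl fun I _ => ?_
      split_ifs <;> module
    rw [h2, h1, ← Finset.sum_add_distrib]
    refine Finset.sum_congr rfl fun I _ => ?_
    split_ifs <;> module

theorem IsLaminar.splitLength_eq (hF : IsLaminar r F) {S : Finset (Fin n)} (hS : r ∉ S)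
    {c : Finset (Fin n) → ℝ} (hc : ∀ I ∈ F, 0 ≤ c I) :
    splitLength S (∑ I ∈ F, c I • splitVec I) = if S ∈ F then c S else 0 := by
  have h0 := hF.isRootedCurve hc
  have hex : ∃ c', IsCurve (∑ I ∈ F, c I • splitVec I) c' :=
    ⟨_, ⟨F, hF.isCombType, fun I hI => if_neg hI⟩, h0.nonneg, h0.eq_sum⟩
  rw [splitLength, dif_pos hex]
  have h1 := congrFun (hex.choose_spec.isRootedCurve.unique h0) S
  simpa only [hS, if_false] using h1

end TypeCones
end TropM

/-! ### Weights of divisors in `M_{0,n}` -/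

namespace TropM
section DivisorWeight

variable {n : ℕ} {r : Fin n} {F G : Finset (Finset (Fin n))} {S : Finset (Fin n)}

open Classical in
/-- The adjacent cones of a cone in a subfan of `M_{0,n}` correspond to resolutions. -/
theorem IsLaminar.star_eq {X : WeightedFan (Ambient n)} (hX : X.cones ⊆ (M0 n).cones)
    (hF : IsLaminar r F) : X.star (typeCone F) = ((resolutions r F).filter fun I =>
      typeCone (insert I F) ∈ X.cones).image fun I => typeCone (insert I F) := by
  ext σ
  simp only [WeightedFan.mem_star, Finset.mem_image, Finset.mem_filter]
  constructor
  · rintro ⟨hσ, hd, hface⟩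
    obtain ⟨G, hG, rfl⟩ := (TropM.mem_M0_cones r).1 (hX hσ)
    have hFG := hF.subset_of_typeCone_le hG hface.le
    rw [hF.coneDim_typeCone, hG.coneDim_typeCone] at hd
    obtain ⟨I, hI, rfl⟩ := Finset.exists_eq_insert_iff.2 ⟨hFG, hd.symm⟩
    exact ⟨I, ⟨mem_resolutions.2 ⟨hI, hG⟩, hσ⟩, rfl⟩
  · rintro ⟨I, ⟨hI, hIX⟩, rfl⟩
    obtain ⟨hIF, hIl⟩ := mem_resolutions.1 hI
    refine ⟨hIX, ?_, hIl.isFaceOf_typeCone (Finset.subset_insert I F)⟩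
    rw [hF.coneDim_typeCone, hIl.coneDim_typeCone, Finset.card_insert_of_notMem hIF]

open Classical in
theorem IsLaminar.sum_star {X : WeightedFan (Ambient n)} (hX : X.cones ⊆ (M0 n).cones)
    (hF : IsLaminar r F) {A : Type*} [AddCommMonoid A] (g : PointedCone ℝ (Ambient n) → A) :
    ∑ σ ∈ X.star (typeCone F), g σ = ∑ I ∈ (resolutions r F).filter fun I =>
      typeCone (insert I F) ∈ X.cones, g (typeCone (insert I F)) := by
  rw [hF.star_eq hX, Finset.sum_image]
  intro I hI J hJ hIJ
  obtain ⟨hI1, hI2⟩ := mem_resolutions.1 (Finset.mem_filter.1 hI).1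
  obtain ⟨hJ1, hJ2⟩ := mem_resolutions.1 (Finset.mem_filter.1 hJ).1
  have := hI2.typeCone_injective hJ2 hIJ
  have h1 : I ∈ insert J F := this ▸ Finset.mem_insert_self I F
  exact (Finset.mem_insert.1 h1).resolve_right hI1

theorem IsLaminar.sum_star_M0 (hF : IsLaminar r F) {A : Type*} [AddCommMonoid A]
    (g : PointedCone ℝ (Ambient n) → A) :
    ∑ σ ∈ (M0 n).star (typeCone F), g σ = ∑ I ∈ resolutions r F, g (typeCone (insert I F)) := by
  rw [hF.sum_star subset_rfl, Finset.filter_true_of_mem]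
  exact fun I hI => (mem_resolutions.1 hI).2.mem_M0_cones

theorem IsLaminar.splitVec_mem_lattice (hF : IsLaminar r F) {I : Finset (Fin n)} (hI : I ∈ F) :
    splitVec I ∈ lattice n :=
  AddSubgroup.subset_closure ⟨I, hF.proper I hI, rfl⟩

theorem isPrimitiveNormal_splitVec {I : Finset (Fin n)} (hI : I ∈ resolutions r F) :
    IsPrimitiveNormal (lattice n) (typeCone F) (typeCone (insert I F)) (splitVec I) := by
  obtain ⟨hIF, hIl⟩ := mem_resolutions.1 hI
  have hIm := Finset.mem_insert_self I F
  refine ⟨hIl.splitVec_mem_lattice hIm, splitVec_mem_typeCone hIm, fun x hx hxs => ?_⟩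
  obtain ⟨f, h1, h2, h3⟩ := hIl.exists_dual hIm
  obtain ⟨m, hm⟩ := h3 x hx
  obtain ⟨c, rfl⟩ := mem_linSpan_typeCone_iff.1 hxs
  rw [Finset.sum_insert hIF] at hm ⊢
  have hz : f (∑ J ∈ F, c J • splitVec J) = 0 := by
    rw [map_sum]
    refine Finset.sum_eq_zero fun J hJ => ?_
    rw [map_smul, h2 J (Finset.mem_insert_of_mem hJ) fun h => hIF (h ▸ hJ), smul_zero]
  rw [map_add, hz, map_smul, h1, smul_eq_mul, mul_one, add_zero] at hm
  refine ⟨m, ?_⟩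
  rw [hm, Int.cast_smul_eq_zsmul, add_sub_cancel_left]
  exact mem_linSpan_typeCone_iff.2 ⟨c, rfl⟩

theorem IsPrimitiveNormal.sub_splitVec_mem {I : Finset (Fin n)} (hI : I ∈ resolutions r F)
    {u : Ambient n} (hu : IsPrimitiveNormal (lattice n) (typeCone F) (typeCone (insert I F)) u) :
    u - splitVec I ∈ linSpan (typeCone F) := by
  obtain ⟨hIF, hIl⟩ := mem_resolutions.1 hI
  have hIm := Finset.mem_insert_self I F
  obtain ⟨f, h1, h2, h3⟩ := hIl.exists_dual hIm
  have hz : ∀ x ∈ linSpan (typeCone F), f x = 0 := by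
    intro x hx
    obtain ⟨c, rfl⟩ := mem_linSpan_typeCone_iff.1 hx
    rw [map_sum]
    refine Finset.sum_eq_zero fun J hJ => ?_
    rw [map_smul, h2 J (Finset.mem_insert_of_mem hJ) fun h => hIF (h ▸ hJ), smul_zero]
  obtain ⟨m, hm⟩ := (isPrimitiveNormal_splitVec hI).2.2 u hu.1 (le_linSpan _ hu.2.1)
  obtain ⟨k, hk⟩ := hu.2.2 _ (hIl.splitVec_mem_lattice hIm) (splitVec_mem_linSpan hIm)
  have hfu : f u = m := by
    have := hz _ hm
    rw [map_sub, map_zsmul, h1, zsmul_eq_mul, mul_one, sub_eq_zero] at this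
    exact this
  have hmk : k * m = 1 := by
    have := hz _ hk
    rw [map_sub, map_zsmul, h1, zsmul_eq_mul, hfu, sub_eq_zero] at this
    exact_mod_cast this.symm
  have hm0 : 0 ≤ m := by
    obtain ⟨c, hc, hcu⟩ := mem_typeCone_iff.1 hu.2.1
    rw [Finset.sum_insert hIF] at hcu
    have := hz (∑ J ∈ F, c J • splitVec J) (mem_linSpan_typeCone_iff.2 ⟨c, rfl⟩)
    rw [hcu, map_add, this, map_smul, h1, smul_eq_mul, mul_one, add_zero] at hfu
    have h4 := hc I hIm
    rw [hfu] at h4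
    exact_mod_cast h4
  have : m = 1 := by
    rcases Int.isUnit_iff.1 (IsUnit.of_mul_eq_one k (by rwa [mul_comm])) with h | h
    · exact h
    · omega
  simpa [this] using hm

theorem isPrimitiveNormal_normalVec {I : Finset (Fin n)} (hI : I ∈ resolutions r F) :
    IsPrimitiveNormal (lattice n) (typeCone F) (typeCone (insert I F))
      (normalVec (lattice n) (typeCone F) (typeCone (insert I F))) := by
  have h : ∃ u, IsPrimitiveNormal (lattice n) (typeCone F) (typeCone (insert I F)) u :=
    ⟨_, isPrimitiveNormal_splitVec hI⟩
  rw [normalVec, dif_pos h]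
  exact h.choose_spec

theorem normalVec_sub_mem {I : Finset (Fin n)} (hI : I ∈ resolutions r F) :
    normalVec (lattice n) (typeCone F) (typeCone (insert I F)) - splitVec I ∈
      linSpan (typeCone F) :=
  (isPrimitiveNormal_normalVec hI).sub_splitVec_mem hI

theorem apply_eq_of_mem_linSpan {f g : Ambient n →ₗ[ℝ] ℝ}
    (h : ∀ J ∈ F, f (splitVec J) = g (splitVec J)) {x : Ambient n}
    (hx : x ∈ linSpan (typeCone F)) : f x = g x := by
  obtain ⟨c, rfl⟩ := mem_linSpan_typeCone_iff.1 hx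
  simp only [map_sum, map_smul]
  exact Finset.sum_congr rfl fun J hJ => by rw [h J hJ]

/-- The length of the edge `S` is the restriction of a linear form on each cone. -/
theorem IsLaminar.exists_length_form (hF : IsLaminar r F) (S : Finset (Fin n)) :
    ∃ f : Ambient n →ₗ[ℝ] ℝ, ∀ J ∈ F, f (splitVec J) = if J = S then 1 else 0 := by
  by_cases hS : S ∈ F
  · obtain ⟨f, h1, h2, -⟩ := hF.exists_dual hS
    refine ⟨f, fun J hJ => ?_⟩
    split_ifs with h
    exacts [h ▸ h1, h2 J hJ h]
  · exact ⟨0, fun J hJ => by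
      rw [if_neg (ne_of_mem_of_not_mem hJ hS), LinearMap.zero_apply]⟩

theorem IsLaminar.splitLength_eq_apply (hF : IsLaminar r F) (hS : r ∉ S)
    {f : Ambient n →ₗ[ℝ] ℝ} (hf : ∀ J ∈ F, f (splitVec J) = if J = S then 1 else 0)
    {x : Ambient n} (hx : x ∈ typeCone F) : splitLength S x = f x := by
  obtain ⟨c, hc, rfl⟩ := mem_typeCone_iff.1 hx
  rw [hF.splitLength_eq hS hc, map_sum]
  have : ∀ J ∈ F, f (c J • splitVec J) = if J = S then c J else 0 := by
    intro J hJ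
    rw [map_smul, hf J hJ, smul_eq_mul, mul_ite, mul_one, mul_zero]
  rw [Finset.sum_congr rfl this, Finset.sum_ite_eq']

/-- The weight of the cone of `F` in the divisor of the length of `S`, in terms of the resolutions
of `F` and of a linear form that agrees on the cone of `F` with the length of `S`. -/
theorem IsLaminar.divisorWeight_eq (hF : IsLaminar r F) (hS : r ∉ S)
    {f : Ambient n →ₗ[ℝ] ℝ} (hf : ∀ J ∈ F, f (splitVec J) = if J = S then 1 else 0)
    (hsum : ∑ I ∈ resolutions r F, splitVec I ∈ linSpan (typeCone F)) :
    (M0 n).divisorWeight (lattice n) (splitLength S) (typeCone F) =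
      (if S ∈ resolutions r F then 1 else 0) - f (∑ I ∈ resolutions r F, splitVec I) := by
  have hex : ∃ g : Ambient n →ₗ[ℝ] ℝ, ∀ x ∈ typeCone F, g x = splitLength S x :=
    ⟨f, fun x hx => (hF.splitLength_eq_apply hS hf hx).symm⟩
  have hext : ∀ x ∈ linSpan (typeCone F), linExt (splitLength S) (typeCone F) x = f x := by
    rw [linExt, dif_pos hex]
    refine fun x hx => apply_eq_of_mem_linSpan (fun J hJ => ?_) hx
    rw [hex.choose_spec _ (splitVec_mem_typeCone hJ),
      hF.splitLength_eq_apply hS hf (splitVec_mem_typeCone hJ)]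
  -- the length of `S` at a normal vector
  have hphi : ∀ I ∈ resolutions r F,
      splitLength S (normalVec (lattice n) (typeCone F) (typeCone (insert I F))) =
        (if I = S then 1 else 0) +
          f (normalVec (lattice n) (typeCone F) (typeCone (insert I F)) - splitVec I) := by
    intro I hI
    obtain ⟨hIF, hIl⟩ := mem_resolutions.1 hI
    obtain ⟨g, hg⟩ := hIl.exists_length_form S
    rw [hIl.splitLength_eq_apply hS hg (isPrimitiveNormal_normalVec hI).2.1,
      ← apply_eq_of_mem_linSpan (f := g) (fun J hJ => by
        rw [hf J hJ, hg J (Finset.mem_insert_of_mem hJ)]) (normalVec_sub_mem hI),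
      map_sub, hg I (Finset.mem_insert_self I F), add_sub_cancel]
  rw [WeightedFan.divisorWeight, hF.sum_star_M0, hF.sum_star_M0]
  simp only [M0, one_mul, one_smul]
  rw [Finset.sum_congr rfl hphi, Finset.sum_add_distrib, Finset.sum_ite_eq']
  have hn : ∑ I ∈ resolutions r F, normalVec (lattice n) (typeCone F) (typeCone (insert I F)) =
      ∑ I ∈ resolutions r F, splitVec I + ∑ I ∈ resolutions r F,
        (normalVec (lattice n) (typeCone F) (typeCone (insert I F)) - splitVec I) := by
    rw [← Finset.sum_add_distrib]
    exact Finset.sum_congr rfl fun I _ => by abel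
  have hmem : ∑ I ∈ resolutions r F, (normalVec (lattice n) (typeCone F)
      (typeCone (insert I F)) - splitVec I) ∈ linSpan (typeCone F) :=
    Submodule.sum_mem _ fun I hI => normalVec_sub_mem hI
  rw [hn, hext _ ((linSpan (typeCone F)).add_mem hsum hmem), map_add, map_sum f (fun I => _ - _)]
  ring

/-- The sum of the resolutions of a 4-valent vertex is the sum of its adjacent edges, where the
edges leading to the markings do not contribute. -/
theorem IsLaminar.exists_sum_resolutions (hF : IsLaminar r F) (hc : F.card + 4 = n) :
    ∃ b : Finset (Fin n) → ℤ, ∑ I ∈ resolutions r F, splitVec I = ∑ J ∈ F, b J • splitVec J := by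
  classical
  obtain ⟨A, hA, B, hB, C, hC, hP, dAB, dAC, dBC, hres⟩ := hF.exists_resolutions_eq hc
  have hedge : ∀ A ∈ edges r F, ∃ b : Finset (Fin n) → ℤ,
      splitVec A = ∑ J ∈ F, b J • splitVec J := by
    intro A hA
    rcases mem_edges.1 hA with h | ⟨i, -, rfl⟩
    · exact ⟨Pi.single A 1, by simp [Pi.single_apply, ite_smul, h]⟩
    · exact ⟨0, by simp [splitVec_singleton]⟩
  obtain ⟨a, ha⟩ := hedge A hA
  obtain ⟨b, hb⟩ := hedge B hB
  obtain ⟨c, hc'⟩ := hedge C hC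
  obtain ⟨p, hp⟩ : ∃ b : Finset (Fin n) → ℤ, splitVec (A ∪ B ∪ C) = ∑ J ∈ F, b J • splitVec J := by
    rcases mem_vertices.1 hP with h | h
    · exact ⟨0, by simp [h, splitVec_compl_singleton]⟩
    · exact hedge _ (mem_edges.2 (Or.inl h))
  refine ⟨fun J => a J + b J + c J + p J, ?_⟩
  have hne : A ∪ B ≠ A ∪ C ∧ A ∪ B ≠ B ∪ C ∧ A ∪ C ≠ B ∪ C := by
    obtain ⟨i, hi⟩ := hF.nonempty_edge hA
    obtain ⟨j, hj⟩ := hF.nonempty_edge hB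
    have hiB := Finset.disjoint_left.1 dAB hi
    have hiC := Finset.disjoint_left.1 dAC hi
    have hjA := Finset.disjoint_right.1 dAB hj
    have hjC := Finset.disjoint_left.1 dBC hj
    simp only [Ne, Finset.ext_iff, not_forall, Finset.mem_union]
    exact ⟨⟨j, by tauto⟩, ⟨i, by tauto⟩, ⟨i, by tauto⟩⟩
  rw [hres, Finset.sum_insert (by simp [hne.1, hne.2.1]), Finset.sum_pair hne.2.2, ← add_assoc,
    splitVec_union_add dAB dAC dBC, ha, hb, hc', hp]
  simp only [add_smul, Finset.sum_add_distrib]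

theorem IsLaminar.sum_resolutions_mem (hF : IsLaminar r F) (hc : F.card + 4 = n) :
    ∑ I ∈ resolutions r F, splitVec I ∈ linSpan (typeCone F) := by
  obtain ⟨b, hb⟩ := hF.exists_sum_resolutions hc
  rw [hb]
  exact Submodule.sum_mem _ fun J hJ => zsmul_mem (splitVec_mem_linSpan hJ) _

/-- The only relation, up to multiples, between the three resolutions of a 4-valent vertex. -/
theorem IsLaminar.eq_of_sum_resolutions_mem (hF : IsLaminar r F) (hc : F.card + 4 = n)
    (a : Finset (Fin n) → ℝ)
    (ha : ∑ I ∈ resolutions r F, a I • splitVec I ∈ linSpan (typeCone F)) :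
    ∃ c, ∀ I ∈ resolutions r F, a I = c := by
  classical
  obtain ⟨A, hA, B, hB, C, hC, hP, dAB, dAC, dBC, hres⟩ := hF.exists_resolutions_eq hc
  obtain ⟨i, hi⟩ := hF.nonempty_edge hA
  obtain ⟨j, hj⟩ := hF.nonempty_edge hB
  obtain ⟨k, hk⟩ := hF.nonempty_edge hC
  have hiB := Finset.disjoint_left.1 dAB hi
  have hiC := Finset.disjoint_left.1 dAC hi
  have hjA := Finset.disjoint_right.1 dAB hj
  have hjC := Finset.disjoint_left.1 dBC hj
  have hkA := Finset.disjoint_right.1 dAC hk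
  have hkB := Finset.disjoint_right.1 dBC hk
  have hir : i ≠ r := ne_of_mem_of_not_mem hi (hF.notMem_edge hA)
  have hjr : j ≠ r := ne_of_mem_of_not_mem hj (hF.notMem_edge hB)
  have hkr : k ≠ r := ne_of_mem_of_not_mem hk (hF.notMem_edge hC)
  have hij : i ≠ j := ne_of_mem_of_not_mem hi hjA
  have hik : i ≠ k := ne_of_mem_of_not_mem hi hkA
  have hjk : j ≠ k := ne_of_mem_of_not_mem hj hkB
  have hne : A ∪ B ≠ A ∪ C ∧ A ∪ B ≠ B ∪ C ∧ A ∪ C ≠ B ∪ C := by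
    simp only [Ne, Finset.ext_iff, not_forall, Finset.mem_union]
    exact ⟨⟨j, by tauto⟩, ⟨i, by tauto⟩, ⟨i, by tauto⟩⟩
  have hrAB : r ∉ A ∪ B := by simp [hF.notMem_edge hA, hF.notMem_edge hB]
  have hrAC : r ∉ A ∪ C := by simp [hF.notMem_edge hA, hF.notMem_edge hC]
  have hrBC : r ∉ B ∪ C := by simp [hF.notMem_edge hB, hF.notMem_edge hC]
  -- no edge of the tree separates two of the markings `i, j, k, r` from the other two
  have hsep : ∀ J ∈ F, ¬ (i ∈ J ∧ j ∈ J ∧ k ∉ J) ∧ ¬ (i ∈ J ∧ k ∈ J ∧ j ∉ J) ∧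
      ¬ (j ∈ J ∧ k ∈ J ∧ i ∉ J) := by
    intro J hJ
    have hnest : ∀ I ∈ resolutions r F, Nested I J := fun I hI => (mem_resolutions.1 hI).2.nested I
      (Finset.mem_insert_self I F) J (Finset.mem_insert_of_mem hJ)
    have nAB := hnest (A ∪ B) (by simp [hres])
    have nAC := hnest (A ∪ C) (by simp [hres])
    refine ⟨fun ⟨h1, h2, h3⟩ => ?_, fun ⟨h1, h2, h3⟩ => ?_, fun ⟨h1, h2, h3⟩ => ?_⟩
    · rcases nAC.subset_or_subset (Finset.mem_union_left C hi) h1 with h | h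
      · exact h3 (h (Finset.mem_union_right A hk))
      · exact (Finset.mem_union.1 (h h2)).elim hjA hjC
    · rcases nAB.subset_or_subset (Finset.mem_union_left B hi) h1 with h | h
      · exact h3 (h (Finset.mem_union_right A hj))
      · exact (Finset.mem_union.1 (h h2)).elim hkA hkB
    · rcases nAB.subset_or_subset (Finset.mem_union_right A hj) h1 with h | h
      · exact h3 (h (Finset.mem_union_left B hi))
      · exact (Finset.mem_union.1 (h h2)).elim hkA hkB
  rw [hres, Finset.sum_insert (by simp [hne.1, hne.2.1]), Finset.sum_pair hne.2.2] at ha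
  obtain ⟨f, hf⟩ := exists_quartet_form hij hik hjr hkr
  obtain ⟨g, hg⟩ := exists_quartet_form hjk hij.symm hkr hir
  have h1 := apply_eq_of_mem_linSpan (f := f) (g := 0) (fun J hJ => by
    rw [hf J (hF.root J hJ), if_neg (hsep J hJ).1, if_neg (hsep J hJ).2.1, sub_zero,
      LinearMap.zero_apply]) ha
  have h2 := apply_eq_of_mem_linSpan (f := g) (g := 0) (fun J hJ => by
    have h3 := (hsep J hJ).1
    rw [hg J (hF.root J hJ), if_neg (hsep J hJ).2.2, if_neg (by tauto), sub_zero,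
      LinearMap.zero_apply]) ha
  simp only [map_add, map_smul, hf _ hrAB, hf _ hrAC, hf _ hrBC, hg _ hrAB, hg _ hrAC, hg _ hrBC,
    LinearMap.zero_apply, Finset.mem_union, hi, hj, hk, hiB, hiC, hjA, hjC, hkA, hkB] at h1 h2
  norm_num at h1 h2
  refine ⟨a (A ∪ B), fun I hI => ?_⟩
  rw [hres] at hI
  simp only [Finset.mem_insert, Finset.mem_singleton] at hI
  rcases hI with rfl | rfl | rfl <;> linarith

end DivisorWeight
end TropM

/-! ### Irreducibility of vital divisors -/

namespace TropM
section VitalDivisor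

variable {n : ℕ} {r : Fin n} {F G H : Finset (Finset (Fin n))} {S : Finset (Fin n)}

/-- The weight of the cone of `F` in the vital divisor `D^S`. -/
noncomputable def vitalWeight (S : Finset (Fin n)) (F : Finset (Finset (Fin n))) : ℝ :=
  (M0 n).divisorWeight (lattice n) (splitLength S) (typeCone F)

theorem IsLaminar.vitalWeight_eq (hF : IsLaminar r F) (hc : F.card + 4 = n) (hS : r ∉ S)
    {f : Ambient n →ₗ[ℝ] ℝ} (hf : ∀ J ∈ F, f (splitVec J) = if J = S then 1 else 0) :
    vitalWeight S F =
      (if S ∈ resolutions r F then 1 else 0) - f (∑ I ∈ resolutions r F, splitVec I) :=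
  hF.divisorWeight_eq hS hf (hF.sum_resolutions_mem hc)

theorem IsLaminar.exists_int_vitalWeight (hF : IsLaminar r F) (hc : F.card + 4 = n) (hS : r ∉ S) :
    ∃ m : ℤ, vitalWeight S F = m := by
  obtain ⟨f, hf⟩ := hF.exists_length_form S
  obtain ⟨b, hb⟩ := hF.exists_sum_resolutions hc
  refine ⟨(if S ∈ resolutions r F then 1 else 0) - ∑ J ∈ F, b J * if J = S then 1 else 0, ?_⟩
  rw [hF.vitalWeight_eq hc hS hf, hb, map_sum]
  push_cast
  congr 1
  refine Finset.sum_congr rfl fun J hJ => ?_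
  rw [map_zsmul, hf J hJ, zsmul_eq_mul]

theorem IsLaminar.vitalWeight_of_notMem (hF : IsLaminar r F) (hc : F.card + 4 = n) (hS : r ∉ S)
    (hSF : S ∉ F) : vitalWeight S F = if S ∈ resolutions r F then 1 else 0 := by
  rw [hF.vitalWeight_eq hc hS (f := 0) fun J hJ => by
    rw [if_neg (ne_of_mem_of_not_mem hJ hSF), LinearMap.zero_apply], LinearMap.zero_apply, sub_zero]

theorem IsLaminar.vitalWeight_of_mem (hF : IsLaminar r F) (hc : F.card + 4 = n) (hSF : S ∈ F)
    {f : Ambient n →ₗ[ℝ] ℝ} (hf : ∀ J ∈ F, f (splitVec J) = if J = S then 1 else 0) :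
    vitalWeight S F = - f (∑ I ∈ resolutions r F, splitVec I) := by
  rw [hF.vitalWeight_eq hc (hF.root S hSF) hf, if_neg fun h => (mem_resolutions.1 h).1 hSF,
    zero_sub]

theorem mem_vitalDivisor_cones (r : Fin n) (hn : 3 < n) {σ : PointedCone ℝ (Ambient n)} :
    σ ∈ (vitalDivisor S).cones ↔ ∃ F, IsLaminar r F ∧ F.card + 4 = n ∧ vitalWeight S F ≠ 0 ∧
      ∃ G ⊆ F, σ = typeCone G := by
  simp only [vitalDivisor, WeightedFan.divisor, Finset.mem_filter]
  constructor
  · rintro ⟨-, ρ, hρ, hd, hw, hface⟩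
    obtain ⟨F, hF, rfl⟩ := (mem_M0_cones r).1 hρ
    rw [hF.coneDim_typeCone] at hd
    obtain ⟨G, hGF, rfl⟩ := exists_eq_typeCone_of_isFaceOf hface
    exact ⟨F, hF, by simp only [M0] at hd; omega, hw, G, hGF, rfl⟩
  · rintro ⟨F, hF, hc, hw, G, hGF, rfl⟩
    refine ⟨(hF.subset hGF).mem_M0_cones, typeCone F, hF.mem_M0_cones, ?_, hw,
      hF.isFaceOf_typeCone hGF⟩
    rw [hF.coneDim_typeCone]
    simp only [M0]
    omega

theorem vitalDivisor_cones_subset : (vitalDivisor S).cones ⊆ (M0 n).cones :=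
  fun σ hσ => by
    simp only [vitalDivisor, WeightedFan.divisor, Finset.mem_filter] at hσ
    exact hσ.1

theorem vitalDivisor_dim : (vitalDivisor S).dim = n - 4 := by
  simp only [vitalDivisor, WeightedFan.divisor, M0]
  omega

theorem vitalDivisor_weight : (vitalDivisor S).weight (typeCone F) = vitalWeight S F := rfl

theorem IsLaminar.mem_vitalDivisor_cones_iff (hF : IsLaminar r F) (hc : F.card + 4 = n) :
    typeCone F ∈ (vitalDivisor S).cones ↔ vitalWeight S F ≠ 0 := by
  rw [mem_vitalDivisor_cones r (by omega)]
  constructor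
  · rintro ⟨F', hF', hc', hw, G, hGF', h⟩
    obtain rfl := hF.typeCone_injective (hF'.subset hGF') h
    rwa [Finset.eq_of_subset_of_card_le hGF' (by omega)]
  · exact fun h => ⟨F, hF, hc, h, F, subset_rfl, rfl⟩

theorem resolutions_comm {I J : Finset (Fin n)} (hI : I ∈ resolutions r G)
    (hJ : J ∈ resolutions r (insert I G)) :
    J ∈ resolutions r G ∧ I ∈ resolutions r (insert J G) := by
  obtain ⟨hI1, hI2⟩ := mem_resolutions.1 hI
  obtain ⟨hJ1, hJ2⟩ := mem_resolutions.1 hJ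
  rw [Finset.mem_insert, not_or] at hJ1
  refine ⟨mem_resolutions.2 ⟨hJ1.2, hJ2.subset
    (Finset.insert_subset_insert J (Finset.subset_insert I G))⟩, mem_resolutions.2 ⟨?_, ?_⟩⟩
  · rw [Finset.mem_insert, not_or]
    exact ⟨fun h => hJ1.1 h.symm, hI1⟩
  · rw [Finset.insert_comm]
    exact hJ2

theorem sum_symm_smul {ι V : Type*} [AddCommGroup V] [Module ℝ V] {s : Finset ι} {t : ι → Finset ι}
    (h : ∀ i ∈ s, ∀ j ∈ t i, j ∈ s ∧ i ∈ t j) (ψ b : ι → ℝ) (v : ι → V) :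
    ∑ i ∈ s, (∑ j ∈ t i, ψ j - b i * ψ i) • v i =
      ∑ j ∈ s, ψ j • (∑ i ∈ t j, v i - b j • v j) := by
  have hswap : ∑ i ∈ s, ∑ j ∈ t i, ψ j • v i = ∑ j ∈ s, ∑ i ∈ t j, ψ j • v i :=
    Finset.sum_comm' fun i j =>
      ⟨fun hij => (h i hij.1 j hij.2).symm, fun hij => h j hij.2 i hij.1⟩
  simp only [sub_smul, Finset.sum_smul, smul_sub, Finset.smul_sum, Finset.sum_sub_distrib, hswap,
    smul_smul, mul_comm]

/-- The balancing condition for the vital divisor.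

Modulo the span of the cone of `G`, the balancing condition of `M_{0,n}` at `insert I G` reads
`∑ J, v_J = b I • v_I`, and after subtracting a linear form from the length of `S` to obtain a
function `ψ` vanishing on the cone of `G`, the weight of `insert I G` is
`∑ J, ψ J - b I * ψ I`. As compatibility is a symmetric relation, summing this against `v_I` gives
`∑ J, ψ J • (∑ I, v_I - b J • v_J)`, which vanishes by the balancing condition at `insert J G`. -/
theorem IsLaminar.sum_vitalWeight_mem (hG : IsLaminar r G) (hc : G.card + 5 = n) (hS : r ∉ S) :
    ∑ I ∈ resolutions r G, vitalWeight S (insert I G) • splitVec I ∈ linSpan (typeCone G) := by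
  obtain ⟨f, hf⟩ := hG.exists_length_form S
  have hcard : ∀ I ∈ resolutions r G, (insert I G).card + 4 = n := fun I hI => by
    rw [Finset.card_insert_of_notMem (mem_resolutions.1 hI).1]
    omega
  have hb : ∀ I ∈ resolutions r G, ∃ b : ℝ,
      ∑ J ∈ resolutions r (insert I G), splitVec J - b • splitVec I ∈ linSpan (typeCone G) := by
    intro I hI
    obtain ⟨hIG, hIl⟩ := mem_resolutions.1 hI
    obtain ⟨b, hb⟩ := hIl.exists_sum_resolutions (hcard I hI)
    refine ⟨b I, ?_⟩
    rw [hb, Finset.sum_insert hIG, Int.cast_smul_eq_zsmul, add_sub_cancel_left]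
    exact Submodule.sum_mem _ fun J hJ => zsmul_mem (splitVec_mem_linSpan hJ) _
  choose! b hb using hb
  let ψ : Finset (Fin n) → ℝ := fun J => (if J = S then 1 else 0) - f (splitVec J)
  have hw : ∀ I ∈ resolutions r G, vitalWeight S (insert I G) =
      ∑ J ∈ resolutions r (insert I G), ψ J - b I * ψ I := by
    intro I hI
    obtain ⟨hIG, hIl⟩ := mem_resolutions.1 hI
    obtain ⟨g, hg⟩ := hIl.exists_length_form S
    have hfg := apply_eq_of_mem_linSpan (f := g) (g := f) (fun J hJ => by
      rw [hf J hJ, hg J (Finset.mem_insert_of_mem hJ)]) (hb I hI)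
    rw [map_sub, map_sub, map_smul, map_smul, hg I (Finset.mem_insert_self I G), smul_eq_mul,
      smul_eq_mul] at hfg
    rw [hIl.vitalWeight_eq (hcard I hI) hS hg]
    simp only [ψ, Finset.sum_sub_distrib, Finset.sum_ite_eq', ← map_sum]
    linarith
  rw [Finset.sum_congr rfl fun I hI => by rw [hw I hI], sum_symm_smul fun I hI J hJ =>
    resolutions_comm hI hJ]
  exact Submodule.sum_mem _ fun J hJ => Submodule.smul_mem _ _ (hb J hJ)

open Classical in
theorem IsLaminar.sum_star_vitalDivisor (hG : IsLaminar r G) {A : Type*} [AddCommMonoid A]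
    (hc : G.card + 5 = n) (g : PointedCone ℝ (Ambient n) → A) :
    ∑ σ ∈ (vitalDivisor S).star (typeCone G), g σ = ∑ I ∈ (resolutions r G).filter fun I =>
      vitalWeight S (insert I G) ≠ 0, g (typeCone (insert I G)) := by
  rw [hG.sum_star vitalDivisor_cones_subset]
  refine Finset.sum_congr (Finset.filter_congr fun I hI => ?_) fun _ _ => rfl
  obtain ⟨hIG, hIl⟩ := mem_resolutions.1 hI
  refine hIl.mem_vitalDivisor_cones_iff ?_
  rw [Finset.card_insert_of_notMem hIG]
  omega

theorem IsLaminar.isRationalCone (hF : IsLaminar r F) :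
    IsRationalCone (lattice n) (typeCone F) := by
  classical
  refine ⟨F.image splitVec, fun x hx => ?_, ?_⟩
  · obtain ⟨I, hI, rfl⟩ := Finset.mem_image.1 hx
    exact hF.splitVec_mem_lattice hI
  · rw [Finset.coe_image, typeCone]

theorem isTropicalFan_vitalDivisor (hn : 3 < n) (hS : r ∉ S) :
    (vitalDivisor S).IsTropicalFan (lattice n) where
  rational := by
    intro σ hσ
    obtain ⟨F, hF, -, -, G, hGF, rfl⟩ := (mem_vitalDivisor_cones r hn).1 hσ
    exact (hF.subset hGF).isRationalCone
  face_mem := by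
    intro σ hσ τ hτ
    obtain ⟨F, hF, hc, hw, G, hGF, rfl⟩ := (mem_vitalDivisor_cones r hn).1 hσ
    obtain ⟨G', hG', rfl⟩ := exists_eq_typeCone_of_isFaceOf hτ
    exact (mem_vitalDivisor_cones r hn).2 ⟨F, hF, hc, hw, G', hG'.trans hGF, rfl⟩
  inter_face := by
    intro σ hσ σ' hσ'
    obtain ⟨F, hF, -, -, G, hGF, rfl⟩ := (mem_vitalDivisor_cones r hn).1 hσ
    obtain ⟨F', hF', -, -, G', hGF', rfl⟩ := (mem_vitalDivisor_cones r hn).1 hσ'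
    rw [(hF.subset hGF).typeCone_inf (hF'.subset hGF')]
    exact (hF.subset hGF).isFaceOf_typeCone Finset.inter_subset_left
  pure := by
    intro σ hσ
    obtain ⟨F, hF, hc, hw, G, hGF, rfl⟩ := (mem_vitalDivisor_cones r hn).1 hσ
    refine ⟨typeCone F, (hF.mem_vitalDivisor_cones_iff hc).2 hw, ?_, hF.isFaceOf_typeCone hGF⟩
    rw [hF.coneDim_typeCone, vitalDivisor_dim]
    omega
  weight_ne_zero := by
    intro σ hσ hd
    obtain ⟨F, hF, rfl⟩ := (mem_M0_cones r).1 (vitalDivisor_cones_subset hσ)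
    rw [hF.coneDim_typeCone, vitalDivisor_dim] at hd
    exact (hF.mem_vitalDivisor_cones_iff (by omega)).1 hσ
  weight_rat := by
    intro σ hσ hd
    obtain ⟨F, hF, rfl⟩ := (mem_M0_cones r).1 (vitalDivisor_cones_subset hσ)
    rw [hF.coneDim_typeCone, vitalDivisor_dim] at hd
    obtain ⟨m, hm⟩ := hF.exists_int_vitalWeight (by omega) hS
    exact ⟨m, by rw [vitalDivisor_weight, hm]; norm_cast⟩
  balanced := by
    classical
    intro τ hτ hd
    obtain ⟨G, hG, rfl⟩ := (mem_M0_cones r).1 (vitalDivisor_cones_subset hτ)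
    rw [hG.coneDim_typeCone, vitalDivisor_dim] at hd
    refine ⟨normalVec (lattice n) (typeCone G), fun σ hσ => ?_, ?_⟩
    · rw [hG.star_eq vitalDivisor_cones_subset] at hσ
      obtain ⟨I, hI, rfl⟩ := Finset.mem_image.1 hσ
      exact isPrimitiveNormal_normalVec (Finset.mem_filter.1 hI).1
    · rw [hG.sum_star_vitalDivisor (by omega)]
      have h1 := hG.sum_vitalWeight_mem (by omega) hS
      rw [← Finset.sum_filter_of_ne (p := fun I => vitalWeight S (insert I G) ≠ 0)
        fun I _ h => left_ne_zero_of_smul h] at h1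
      have h2 : ∑ I ∈ (resolutions r G).filter fun I => vitalWeight S (insert I G) ≠ 0,
          vitalWeight S (insert I G) • (normalVec (lattice n) (typeCone G)
            (typeCone (insert I G)) - splitVec I) ∈ linSpan (typeCone G) :=
        Submodule.sum_mem _ fun I hI => Submodule.smul_mem _ _
          (normalVec_sub_mem (Finset.mem_filter.1 hI).1)
      have h3 := (linSpan (typeCone G)).add_mem h2 h1
      rw [← Finset.sum_add_distrib] at h3
      convert h3 using 1
      refine Finset.sum_congr rfl fun I _ => ?_
      rw [vitalDivisor_weight, smul_sub, sub_add_cancel]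

theorem erase_resolution (hH : IsLaminar r H) (hSH : S ∈ H) {I : Finset (Fin n)}
    (hI : I ∈ resolutions r H) :
    I ∈ resolutions r (H.erase S) ∧ S ∉ insert I (H.erase S) ∧
      S ∈ resolutions r (insert I (H.erase S)) := by
  have hS : S ∈ resolutions r (H.erase S) := mem_resolutions.2
    ⟨Finset.notMem_erase S H, by rwa [Finset.insert_erase hSH]⟩
  have h := resolutions_comm hS (J := I) (by rwa [Finset.insert_erase hSH])
  exact ⟨h.1, (mem_resolutions.1 h.2).1, h.2⟩

theorem vitalWeight_insert_erase (hH : IsLaminar r H) (hc : H.card + 4 = n) (hSH : S ∈ H)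
    {I : Finset (Fin n)} (hI : I ∈ resolutions r H) :
    vitalWeight S (insert I (H.erase S)) = 1 := by
  obtain ⟨h1, h2, h3⟩ := erase_resolution hH hSH hI
  obtain ⟨h4, h5⟩ := mem_resolutions.1 h1
  rw [h5.vitalWeight_of_notMem ?_ (hH.root S hSH) h2, if_pos h3]
  rw [Finset.card_insert_of_notMem h4, Finset.card_erase_of_mem hSH]
  have := Finset.card_pos.2 ⟨S, hSH⟩
  omega

theorem filter_resolutions_erase [DecidablePred fun I => vitalWeight S (insert I (H.erase S)) ≠ 0]
    (hH : IsLaminar r H) (hc : H.card + 4 = n) (hSH : S ∈ H) :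
    ((resolutions r (H.erase S)).filter fun I => vitalWeight S (insert I (H.erase S)) ≠ 0).erase S =
      resolutions r H := by
  ext I
  simp only [Finset.mem_erase, Finset.mem_filter]
  constructor
  · rintro ⟨hIS, hI, hw⟩
    obtain ⟨h4, h5⟩ := mem_resolutions.1 hI
    have h2 : S ∉ insert I (H.erase S) := by
      rw [Finset.mem_insert, not_or]
      exact ⟨Ne.symm hIS, Finset.notMem_erase S H⟩
    rw [h5.vitalWeight_of_notMem ?_ (hH.root S hSH) h2] at hw
    · have h6 := (resolutions_comm hI (by by_contra h; exact hw (if_neg h))).2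
      rwa [Finset.insert_erase hSH] at h6
    · rw [Finset.card_insert_of_notMem h4, Finset.card_erase_of_mem hSH]
      have := Finset.card_pos.2 ⟨S, hSH⟩
      omega
  · intro hI
    refine ⟨fun h => (mem_resolutions.1 hI).1 (h ▸ hSH), (erase_resolution hH hSH hI).1, ?_⟩
    rw [vitalWeight_insert_erase hH hc hSH hI]
    exact one_ne_zero

theorem card_resolutions (hH : IsLaminar r H) (hc : H.card + 4 = n) :
    (resolutions r H).card = 3 := by
  obtain ⟨A, hA, B, hB, C, hC, -, dAB, dAC, dBC, hres⟩ := hH.exists_resolutions_eq hc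
  obtain ⟨i, hi⟩ := hH.nonempty_edge hA
  obtain ⟨j, hj⟩ := hH.nonempty_edge hB
  have hiB := Finset.disjoint_left.1 dAB hi
  have hiC := Finset.disjoint_left.1 dAC hi
  have hjA := Finset.disjoint_right.1 dAB hj
  have hjC := Finset.disjoint_left.1 dBC hj
  rw [hres]
  refine Finset.card_eq_three.2 ⟨_, _, _, ?_, ?_, ?_, rfl⟩ <;>
    simp only [Ne, Finset.ext_iff, not_forall, Finset.mem_union]
  exacts [⟨j, by tauto⟩, ⟨i, by tauto⟩, ⟨i, by tauto⟩]

theorem mem_star_vitalDivisor (hG : IsLaminar r G) (hc : G.card + 5 = n) {I : Finset (Fin n)}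
    (hI : I ∈ resolutions r G) (hw : vitalWeight S (insert I G) ≠ 0) :
    typeCone (insert I G) ∈ (vitalDivisor S).star (typeCone G) := by
  obtain ⟨h1, h2⟩ := mem_resolutions.1 hI
  refine WeightedFan.mem_star.2 ⟨(h2.mem_vitalDivisor_cones_iff ?_).2 hw, ?_,
    h2.isFaceOf_typeCone (Finset.subset_insert I G)⟩
  · rw [Finset.card_insert_of_notMem h1]
    omega
  · rw [h2.coneDim_typeCone, hG.coneDim_typeCone, Finset.card_insert_of_notMem h1]

/-- If `H` is a tree with exactly one 4-valent vertex and `S` is one of its edges, then the wall of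
the vital divisor obtained by contracting `S` is rigid: its adjacent cones come from the three
resolutions of `H`, which satisfy a single relation modulo the span of `H`, and possibly from `H`
itself, in which case this relation determines the coefficient of `v_S`. -/
theorem isRigidWall_vitalDivisor (hH : IsLaminar r H) (hc : H.card + 4 = n) (hSH : S ∈ H) :
    (vitalDivisor S).IsRigidWall (typeCone (H.erase S)) := by
  classical
  have hpos := Finset.card_pos.2 ⟨S, hSH⟩
  have hcG : (H.erase S).card + 5 = n := by
    rw [Finset.card_erase_of_mem hSH]
    omega
  have hG : IsLaminar r (H.erase S) := hH.subset (Finset.erase_subset S H)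
  have hstar : ∀ I ∈ resolutions r H,
      typeCone (insert I (H.erase S)) ∈ (vitalDivisor S).star (typeCone (H.erase S)) := fun I hI =>
    mem_star_vitalDivisor hG hcG (erase_resolution hH hSH hI).1 (by
      rw [vitalWeight_insert_erase hH hc hSH hI]; exact one_ne_zero)
  have hcard3 := card_resolutions hH hc
  refine ⟨?_, ?_, ?_, normalVec (lattice n) (typeCone (H.erase S)), ?_, ?_⟩
  · obtain ⟨I, hI⟩ := Finset.card_pos.1 (show 0 < (resolutions r H).card by omega)
    have h1 := WeightedFan.mem_star.1 (hstar I hI)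
    exact (isTropicalFan_vitalDivisor (by omega) (hH.root S hSH)).face_mem _ h1.1 _ h1.2.2
  · rw [hG.coneDim_typeCone, vitalDivisor_dim]
    omega
  · have := hG.sum_star_vitalDivisor (S := S) hcG (fun _ => 1)
    rw [Finset.sum_const, Finset.sum_const, smul_eq_mul, mul_one, smul_eq_mul, mul_one] at this
    rw [this]
    have h2 := Finset.card_le_card (Finset.erase_subset S ((resolutions r (H.erase S)).filter
      fun I => vitalWeight S (insert I (H.erase S)) ≠ 0))
    rw [filter_resolutions_erase hH hc hSH] at h2
    omega
  · intro σ hσ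
    rw [hG.star_eq vitalDivisor_cones_subset] at hσ
    obtain ⟨I, hI, rfl⟩ := Finset.mem_image.1 hσ
    exact (isPrimitiveNormal_normalVec (Finset.mem_filter.1 hI).1).2.1
  · intro a ha
    rw [hG.sum_star_vitalDivisor hcG] at ha
    set T := (resolutions r (H.erase S)).filter
      fun I => vitalWeight S (insert I (H.erase S)) ≠ 0 with hT
    have hTS : T.erase S = resolutions r H := filter_resolutions_erase hH hc hSH
    let a' : Finset (Fin n) → ℝ := fun I => a (typeCone (insert I (H.erase S)))
    have ha' : ∑ I ∈ T, a' I • splitVec I ∈ linSpan (typeCone (H.erase S)) := by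
      have h2 : ∑ I ∈ T, a' I • (normalVec (lattice n) (typeCone (H.erase S))
            (typeCone (insert I (H.erase S))) - splitVec I) ∈ linSpan (typeCone (H.erase S)) :=
        Submodule.sum_mem _ fun I hI => Submodule.smul_mem _ _
          (normalVec_sub_mem (Finset.mem_filter.1 hI).1)
      have h3 := (linSpan (typeCone (H.erase S))).sub_mem ha h2
      rw [← Finset.sum_sub_distrib] at h3
      convert h3 using 1
      refine Finset.sum_congr rfl fun I _ => ?_
      rw [smul_sub, sub_sub_cancel]
    have hle : linSpan (typeCone (H.erase S)) ≤ linSpan (typeCone H) :=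
      linSpan_mono (typeCone_mono (Finset.erase_subset S H))
    obtain ⟨c, hcI⟩ := hH.eq_of_sum_resolutions_mem hc a' (by
      have h1 := hle ha'
      by_cases hST : S ∈ T
      · rw [← Finset.add_sum_erase T _ hST, hTS] at h1
        exact ((linSpan (typeCone H)).add_mem_iff_right
          ((linSpan (typeCone H)).smul_mem _ (splitVec_mem_linSpan hSH))).1 h1
      · rwa [← hTS, Finset.erase_eq_of_notMem hST])
    have haS : S ∈ T → a' S = c * vitalWeight S H := by
      intro hST
      obtain ⟨f, hf⟩ := hH.exists_length_form S
      have h1 := apply_eq_of_mem_linSpan (f := f) (g := 0) (fun J hJ => by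
        rw [hf J (Finset.mem_of_mem_erase hJ), if_neg (Finset.ne_of_mem_erase hJ),
          LinearMap.zero_apply]) ha'
      have h2 := hH.vitalWeight_of_mem hc hSH hf
      rw [← Finset.add_sum_erase T _ hST, hTS, Finset.sum_congr rfl fun I hI => by rw [hcI I hI],
        ← Finset.smul_sum, map_add, map_smul, map_smul, hf S hSH, if_pos rfl, smul_eq_mul,
        smul_eq_mul, mul_one, LinearMap.zero_apply] at h1
      rw [h2]
      linarith
    have hall : ∀ σ ∈ (vitalDivisor S).star (typeCone (H.erase S)),
        ∃ e : ℝ, e ≠ 0 ∧ a σ = c * e := by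
      intro σ hσ
      rw [hG.star_eq vitalDivisor_cones_subset] at hσ
      obtain ⟨I, hI, rfl⟩ := Finset.mem_image.1 hσ
      obtain ⟨hI, hID⟩ := Finset.mem_filter.1 hI
      obtain ⟨h4, h5⟩ := mem_resolutions.1 hI
      have hw : vitalWeight S (insert I (H.erase S)) ≠ 0 := by
        refine (h5.mem_vitalDivisor_cones_iff ?_).1 hID
        rw [Finset.card_insert_of_notMem h4]
        omega
      have hIT : I ∈ T := Finset.mem_filter.2 ⟨hI, hw⟩
      by_cases hIS : I = S
      · subst hIS
        rw [Finset.insert_erase hSH] at hw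
        exact ⟨_, hw, haS hIT⟩
      · have : I ∈ resolutions r H := hTS ▸ Finset.mem_erase.2 ⟨hIS, hIT⟩
        exact ⟨1, one_ne_zero, by rw [mul_one]; exact hcI I this⟩
    by_cases h0 : c = 0
    · left
      intro σ hσ
      obtain ⟨e, -, he⟩ := hall σ hσ
      rw [he, h0, zero_mul]
    · right
      intro σ hσ
      obtain ⟨e, he0, he⟩ := hall σ hσ
      rw [he]
      exact mul_ne_zero h0 he0

theorem mem_star_typeCone_erase {M : Finset (Finset (Fin n))} (hM : IsLaminar r M)
    (hcM : M.card + 3 = n) (hc : H.card + 4 = n) (hHM : H ⊆ M) (hSH : S ∈ H) :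
    typeCone (M.erase S) ∈ (vitalDivisor S).star (typeCone (H.erase S)) := by
  have hH := hM.subset hHM
  have hpos := Finset.card_pos.2 ⟨S, hSH⟩
  obtain ⟨I, hI, rfl⟩ := Finset.exists_eq_insert_iff.2 ⟨hHM, by omega⟩
  have hIS : S ≠ I := fun h => hI (h ▸ hSH)
  have hIr : I ∈ resolutions r H := mem_resolutions.2 ⟨hI, hM⟩
  rw [Finset.erase_insert_of_ne hIS.symm]
  refine mem_star_vitalDivisor (hH.subset (Finset.erase_subset S H)) ?_
    (erase_resolution hH hSH hIr).1 ?_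
  · rw [Finset.card_erase_of_mem hSH]
    omega
  · rw [vitalWeight_insert_erase hH hc hSH hIr]
    exact one_ne_zero

theorem isLaminar_singleton (hr : r ∉ S) (hS : IsProper S) : IsLaminar r {S} where
  root I hI := by rwa [Finset.mem_singleton.1 hI]
  proper I hI := by rwa [Finset.mem_singleton.1 hI]
  nested I hI J hJ := by
    rw [Finset.mem_singleton.1 hI, Finset.mem_singleton.1 hJ]
    exact Or.inr (Or.inl subset_rfl)

/-- Vital divisors are connected in codimension one through rigid walls. The cones of weight `1` are
obtained from the trivalent trees containing `S` by contracting `S`, hence they are connected like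
these trees. Each of the other cones contains `v_S`, and is adjacent to cones of weight `1` at the
wall opposite to `v_S`. -/
theorem reflTransGen_rigidlyAdjacent (hn : 3 < n) (hr : r ∉ S) (hS : IsProper S)
    {σ σ' : PointedCone ℝ (Ambient n)} (hσ : σ ∈ (vitalDivisor S).cones)
    (hd : coneDim σ = (vitalDivisor S).dim) (hσ' : σ' ∈ (vitalDivisor S).cones)
    (hd' : coneDim σ' = (vitalDivisor S).dim) :
    Relation.ReflTransGen (vitalDivisor S).RigidlyAdjacent σ σ' := by
  have hsymm : ∀ {σ σ'}, Relation.ReflTransGen (vitalDivisor S).RigidlyAdjacent σ σ' →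
      Relation.ReflTransGen (vitalDivisor S).RigidlyAdjacent σ' σ := by
    intro σ σ' h
    induction h with
    | refl => exact .refl
    | tail _ h ih => exact .head h.symm ih
  have hfacet : ∀ σ ∈ (vitalDivisor S).cones, coneDim σ = (vitalDivisor S).dim →
      ∃ M, S ∈ M ∧ IsLaminar r M ∧ M.card + 3 = n ∧
        Relation.ReflTransGen (vitalDivisor S).RigidlyAdjacent σ (typeCone (M.erase S)) := by
    intro σ hσ hd
    obtain ⟨F, hF, rfl⟩ := (mem_M0_cones r).1 (vitalDivisor_cones_subset hσ)
    rw [hF.coneDim_typeCone, vitalDivisor_dim] at hd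
    have hc : F.card + 4 = n := by omega
    have hw := (hF.mem_vitalDivisor_cones_iff hc).1 hσ
    by_cases hSF : S ∈ F
    · obtain ⟨I, hI⟩ := Finset.card_pos.1
        (show 0 < (resolutions r F).card by rw [card_resolutions hF hc]; omega)
      obtain ⟨hIF, hIl⟩ := mem_resolutions.1 hI
      have hcI : (insert I F).card + 3 = n := by
        rw [Finset.card_insert_of_notMem hIF]
        omega
      refine ⟨insert I F, Finset.mem_insert_of_mem hSF, hIl, hcI, Relation.ReflTransGen.single
        ⟨typeCone (F.erase S), isRigidWall_vitalDivisor hF hc hSF, ?_,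
          mem_star_typeCone_erase hIl hcI hc (Finset.subset_insert I F) hSF⟩⟩
      have hG : IsLaminar r (F.erase S) := hF.subset (Finset.erase_subset S F)
      have := mem_star_vitalDivisor (S := S) (I := S) hG (by
        have := Finset.card_pos.2 ⟨S, hSF⟩
        rw [Finset.card_erase_of_mem hSF]
        omega) (mem_resolutions.2 ⟨Finset.notMem_erase S F, by rwa [Finset.insert_erase hSF]⟩)
        (by rwa [Finset.insert_erase hSF])
      rwa [Finset.insert_erase hSF] at this
    · rw [hF.vitalWeight_of_notMem hc hr hSF] at hw
      have hSr : S ∈ resolutions r F := by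
        by_contra h
        exact hw (if_neg h)
      refine ⟨insert S F, Finset.mem_insert_self S F, (mem_resolutions.1 hSr).2, ?_, ?_⟩
      · rw [Finset.card_insert_of_notMem hSF]
        omega
      · rw [Finset.erase_insert hSF]
  have hlift : ∀ M M', Relation.ReflTransGen (Neighbours r S) M M' →
      Relation.ReflTransGen (vitalDivisor S).RigidlyAdjacent (typeCone (M.erase S))
        (typeCone (M'.erase S)) := by
    intro M M' h
    induction h with
    | refl => exact .refl
    | tail _ h ih =>
      obtain ⟨hM, hM', hMc, hMc', H, hSH, hc, hHM, hHM'⟩ := h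
      exact ih.tail ⟨typeCone (H.erase S), isRigidWall_vitalDivisor (hM.subset hHM) hc hSH,
      mem_star_typeCone_erase hM hMc hc hHM hSH, mem_star_typeCone_erase hM' hMc' hc hHM' hSH⟩
  obtain ⟨M, hSM, hM, hMc, h1⟩ := hfacet σ hσ hd
  obtain ⟨M', hSM', hM', hMc', h2⟩ := hfacet σ' hσ' hd'
  exact (h1.trans (hlift M M' (reflTransGen_neighbours (by omega) (Finset.mem_singleton_self S)
    (isLaminar_singleton hr hS) hM hM' hMc hMc' (by simpa using hSM)
    (by simpa using hSM')))).trans (hsymm h2)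

theorem isIrreducible_vitalDivisor (hn : 3 < n) (hS : IsProper S) :
    (vitalDivisor S).IsIrreducible (lattice n) := by
  obtain ⟨r, hr⟩ : ∃ r, r ∉ S := by
    by_contra hcon
    push Not at hcon
    have h1 := hS.2
    rw [Finset.eq_univ_iff_forall.2 hcon, Finset.card_fin] at h1
    omega
  refine (isTropicalFan_vitalDivisor hn hr).isIrreducible ?_ fun σ hσ hd σ' hσ' hd' =>
    reflTransGen_rigidlyAdjacent hn hr hS hσ hd hσ' hd'
  obtain ⟨M, hSM, hM, hMc⟩ := (isLaminar_singleton hr hS).exists_trivalent (by omega)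
  rw [Finset.singleton_subset_iff] at hSM
  have hF : IsLaminar r (M.erase S) := hM.subset (Finset.erase_subset S M)
  have hc : (M.erase S).card + 4 = n := by
    have := Finset.card_pos.2 ⟨S, hSM⟩
    rw [Finset.card_erase_of_mem hSM]
    omega
  refine ⟨typeCone (M.erase S), (hF.mem_vitalDivisor_cones_iff hc).2 ?_⟩
  rw [hF.vitalWeight_of_notMem hc hr (Finset.notMem_erase S M), if_pos]
  · exact one_ne_zero
  · exact mem_resolutions.2 ⟨Finset.notMem_erase S M, by rwa [Finset.insert_erase hSM]⟩

end VitalDivisor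
end TropM

/-! ### Failure of local irreducibility -/

namespace TropM
section LocalReducibility

variable {n : ℕ} {r : Fin n} {F : Finset (Finset (Fin n))} {S A B C : Finset (Fin n)}

theorem IsLaminar.resolutions_eq (hF : IsLaminar r F) (hc : F.card + 4 = n)
    (hres : ∀ I ∈ ({A ∪ B, A ∪ C, B ∪ C} : Finset (Finset (Fin n))),
      I ∉ F ∧ IsLaminar r (insert I F))
    (hcard : ({A ∪ B, A ∪ C, B ∪ C} : Finset (Finset (Fin n))).card = 3) :
    resolutions r F = {A ∪ B, A ∪ C, B ∪ C} :=
  (Finset.eq_of_subset_of_card_le (fun I hI => mem_resolutions.2 (hres I hI))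
    (by rw [card_resolutions hF hc, hcard])).symm

theorem sum_splitVec_unions (dAB : Disjoint A B) (dAC : Disjoint A C) (dBC : Disjoint B C)
    (hcard : ({A ∪ B, A ∪ C, B ∪ C} : Finset (Finset (Fin n))).card = 3) :
    ∑ I ∈ ({A ∪ B, A ∪ C, B ∪ C} : Finset (Finset (Fin n))), splitVec I =
      splitVec A + splitVec B + splitVec C + splitVec (A ∪ B ∪ C) := by
  have h1 : A ∪ C ≠ B ∪ C := by
    intro h
    rw [h, Finset.pair_eq_singleton] at hcard
    have := Finset.card_le_two (a := A ∪ B) (b := B ∪ C)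
    omega
  have h2 : A ∪ B ∉ ({A ∪ C, B ∪ C} : Finset (Finset (Fin n))) := by
    intro h
    rw [Finset.insert_eq_of_mem h, Finset.card_pair h1] at hcard
    omega
  rw [Finset.sum_insert h2, Finset.sum_pair h1, ← add_assoc, splitVec_union_add dAB dAC dBC]

theorem IsLaminar.vitalWeight_eq_neg_one (hF : IsLaminar r F) (hc : F.card + 4 = n) (hSF : S ∈ F)
    (hsum : ∑ I ∈ resolutions r F, splitVec I = splitVec S) : vitalWeight S F = -1 := by
  obtain ⟨f, hf⟩ := hF.exists_length_form S
  rw [hF.vitalWeight_of_mem hc hSF hf, hsum, hf S hSF, if_pos rfl]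

instance (I J : Finset (Fin n)) : Decidable (Nested I J) :=
  inferInstanceAs (Decidable (Disjoint I J ∨ I ⊆ J ∨ J ⊆ I))

instance (I : Finset (Fin n)) : Decidable (IsProper I) :=
  inferInstanceAs (Decidable (2 ≤ I.card ∧ I.card + 2 ≤ n))

theorem isLaminar_iff : IsLaminar r F ↔
    (∀ I ∈ F, r ∉ I) ∧ (∀ I ∈ F, IsProper I) ∧ ∀ I ∈ F, ∀ J ∈ F, Nested I J :=
  ⟨fun h => ⟨h.root, h.proper, h.nested⟩, fun h => ⟨h.1, h.2.1, h.2.2⟩⟩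

instance : Decidable (IsLaminar r F) := decidable_of_iff' _ isLaminar_iff

/-- In `M_{0,6}`, the weight in `D^{0, 1, 2}` of the cone of the curves with an edge separating
`{0, 1, 2}` from `{3, 4, 5}` and an edge separating two markings in `{0, 1, 2}` from the others. The
4-valent vertex of such a curve lies on the side of `3, 4, 5`. -/
theorem vitalWeight_pair_left {I : Finset (Fin 6)}
    (hI : I ∈ ({{0} ∪ {1}, {0} ∪ {2}, {1} ∪ {2}} : Finset (Finset (Fin 6)))) :
    vitalWeight {0, 1, 2} {I, {0, 1, 2}} = -1 := by
  have hl : ∀ I ∈ ({{0} ∪ {1}, {0} ∪ {2}, {1} ∪ {2}} : Finset (Finset (Fin 6))),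
      IsLaminar 5 {I, {0, 1, 2}} ∧ ({I, {0, 1, 2}} : Finset (Finset (Fin 6))).card = 2 ∧
        ∀ J ∈ ({{0, 1, 2} ∪ {3}, {0, 1, 2} ∪ {4}, {3} ∪ {4}} : Finset (Finset (Fin 6))),
          J ∉ ({I, {0, 1, 2}} : Finset (Finset (Fin 6))) ∧
            IsLaminar 5 (insert J {I, {0, 1, 2}}) := by
    set_option maxRecDepth 10000 in decide
  obtain ⟨h1, h2, h3⟩ := hl I hI
  refine h1.vitalWeight_eq_neg_one (by rw [h2]) (by simp) ?_
  rw [h1.resolutions_eq (by rw [h2]) h3 (by decide), sum_splitVec_unions (by decide) (by decide)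
    (by decide) (by decide), splitVec_singleton, splitVec_singleton, add_zero, add_zero,
    show ({0, 1, 2} ∪ {3} ∪ {4} : Finset (Fin 6)) = {5}ᶜ by decide, splitVec_compl_singleton,
    add_zero]

theorem sum_splitVec_pair_left :
    ∑ I ∈ ({{0} ∪ {1}, {0} ∪ {2}, {1} ∪ {2}} : Finset (Finset (Fin 6))), splitVec I =
      splitVec {0, 1, 2} := by
  rw [sum_splitVec_unions (by decide) (by decide) (by decide) (by decide), splitVec_singleton,
    splitVec_singleton, splitVec_singleton, add_zero, add_zero, zero_add,
    show ({0} ∪ {1} ∪ {2} : Finset (Fin 6)) = {0, 1, 2} by decide]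

theorem vitalWeight_pair_right :
    vitalWeight {0, 1, 2} {{3, 4}, ({0, 1, 2} : Finset (Fin 6))} = -1 := by
  have h1 : IsLaminar 5 {{3, 4}, ({0, 1, 2} : Finset (Fin 6))} := by decide
  refine h1.vitalWeight_eq_neg_one rfl (by simp) ?_
  rw [h1.resolutions_eq (A := {0}) (B := {1}) (C := {2}) rfl
    (by set_option maxRecDepth 10000 in decide) (by decide), sum_splitVec_pair_left]

/-- At the ray of `v_S`, where `S = {0, 1, 2}`, the adjacent cones of the vital divisor arise by
resolving one of the two ends of the edge `S`. The cones resolving one end balance without those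
resolving the other one. -/
theorem not_isLocallyIrreducible_vitalDivisor :
    ¬ (vitalDivisor ({0, 1, 2} : Finset (Fin 6))).IsLocallyIrreducible (lattice 6) := by
  classical
  intro hloc
  have hS : IsLaminar 5 {({0, 1, 2} : Finset (Fin 6))} := by decide
  let T : Finset (Finset (Fin 6)) := {{0} ∪ {1}, {0} ∪ {2}, {1} ∪ {2}}
  have hT : ∀ I ∈ T, I ∈ resolutions 5 {{0, 1, 2}} := by
    have : ∀ I ∈ T, I ∉ ({{0, 1, 2}} : Finset (Finset (Fin 6))) ∧ IsLaminar 5 {I, {0, 1, 2}} := by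
      decide
    exact fun I hI => mem_resolutions.2 (this I hI)
  have h34 : {3, 4} ∈ resolutions 5 {({0, 1, 2} : Finset (Fin 6))} :=
    mem_resolutions.2 (by decide)
  have hinj : ∀ I ∈ resolutions 5 {({0, 1, 2} : Finset (Fin 6))},
      typeCone {I, {0, 1, 2}} ∈ T.image (fun I => typeCone {I, {0, 1, 2}}) ↔ I ∈ T := by
    intro I hI
    refine ⟨fun h => ?_, Finset.mem_image_of_mem _⟩
    obtain ⟨J, hJ, hJI⟩ := Finset.mem_image.1 h
    have h2 := (mem_resolutions.1 (hT J hJ)).2.typeCone_injective (mem_resolutions.1 hI).2 hJI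
    have h3 : I ∈ ({J, {0, 1, 2}} : Finset (Finset (Fin 6))) := h2 ▸ Finset.mem_insert_self I _
    rcases Finset.mem_insert.1 h3 with rfl | h4
    exacts [hJ, absurd h4 (mem_resolutions.1 hI).1]
  have hw34 := vitalWeight_pair_right
  have hstar34 := mem_star_vitalDivisor hS rfl h34 (by rw [hw34]; norm_num)
  have hstar01 := mem_star_vitalDivisor (I := {0} ∪ {1}) hS rfl (hT _ (by decide))
    (by rw [vitalWeight_pair_left (by decide)]; norm_num)
  -- the weights supported on the cones that separate two of the markings `0, 1, 2`
  have hbal : (vitalDivisor ({0, 1, 2} : Finset (Fin 6))).BalancedAt (lattice 6)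
      (fun σ => ((if σ ∈ T.image (fun I => typeCone {I, {0, 1, 2}}) then 1 else 0 : ℚ) : ℝ))
      (typeCone {{0, 1, 2}}) := by
    refine ⟨normalVec (lattice 6) (typeCone {{0, 1, 2}}), fun σ hσ => ?_, ?_⟩
    · rw [hS.star_eq vitalDivisor_cones_subset] at hσ
      obtain ⟨I, hI, rfl⟩ := Finset.mem_image.1 hσ
      exact isPrimitiveNormal_normalVec (Finset.mem_filter.1 hI).1
    · rw [hS.sum_star_vitalDivisor rfl]
      have h1 : ∀ I ∈ (resolutions 5 {({0, 1, 2} : Finset (Fin 6))}).filter fun I =>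
          vitalWeight {0, 1, 2} {I, {0, 1, 2}} ≠ 0, I ∉ T →
          ((if typeCone {I, {0, 1, 2}} ∈ T.image (fun I => typeCone {I, {0, 1, 2}})
            then 1 else 0 : ℚ) : ℝ) • normalVec (lattice 6) (typeCone {{0, 1, 2}})
              (typeCone {I, {0, 1, 2}}) = 0 := by
        intro I hI hIT
        rw [if_neg fun h => hIT ((hinj I (Finset.mem_filter.1 hI).1).1 h), Rat.cast_zero, zero_smul]
      rw [← Finset.sum_subset (s₁ := T) (fun I hI => Finset.mem_filter.2 ⟨hT I hI, by
        rw [vitalWeight_pair_left hI]; norm_num⟩) h1]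
      have h2 : ∑ I ∈ T, (normalVec (lattice 6) (typeCone {{0, 1, 2}})
          (typeCone {I, {0, 1, 2}}) - splitVec I) ∈ linSpan (typeCone {{0, 1, 2}}) :=
        Submodule.sum_mem _ fun I hI => normalVec_sub_mem (hT I hI)
      rw [Finset.sum_sub_distrib, sum_splitVec_pair_left] at h2
      have h3 := Submodule.add_mem _ h2 (splitVec_mem_linSpan (Finset.mem_singleton_self _))
      rw [sub_add_cancel] at h3
      convert h3 using 1
      refine Finset.sum_congr rfl fun I hI => ?_
      rw [if_pos ((hinj I (hT I hI)).2 hI), Rat.cast_one, one_smul]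
  obtain ⟨c, hc⟩ := hloc (typeCone {{0, 1, 2}})
    ((isTropicalFan_vitalDivisor (by norm_num) (by decide : (5 : Fin 6) ∉ _)).face_mem _
      (WeightedFan.mem_star.1 hstar34).1 _ (WeightedFan.mem_star.1 hstar34).2.2)
    (by rw [hS.coneDim_typeCone, vitalDivisor_dim]; rfl)
    (fun σ => if σ ∈ T.image (fun I => typeCone {I, {0, 1, 2}}) then 1 else 0) hbal
  -- the candidate weight vanishes at `{3, 4}`, where the weight of the divisor does not
  have h1 := hc _ hstar34
  have h2 := hc _ hstar01
  rw [if_neg fun h => absurd ((hinj _ h34).1 h) (by decide), vitalDivisor_weight, hw34] at h1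
  rw [if_pos ((hinj _ (hT _ (by decide))).2 (by decide))] at h2
  have h3 : (c : ℝ) = 0 := by
    push_cast at h1
    linarith
  rw [h3] at h2
  norm_num at h2

end LocalReducibility
end TropM

theorem mainTheorem3 :
    (∀ n : ℕ, 3 < n → ∀ S : Finset (Fin n), 2 ≤ S.card → S.card + 2 ≤ n →
      (TropM.vitalDivisor S).IsIrreducible (TropM.lattice n)) ∧
    ¬ (TropM.vitalDivisor ({0, 1, 2} : Finset (Fin 6))).IsLocallyIrreducible
      (TropM.lattice 6) :=
  ⟨fun _ hn _ h1 h2 => TropM.isIrreducible_vitalDivisor hn ⟨h1, h2⟩,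
    TropM.not_isLocallyIrreducible_vitalDivisor⟩
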